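/- For $\beta\in\{0,1\}$ and $n\ge 0$ let $c\psi_{2,\beta}(n)$ be the number of arrays $\begin{pmatrix}a_1&\dots&a_r\\ b_1&\dots&b_s\end{pmatrix}$ whose entries belong to two copies (colours) of $\mathbb{Z}_{\ge 0}$, whose rows are strictly decreasing for the lexicographic order, and which satisfy $r-s=\beta-1$ and $n=r+\sum a_i+\sum b_j$ (the empty array is admitted for $\beta=1$, $n=0$). Let $\mathrm{C}\Psi_{2,\beta}(q)=\sum_{n\ge 0}c\psi_{2,\beta}(n)q^n$, and for $\alpha\ge 1$, with $a\in\{0,1\}$, $a\equiv\alpha\pmod 2$ and $q=e^{2\pi i\tau}$, $\tau\in\mathbb{H}$, let $$L_\alpha^{(\beta)}=\frac{1}{\mathrm{C}\Psi_{2,\beta}(q^{1+4a})}\sum_{3\cdot 2^{\beta+1}n\equiv(-1)^{\beta+1}\bmod 5^\alpha}c\psi_{2,\beta}(n)\,q^{\lfloor n/5^\alpha\rfloor+\beta}.$$ Let $$t=\frac{\eta(5\tau)^6}{\eta(\tau)^6},\qquad x=\frac{\eta(2\tau)\eta(10\tau)^3}{\eta(\tau)^3\eta(5\tau)},\qquad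 y=\frac{\eta(2\tau)^2\eta(4\tau)\eta(5\tau)\eta(20\tau)^3}{\eta(\tau)^5\eta(10\tau)^2},$$ where $t$ is the Hauptmodul of $\mathrm{X}_0(5)$, and let \begin{align*} p_0^{(1)}&=85t+625t^2-24x-64x^2-4y-1000ty-12500t^2y+992xy+12000txy+3520x^2y+40000tx^2y,\\ p_1^{(1)}&=t+25t^2-8tx-4y-8ty-500t^2y-32xy+480txy-64x^2y+1600tx^2y,\\ p_0^{(0)}&=1+5t+64x+600tx+208x^2+2000tx^2+4y+1000ty+12500t^2y-992xy-12000txy-3520x^2y-40000tx^2y,\\ p_1^{(0)}&=1+9t+8x+64tx+16x^2+80tx^2+4y+8ty+500t^2y+32xy-480txy+64x^2y-1600tx^2y. \end{align*} Inside the field of meromorphic functions on $\mathbb{H}$ put $\mathcal{R}^{(\beta)}=\mathbb{C}(t)+p_0^{(\beta)}\mathbb{C}(t)+p_1^{(\beta)}\mathbb{C}(t)$, and let $\mathcal{A}^{(\beta)}=\mathbb{C}(t)[p_0^{(\beta)},p_1^{(\beta)}]$ be the ring generated by $\mathcal{R}^{(\beta)}$. Then for each $\beta\in\{0,1\}$ there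 is a unique ring homomorphism $\sigma^{(\beta)}:\mathcal{A}^{(\beta)}\to\mathcal{A}^{(1-\beta)}$ that fixes every element of $\mathbb{C}(t)$ (in particular $t$) and satisfies $\sigma^{(\beta)}(p_a^{(\beta)})=p_a^{(1-\beta)}$ for $a=0,1$. It is an isomorphism, it maps $\mathcal{R}^{(\beta)}$ onto $\mathcal{R}^{(1-\beta)}$, and for every $\alpha\ge 1$ one has $L_\alpha^{(\beta)}\in\mathcal{R}^{(\beta)}$ and $$\sigma^{(\beta)}\bigl(L_\alpha^{(\beta)}\bigr)=L_\alpha^{(1-\beta)}.$$ Moreover $\sigma^{(1)}$ is $f(\tau)\mapsto f(\gamma\tau)$ and $\sigma^{(0)}$ is $f(\tau)\mapsto f(\gamma^{-1}\tau)$, with $\gamma=\begin{pmatrix}27&7\\50&13\end{pmatrix}\in\Gamma_0(10)$. The congruence families of $c\psi_{2,1}$ and $c\psi_{2,0}$ are equivalent: for every $\alpha\ge 1$, $5^\alpha\mid c\psi_{2,1}(n)$ for all $n\ge 0$ with $12n\equiv 1\pmod{5^\alpha}$ if and only if $5^\alpha\mid c\psi_{2,0}(n)$ for all $n\ge 0$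 with $6n\equiv -1\pmod{5^\alpha}$. -/

import Mathlib

open UpperHalfPlane
open scoped Manifold MatrixGroups

noncomputable section

namespace FrobeniusPairs

/-! ### Generalized Frobenius partitions -/

/-- A row with entries in `k` copies of `ℤ≥0`; `(a, c)` is the integer `a` in the copy (colour) `c`.
A row that is (strictly) decreasing for the lexicographic order is determined by its set of
entries, and every finite set of entries occurs. -/
abbrev Row (k : ℕ) : Type := Finset (ℕ × Fin k)

/-- For an array with top row `a₁, …, a_r` and bottom row `b₁, …, b_s`: `r + ∑ aᵢ + ∑ bⱼ`. -/
def weight {k : ℕ} (P : Row k × Row k) : ℕ :=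
  P.1.card + ∑ a ∈ P.1, a.1 + ∑ b ∈ P.2, b.1

/-- The `(k, β)`-coloured generalized Frobenius partitions of `n`: the arrays with
`r - s = β - k / 2` and `n = r + ∑ aᵢ + ∑ bⱼ`. (An array with `r = s = 0` has weight `0`, so the
requirement `r + s ≠ 0` is automatic for `n ≥ 1`; for `n = 0` the empty array is admitted.) -/
def frobeniusPartitions (k : ℕ) (β : ℚ) (n : ℕ) : Set (Row k × Row k) :=
  {P | (P.1.card : ℚ) - (P.2.card : ℚ) = β - (k : ℚ) / 2 ∧ weight P = n}

/-- `cψ_{2,β}(n)` for `β ∈ {0, 1}`. -/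
def cpsi (β : Fin 2) (n : ℕ) : ℕ := (frobeniusPartitions 2 ((β : ℕ) : ℚ) n).ncard

/-- The residue class of index `α`: `3 · 2^(β+1) · n ≡ (-1)^(β+1) (mod 5^α)`. -/
def InClass (β : Fin 2) (α n : ℕ) : Prop :=
  3 * 2 ^ ((β : ℕ) + 1) * (n : ℤ) ≡ (-1) ^ ((β : ℕ) + 1) [ZMOD 5 ^ α]

/-- The `α`-th member of the congruence family of `cψ_{2,β}`. -/
def CongruenceAt (β : Fin 2) (α : ℕ) : Prop :=
  ∀ n : ℕ, InClass β α n → 5 ^ α ∣ cpsi β n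

/-- The generating function `CΨ_{2,β}(q)`. -/
def CPsi (β : Fin 2) (q : ℂ) : ℂ := ∑' n : ℕ, (cpsi β n : ℂ) * q ^ n

/-- `∑ cψ_{2,β}(n) q^(⌊n / 5^α⌋ + β)`, over the `n` in the residue class of index `α`. -/
def classSum (β : Fin 2) (α : ℕ) (q : ℂ) : ℂ :=
  ∑' n : {n : ℕ // InClass β α n}, (cpsi β n : ℂ) * q ^ ((n : ℕ) / 5 ^ α + (β : ℕ))

/-! ### Holomorphic and meromorphic functions on the upper half-plane -/

/-- The ring of holomorphic functions on the upper half-plane. -/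
def Hol : Subalgebra ℂ (ℍ → ℂ) where
  carrier := {f | MDifferentiable 𝓘(ℂ) 𝓘(ℂ) f}
  mul_mem' hf hg := by
    simp only [Set.mem_ofPred_eq] at *
    exact hf.mul hg
  add_mem' hf hg := by
    simp only [Set.mem_ofPred_eq] at *
    exact hf.add hg
  algebraMap_mem' c := by
    simp only [Set.mem_ofPred_eq]
    exact mdifferentiable_const

instance : Nontrivial Hol :=
  ⟨⟨0, 1, fun h => zero_ne_one (α := ℂ) (congrFun (congrArg Subtype.val h) UpperHalfPlane.I)⟩⟩

instance : NoZeroDivisors Hol where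
  eq_zero_or_eq_zero_of_mul_eq_zero {f g} h := by
    have h' : (f : ℍ → ℂ) * (g : ℍ → ℂ) = 0 := congrArg Subtype.val h
    exact ((UpperHalfPlane.mul_eq_zero_iff f.2 g.2).mp h').imp
      (fun h => Subtype.ext h) (fun h => Subtype.ext h)

instance : IsDomain Hol := NoZeroDivisors.to_isDomain _

/-- The field of meromorphic functions on the upper half-plane (quotients of holomorphic ones). -/
abbrev Mer : Type := FractionRing Hol

/-- A holomorphic function as an element of the field of meromorphic functions. -/
abbrev toMer (f : ℍ → ℂ) (hf : f ∈ Hol) : Mer := algebraMap Hol Mer ⟨f, hf⟩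

theorem comp_mem (g : SL(2, ℤ)) {f : ℍ → ℂ} (hf : f ∈ Hol) : (fun τ => f (g • τ)) ∈ Hol := by
  change MDifferentiable 𝓘(ℂ) 𝓘(ℂ) _
  have h : MDifferentiable 𝓘(ℂ) 𝓘(ℂ) (fun τ : ℍ => g • τ) := by
    have := UpperHalfPlane.mdifferentiable_smul
      (g := ((g : SL(2, ℝ)) : GL (Fin 2) ℝ)) (by simp)
    exact this
  exact MDifferentiable.comp (show MDifferentiable 𝓘(ℂ) 𝓘(ℂ) f from hf) h

/-- `f(τ) ↦ f(gτ)` on holomorphic functions. -/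
def holComp (g : SL(2, ℤ)) : Hol ≃+* Hol where
  toFun f := ⟨fun τ => (f : ℍ → ℂ) (g • τ), comp_mem g f.2⟩
  invFun f := ⟨fun τ => (f : ℍ → ℂ) (g⁻¹ • τ), comp_mem g⁻¹ f.2⟩
  left_inv f := by ext τ; simp
  right_inv f := by ext τ; simp
  map_mul' _ _ := rfl
  map_add' _ _ := rfl

/-- `f(τ) ↦ f(gτ)` on meromorphic functions. -/
def merComp (g : SL(2, ℤ)) : Mer ≃+* Mer :=
  IsFractionRing.ringEquivOfRingEquiv (holComp g)

/-- The matrix with rows `(27, 7)` and `(50, 13)`. -/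
def gam : SL(2, ℤ) := ⟨!![27, 7; 50, 13], by norm_num [Matrix.det_fin_two_of]⟩

/-! ### The functions `t`, `x`, `y` and the module generators -/

/-- `τ ↦ η(d τ)` is holomorphic. -/
theorem eta_mem (d : ℕ) (hd : 0 < d) : (fun τ : ℍ => ModularForm.eta (d * τ)) ∈ Hol := by
  change MDifferentiable 𝓘(ℂ) 𝓘(ℂ) _
  rw [UpperHalfPlane.mdifferentiable_iff]
  intro z hz
  have hz' : 0 < z.im := hz
  have him : (d * z : ℂ) ∈ upperHalfPlaneSet := by
    change 0 < (d * z : ℂ).im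
    simpa using mul_pos (Nat.cast_pos.mpr hd) hz'
  have h1 : DifferentiableAt ℂ (fun w : ℂ => ModularForm.eta (d * w)) z :=
    (ModularForm.differentiableAt_eta_of_mem_upperHalfPlaneSet him).comp z (by fun_prop)
  refine (h1.congr_of_eventuallyEq ?_).differentiableWithinAt
  filter_upwards [isOpen_upperHalfPlaneSet.mem_nhds hz] with w hw
  simp [ofComplex_apply_of_im_pos hw]

/-- The function `τ ↦ η(d τ)`. -/
def etaAt (d : ℕ) (hd : 0 < d := by norm_num) : Mer := toMer _ (eta_mem d hd)

/-- The Hauptmodul `t = η(5τ)⁶ / η(τ)⁶` of `X₀(5)`. -/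
def t : Mer := etaAt 5 ^ 6 / etaAt 1 ^ 6

/-- `x = η(2τ) η(10τ)³ / (η(τ)³ η(5τ))`. -/
def x : Mer := etaAt 2 * etaAt 10 ^ 3 / (etaAt 1 ^ 3 * etaAt 5)

/-- `y = η(2τ)² η(4τ) η(5τ) η(20τ)³ / (η(τ)⁵ η(10τ)²)`. -/
def y : Mer := etaAt 2 ^ 2 * etaAt 4 * etaAt 5 * etaAt 20 ^ 3 / (etaAt 1 ^ 5 * etaAt 10 ^ 2)

/-- `p_0^{(1)}` -/
def p10 : Mer :=
  85 * t + 625 * t ^ 2 - 24 * x - 64 * x ^ 2 - 4 * y - 1000 * t * y - 12500 * t ^ 2 * y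
    + 992 * x * y + 12000 * t * x * y + 3520 * x ^ 2 * y + 40000 * t * x ^ 2 * y

/-- `p_1^{(1)}` -/
def p11 : Mer :=
  t + 25 * t ^ 2 - 8 * t * x - 4 * y - 8 * t * y - 500 * t ^ 2 * y - 32 * x * y
    + 480 * t * x * y - 64 * x ^ 2 * y + 1600 * t * x ^ 2 * y

/-- `p_0^{(0)}` -/
def p00 : Mer :=
  1 + 5 * t + 64 * x + 600 * t * x + 208 * x ^ 2 + 2000 * t * x ^ 2 + 4 * y + 1000 * t * y
    + 12500 * t ^ 2 * y - 992 * x * y - 12000 * t * x * y - 3520 * x ^ 2 * y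
    - 40000 * t * x ^ 2 * y

/-- `p_1^{(0)}` -/
def p01 : Mer :=
  1 + 9 * t + 8 * x + 64 * t * x + 16 * x ^ 2 + 80 * t * x ^ 2 + 4 * y + 8 * t * y
    + 500 * t ^ 2 * y + 32 * x * y - 480 * t * x * y + 64 * x ^ 2 * y - 1600 * t * x ^ 2 * y

/-- `p β a` is `p_a^{(β)}`. -/
def p (β a : Fin 2) : Mer :=
  match β, a with
  | 0, 0 => p00
  | 0, 1 => p01
  | 1, 0 => p10
  | 1, 1 => p11

/-- The field `ℂ(t)`. -/
def Ct : IntermediateField ℂ Mer := IntermediateField.adjoin ℂ {t}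

/-- `R^{(β)} = ℂ(t) + p_0^{(β)} ℂ(t) + p_1^{(β)} ℂ(t)`. -/
def R (β : Fin 2) : Submodule Ct Mer := Submodule.span Ct {1, p β 0, p β 1}

/-- The ring `ℂ(t)[p_0^{(β)}, p_1^{(β)}]` generated by `R^{(β)}`. -/
def A (β : Fin 2) : Subalgebra Ct Mer := Algebra.adjoin Ct {p β 0, p β 1}

theorem R_le_A (β : Fin 2) {f : Mer} (hf : f ∈ R β) : f ∈ A β := by
  have h : R β ≤ Subalgebra.toSubmodule (A β) := by
    refine Submodule.span_le.mpr ?_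
    rintro g (rfl | rfl | rfl)
    · exact (A β).one_mem
    · exact Algebra.subset_adjoin (by simp)
    · exact Algebra.subset_adjoin (by simp)
  exact h hf

theorem p_mem_R (β a : Fin 2) : p β a ∈ R β := by
  refine Submodule.subset_span ?_
  fin_cases a <;> simp

/-! ### The functions `L_α^{(β)}` -/

/-- Power series in `q = exp(2πiτ)` that converge absolutely in the unit disc are holomorphic. -/
theorem qsum_mem {ι : Type*} (c : ι → ℕ) (e : ι → ℕ)
    (h : ∀ r : ℝ, 0 < r → r < 1 → Summable fun i => (c i : ℝ) * r ^ e i) (m : ℕ) (hm : 0 < m) :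
    (fun τ : ℍ => ∑' i, (c i : ℂ) * (Function.Periodic.qParam 1 τ ^ m) ^ e i) ∈ Hol := by
  have key : DifferentiableOn ℂ (fun q : ℂ => ∑' i, (c i : ℂ) * q ^ e i) (Metric.ball 0 1) := by
    intro q hq
    have hq1 : ‖q‖ < 1 := by simpa using hq
    obtain ⟨r, hqr, hr1⟩ := exists_between hq1
    have hr0 : 0 < r := (norm_nonneg q).trans_lt hqr
    have hd := Complex.differentiableOn_tsum_of_summable_norm (F := fun i (q : ℂ) => (c i : ℂ) * q ^ e i)
      (U := Metric.ball 0 r) (h r hr0 hr1) (fun i => by fun_prop) Metric.isOpen_ball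
      (fun i w hw => by
        have hw' : ‖w‖ ≤ r := by
          have : ‖w‖ < r := by simpa using hw
          exact this.le
        rw [norm_mul, norm_pow, Complex.norm_natCast]
        gcongr)
    exact (hd.differentiableAt (Metric.isOpen_ball.mem_nhds (by simpa using hqr))).differentiableWithinAt
  change MDifferentiable 𝓘(ℂ) 𝓘(ℂ) _
  rw [UpperHalfPlane.mdifferentiable_iff]
  intro z hz
  have hn : ‖Function.Periodic.qParam 1 z‖ < 1 := by
    simpa using norm_qParam_lt_one 1 ⟨z, hz⟩
  have hball : Function.Periodic.qParam 1 z ^ m ∈ Metric.ball (0 : ℂ) 1 := by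
    simpa using pow_lt_one₀ (norm_nonneg _) hn hm.ne'
  have h1 := ((key.differentiableAt (Metric.isOpen_ball.mem_nhds hball)).comp z
    (f := fun w : ℂ => Function.Periodic.qParam 1 w ^ m) (by fun_prop))
  refine (h1.congr_of_eventuallyEq ?_).differentiableWithinAt
  filter_upwards [isOpen_upperHalfPlaneSet.mem_nhds hz] with w hw
  simp [ofComplex_apply_of_im_pos hw]

theorem summable_cpsi (β : Fin 2) (r : ℝ) (h0 : 0 < r) (h1 : r < 1) :
    Summable fun n => (cpsi β n : ℝ) * r ^ n := by
  have hg : Summable fun n : ℕ => r ^ n := summable_geometric_of_lt_one h0.le h1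
  have hrow : Summable fun a : ℕ × Fin 2 => r ^ a.1 := by
    have := hg.mul_of_nonneg (g := fun _ : Fin 2 => (1 : ℝ)) (summable_of_hasFiniteSupport
      (Set.toFinite _)) (fun n => by positivity) (fun _ => zero_le_one)
    simpa using this
  have hb := summable_finsetProd_of_summable_nonneg (fun a : ℕ × Fin 2 => by positivity) hrow
  have ht := summable_finsetProd_of_summable_nonneg
    (f := fun a : ℕ × Fin 2 => r * r ^ a.1) (fun a => by positivity) (hrow.mul_left r)
  have hP : Summable fun P : Row 2 × Row 2 => r ^ weight P := by
    refine (ht.mul_of_nonneg hb (fun _ => Finset.prod_nonneg fun _ _ => by positivity)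
      (fun _ => Finset.prod_nonneg fun _ _ => by positivity)).congr fun P => ?_
    rw [Finset.prod_mul_distrib, Finset.prod_const, Finset.prod_pow_eq_pow_sum,
      Finset.prod_pow_eq_pow_sum, ← pow_add, ← pow_add, weight]
  let S : Set (Row 2 × Row 2) :=
    {P | (P.1.card : ℚ) - (P.2.card : ℚ) = ((β : ℕ) : ℚ) - ((2 : ℕ) : ℚ) / 2}
  have hS : Summable fun P : S => r ^ weight (P : Row 2 × Row 2) := hP.subtype S
  have hsig := ((Equiv.sigmaFiberEquiv
    (fun P : S => weight (P : Row 2 × Row 2))).summable_iff.mpr hS).sigma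
  refine hsig.congr fun n => ?_
  have hc : ∀ P : {P : S // weight (P : Row 2 × Row 2) = n},
      ((fun P : S => r ^ weight (P : Row 2 × Row 2)) ∘
        (Equiv.sigmaFiberEquiv (fun P : S => weight (P : Row 2 × Row 2)))) ⟨n, P⟩ = r ^ n := by
    intro P
    simp [Equiv.sigmaFiberEquiv, P.2]
  rw [tsum_congr hc, tsum_const, nsmul_eq_mul]
  congr 2
  rw [cpsi, ← Nat.card_coe_set_eq]
  exact Nat.card_congr
    { toFun := fun P => ⟨P.1.1, P.1.2, P.2⟩
      invFun := fun P => ⟨⟨P.1, P.2.1⟩, P.2.2⟩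
      left_inv := fun _ => rfl
      right_inv := fun _ => rfl }

theorem summable_class (β : Fin 2) (α : ℕ) (r : ℝ) (h0 : 0 < r) (h1 : r < 1) :
    Summable fun n : {n : ℕ // InClass β α n} =>
      (cpsi β n : ℝ) * r ^ ((n : ℕ) / 5 ^ α + (β : ℕ)) := by
  obtain ⟨s, hs0, hs1, hs⟩ : ∃ s : ℝ, 0 < s ∧ s < 1 ∧ s ^ (5 ^ α) = r := by
    refine ⟨r ^ (((5 ^ α : ℕ) : ℝ)⁻¹), by positivity, ?_, ?_⟩
    · exact Real.rpow_lt_one h0.le h1 (by positivity)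
    · exact Real.rpow_inv_natCast_pow h0.le (by positivity)
  have hsum := ((summable_cpsi β s hs0 hs1).mul_left ((s ^ (5 ^ α))⁻¹)).subtype
    {n : ℕ | InClass β α n}
  refine Summable.of_nonneg_of_le (fun n => by positivity) (fun n => ?_) hsum
  have hle : (n : ℕ) ≤ 5 ^ α * ((n : ℕ) / 5 ^ α) + 5 ^ α := by
    have h5 : 0 < 5 ^ α := by positivity
    have := Nat.div_add_mod (n : ℕ) (5 ^ α)
    have := Nat.mod_lt (n : ℕ) h5
    omega
  have hp : r ^ ((n : ℕ) / 5 ^ α + (β : ℕ)) ≤ (s ^ (5 ^ α))⁻¹ * s ^ (n : ℕ) := by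
    calc r ^ ((n : ℕ) / 5 ^ α + (β : ℕ)) ≤ r ^ ((n : ℕ) / 5 ^ α) :=
          pow_le_pow_of_le_one h0.le h1.le (Nat.le_add_right _ _)
      _ = (s ^ (5 ^ α))⁻¹ * s ^ (5 ^ α * ((n : ℕ) / 5 ^ α) + 5 ^ α) := by
          rw [← hs, pow_add, ← pow_mul]
          field_simp
      _ ≤ (s ^ (5 ^ α))⁻¹ * s ^ (n : ℕ) := by
          gcongr ?_ * ?_
          exact pow_le_pow_of_le_one hs0.le hs1.le hle
  calc (cpsi β n : ℝ) * r ^ ((n : ℕ) / 5 ^ α + (β : ℕ))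
      ≤ (cpsi β n : ℝ) * ((s ^ (5 ^ α))⁻¹ * s ^ (n : ℕ)) := by gcongr
    _ = _ := by simp only [Function.comp_apply]; ring

theorem CPsi_mem (β : Fin 2) (m : ℕ) (hm : 0 < m) :
    (fun τ : ℍ => CPsi β (Function.Periodic.qParam 1 τ ^ m)) ∈ Hol :=
  qsum_mem (cpsi β) id (summable_cpsi β) m hm

theorem classSum_mem (β : Fin 2) (α : ℕ) :
    (fun τ : ℍ => classSum β α (Function.Periodic.qParam 1 τ)) ∈ Hol := by
  have := qsum_mem (fun n : {n : ℕ // InClass β α n} => cpsi β n)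
    (fun n => (n : ℕ) / 5 ^ α + (β : ℕ)) (summable_class β α) 1 one_pos
  simpa only [pow_one] using! this

/-- `L_α^{(β)} = CΨ_{2,β}(q^(1+4a))⁻¹ · ∑ cψ_{2,β}(n) q^(⌊n / 5^α⌋ + β)`, where `q = exp(2πiτ)` and
`a ∈ {0, 1}` has the parity of `α`. -/
def L (β : Fin 2) (α : ℕ) : Mer :=
  toMer (fun τ => classSum β α (Function.Periodic.qParam 1 τ)) (classSum_mem β α) /
    toMer (fun τ => CPsi β (Function.Periodic.qParam 1 τ ^ (1 + 4 * (α % 2))))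
      (CPsi_mem β (1 + 4 * (α % 2)) (by omega))

end FrobeniusPairs

end

noncomputable section

namespace FrobeniusPairs

/-! ### Pairs of finite sets of natural numbers and the Jacobi triple product -/

/-! Splitting an array by colour and grouping by charge expresses the generating functions through
theta functions. Up to a power of `q`, `η² CΨ_{2,β}` is `∑ q^((n+1/2)²)` for `β = 0` and `∑ q^(n²)`
for `β = 1` (`theta_eq_CPsi`). These two series are the components of one vector `theta`, which
transforms under SL(2,ℤ) with weight 1/2 through unitary 2×2 matrices. Up to the factor `5^α`,
`L_α^{(β)}` is the quotient of the `β`-components of two vectors: `W = thetaSum α`, a weighted sum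
over the points `(τ + 24j)/5^α`, and `Θ = theta(5^a τ)` (`thetaRatio_eq`).

Under Γ₀(5) the vectors `W` and `Θ` transform by the same matrix. An element of Γ₀(5) permutes the
points `(τ + 24j)/5^α`, with a unitary matrix for each of them. The plain average of `theta` over
these points is `Θ`, so the mean of these unitary matrices is again unitary, and this forces all of
them to be equal (`eq_of_sum_unitary`, `eq_of_sum_node`, `node_transforms`). A third vector `P =
grad a` with the same behaviour is the gradient of the octahedral form `XY(X⁴ - Y⁴)`, taken at the
theta vector of the other level (`gradEven_smul`, `gradOdd_smul`); here a level-5 theta identity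
(`wedge_theta`) is what links the matrices at `τ` and at `5τ`.

In dimension two, `W` is a combination of `Θ` and `P` whose coefficients are quotients of cross
products. Suitably normalised by eta functions, these coefficients are Γ₀(5)-invariant, holomorphic
on ℍ and of moderate growth, hence Laurent polynomials in the Hauptmodul `t` (`coeff_smul`,
`exists_polynomial_of_tame`). The quotient `P_β/Θ_β` is an affine function of `p_a^{(β)}` over ℂ(t)
(`genPoly_even`, `genPoly_odd`), which is a computation on the curve `4y² + y + 6xy = x²(1 + 5x)`.
So `D(t) L = F(t) + G(t) p_a` with polynomials `D ≠ 0`, `F`, `G` that do not depend on `β`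
(`exists_polynomials`).

The matrix `gam` lies in Γ₀(5) and acts on the vectors by antidiagonal matrices
(`VectorTransform.antidiagonal`). Composition with it therefore fixes `t` and interchanges the
components `β = 0` and `β = 1` in every quotient: this is `σ`.

For the congruences, the relation can be taken with integer polynomials (`exists_int_solution`),
since all `q`-expansions involved are integral. Modulo 5 the functions `1` and `p_a^{(β)}` are
independent over the polynomials in `t` (`genPoly_independent`). Hence a power of 5 that divides the
series for one `β` passes, after the power of 5 in `D` is split off, to `F` and `G`, and from there
to the series for the other `β` (`pow_five_dvd_of_relation`). -/

/-- Whether `0` belongs to a finite set, together with the set of predecessors of its positive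
elements. -/
def finsetNatEquiv : Finset ℕ ≃ Bool × Finset ℕ where
  toFun T := (decide (0 ∈ T), T.preimage Nat.succ (Nat.succ_injective.injOn))
  invFun x := if x.1 then insert 0 (x.2.image Nat.succ) else x.2.image Nat.succ
  left_inv T := by
    by_cases h : 0 ∈ T
    · ext n
      cases n <;> simp [h]
    · ext n
      cases n <;> simp [h]
  right_inv x := by
    obtain ⟨b, T⟩ := x
    cases b <;> ext <;> simp

lemma card_finsetNatEquiv_symm (b : Bool) (T : Finset ℕ) :
    (finsetNatEquiv.symm (b, T)).card = T.card + b.toNat := by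
  cases b
  · simp [finsetNatEquiv, Finset.card_image_of_injective _ Nat.succ_injective]
  · simp [finsetNatEquiv, Finset.card_image_of_injective _ Nat.succ_injective]

lemma sum_finsetNatEquiv_symm (b : Bool) (T : Finset ℕ) :
    ∑ i ∈ finsetNatEquiv.symm (b, T), i = ∑ i ∈ T, i + T.card := by
  cases b <;>
  simp [finsetNatEquiv, Finset.sum_image Nat.succ_injective.injOn, Finset.sum_add_distrib]

/-- The charge of a pair of finite sets. -/
def charge (P : Finset ℕ × Finset ℕ) : ℤ := P.1.card - P.2.card

/-- The weight of a pair of finite sets, `|S| + ∑ S + ∑ T`. -/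
def pairWeight (P : Finset ℕ × Finset ℕ) : ℕ := P.1.card + ∑ a ∈ P.1, a + ∑ b ∈ P.2, b

/-- The shift, which raises the charge by one. -/
def shiftPair : (Finset ℕ × Finset ℕ) ≃ (Finset ℕ × Finset ℕ) where
  toFun P := (finsetNatEquiv.symm (!(finsetNatEquiv P.2).1, P.1), (finsetNatEquiv P.2).2)
  invFun P := ((finsetNatEquiv P.1).2, finsetNatEquiv.symm (!(finsetNatEquiv P.1).1, P.2))
  left_inv P := by simp
  right_inv P := by simp

lemma charge_shiftPair (P : Finset ℕ × Finset ℕ) : charge (shiftPair P) = charge P + 1 := by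
  obtain ⟨S, T⟩ := P
  obtain ⟨⟨b, T'⟩, rfl⟩ := finsetNatEquiv.symm.surjective T
  cases b <;> simp [charge, shiftPair, card_finsetNatEquiv_symm] <;> ring

/-- Raising `S` by one adds `|S|`, lowering the positive part of `T` subtracts its cardinality, and
moving `0` contributes one in either case. The pairs are Maya diagrams, and the shift is a
translation of the diagram. -/
lemma pairWeight_shiftPair (P : Finset ℕ × Finset ℕ) :
    (pairWeight (shiftPair P) : ℤ) = pairWeight P + charge P + 1 := by
  obtain ⟨S, T⟩ := P
  obtain ⟨⟨b, T'⟩, rfl⟩ := finsetNatEquiv.symm.surjective T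
  cases b <;> simp [charge, pairWeight, shiftPair, card_finsetNatEquiv_symm,
    sum_finsetNatEquiv_symm] <;> ring

/-- The generating function of the pairs of charge `k`. -/
def chargeSum (q : ℂ) (k : ℤ) : ℂ := ∑' P : charge ⁻¹' {k}, q ^ pairWeight P

lemma chargeSum_add_one {q : ℂ} (hq : q ≠ 0) (k : ℤ) :
    chargeSum q (k + 1) = q ^ (k + 1) * chargeSum q k := by
  rw [chargeSum, chargeSum, ← tsum_mul_left]
  let e : (charge ⁻¹' {k} : Set _) ≃ (charge ⁻¹' {k + 1} : Set _) :=
    shiftPair.subtypeEquiv fun P => by simp [charge_shiftPair]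
  rw [← e.tsum_eq]
  refine tsum_congr fun P => ?_
  have h1 : (e P : Finset ℕ × Finset ℕ) = shiftPair P := rfl
  have h2 : charge P = k := P.2
  rw [h1, ← zpow_natCast, ← zpow_natCast, pairWeight_shiftPair, h2, ← zpow_add₀ hq]
  congr 1
  ring

/-- Iterating the shift multiplies by `q · q² ⋯ q^k`. Only the constant `chargeSum q 0` remains to
be found for the triple product. -/
lemma chargeSum_eq {q : ℂ} (hq : q ≠ 0) (k : ℤ) :
    chargeSum q k = q ^ (k * (k + 1) / 2) * chargeSum q 0 := by
  have key : ∀ k : ℤ, (k + 1) * (k + 1 + 1) / 2 = (k + 1) + k * (k + 1) / 2 := fun k => by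
    rw [show (k + 1) * (k + 1 + 1) = k * (k + 1) + (k + 1) * 2 by ring,
      Int.add_mul_ediv_right _ _ two_ne_zero, add_comm]
  induction k using Int.induction_on with
  | zero => simp
  | succ k ih => rw [chargeSum_add_one hq, ih, key, zpow_add₀ hq (_ + 1), mul_assoc]
  | pred k ih =>
    have h := chargeSum_add_one hq (-(k : ℤ) - 1)
    have hk := key (-(k : ℤ) - 1)
    have hs : -(k : ℤ) - 1 + 1 = -k := by ring
    rw [hs] at h hk ⊢
    rw [ih, hk, zpow_add₀ hq, mul_assoc] at h
    exact (mul_left_cancel₀ (zpow_ne_zero _ hq) h).symm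

lemma summable_pow_succ {q : ℂ} (hq : ‖q‖ < 1) (z : ℂ) :
    Summable fun n : ℕ => ‖z * q ^ (n + 1)‖ := by
  simp_rw [norm_mul, norm_pow]
  exact ((summable_nat_add_iff 1).mpr (summable_geometric_of_lt_one (norm_nonneg _) hq)).mul_left _

lemma summable_pow_mul {q : ℂ} (hq : ‖q‖ < 1) (z : ℂ) : Summable fun n : ℕ => ‖z * q ^ n‖ := by
  simp_rw [norm_mul, norm_pow]
  exact (summable_geometric_of_lt_one (norm_nonneg _) hq).mul_left _

lemma charge_pow_eq {q z : ℂ} (hz : z ≠ 0) (P : Finset ℕ × Finset ℕ) :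
    z ^ charge P * q ^ pairWeight P =
      (∏ a ∈ P.1, z * q ^ (a + 1)) * ∏ b ∈ P.2, z⁻¹ * q ^ b := by
  rw [Finset.prod_mul_distrib, Finset.prod_mul_distrib, Finset.prod_pow_eq_pow_sum,
    Finset.prod_pow_eq_pow_sum, Finset.prod_const, Finset.prod_const, Finset.sum_add_distrib,
    Finset.sum_const, smul_eq_mul, mul_one, charge, pairWeight, zpow_sub₀ hz, zpow_natCast,
    zpow_natCast, pow_add, pow_add, pow_add, inv_pow]
  field_simp

lemma summable_norm_charge {q z : ℂ} (hq : ‖q‖ < 1) (hz : z ≠ 0) :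
    Summable fun P => ‖z ^ charge P * q ^ pairWeight P‖ := by
  simp_rw [charge_pow_eq hz]
  have h1 := summable_finsetProd_of_summable_nonneg (fun _ => norm_nonneg _) (summable_pow_succ hq z)
  have h2 := summable_finsetProd_of_summable_nonneg (fun _ => norm_nonneg _) (summable_pow_mul hq z⁻¹)
  refine (h1.mul_of_nonneg h2 (fun _ => Finset.prod_nonneg fun _ _ => norm_nonneg _)
    (fun _ => Finset.prod_nonneg fun _ _ => norm_nonneg _)).congr fun P => ?_
  simp [norm_prod]

/-- Expand both products: `S` records the factors where `z q^(a+1)` is chosen, `T` those where `z⁻¹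
q^b` is chosen. -/
lemma hasSum_charge {q z : ℂ} (hq : ‖q‖ < 1) (hz : z ≠ 0) :
    HasSum (fun P => z ^ charge P * q ^ pairWeight P)
      ((∏' n : ℕ, (1 + z * q ^ (n + 1))) * ∏' n : ℕ, (1 + z⁻¹ * q ^ n)) := by
  have h1 := summable_finsetProd_of_summable_norm (summable_pow_succ hq z)
  have h2 := summable_finsetProd_of_summable_norm (summable_pow_mul hq z⁻¹)
  rw [tprod_one_add h1, tprod_one_add h2]
  have h3 := (summable_norm_charge hq hz).of_norm
  rw [funext (charge_pow_eq (q := q) hz)] at h3 ⊢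
  have h4 := h1.tsum_mul_tsum h2 h3
  rw [h4]
  exact h3.hasSum

lemma hasSum_chargeSum {q z : ℂ} (hq : ‖q‖ < 1) (hz : z ≠ 0) :
    HasSum (fun k : ℤ => z ^ k * chargeSum q k)
      ((∏' n : ℕ, (1 + z * q ^ (n + 1))) * ∏' n : ℕ, (1 + z⁻¹ * q ^ n)) := by
  refine ((hasSum_charge hq hz).tsum_fiberwise charge).congr_fun fun k => ?_
  rw [chargeSum, ← tsum_mul_left]
  refine tsum_congr fun P => ?_
  rw [show charge (P : Finset ℕ × Finset ℕ) = k from P.2]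

/-- The Euler product `∏ (1 - q ^ n)`. -/
def euler (q : ℂ) : ℂ := ∏' n : ℕ, (1 - q ^ (n + 1))

lemma one_sub_pow_ne_zero {q : ℂ} (hq : ‖q‖ < 1) {n : ℕ} (hn : n ≠ 0) : 1 - q ^ n ≠ 0 := by
  intro h
  have h1 : ‖q ^ n‖ = 1 := by rw [← sub_eq_zero.mp h, norm_one]
  rw [norm_pow] at h1
  exact (pow_lt_one₀ (norm_nonneg _) hq hn).ne h1

lemma euler_ne_zero {q : ℂ} (hq : ‖q‖ < 1) : euler q ≠ 0 := by
  have := tprod_one_add_ne_zero_of_summable (f := fun n : ℕ => -q ^ (n + 1))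
    (fun n => by
      rw [← sub_eq_add_neg]
      exact one_sub_pow_ne_zero hq n.succ_ne_zero) (by simpa using summable_pow_succ hq 1)
  simpa [euler, sub_eq_add_neg] using this

lemma tprod_residues {f : ℕ → ℂ} (m : ℕ) [NeZero m] (hf : Multipliable f)
    (hm : ∀ i < m, Multipliable fun n => f (m * n + i)) :
    ∏' n, f n = ∏ i ∈ Finset.range m, ∏' n, f (m * n + i) := by
  have h1 : HasProd (fun p : ℕ × Fin m => f (m * p.1 + p.2)) (∏' n, f n) := by
    have := (Nat.divModEquiv m).symm.hasProd_iff.mpr hf.hasProd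
    convert this using 2 with p
    simp [Nat.divModEquiv, mul_comm]
  have h2 := h1.prod_fiberwise (fun n => hasProd_fintype fun i : Fin m => f (m * n + i))
  have h3 : HasProd (fun n => ∏ i : Fin m, f (m * n + i)) (∏ i : Fin m, ∏' n, f (m * n + i)) :=
    hasProd_prod fun i _ => (hm i i.2).hasProd
  rw [h2.unique h3, Finset.prod_range]

lemma multipliable_one_add_mul_pow {q : ℂ} (hq : ‖q‖ < 1) (z : ℂ) :
    Multipliable fun n : ℕ => 1 + z * q ^ n :=
  multipliable_one_add_of_summable (summable_pow_mul hq z)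

/-! ### Analytic estimates for the pentagonal number theorem -/

lemma norm_prod_one_sub_le {q : ℂ} (hq : ‖q‖ < 1) :
    ∃ C : ℝ, 0 ≤ C ∧ ∀ k n : ℕ, ‖∏ i ∈ Finset.range n, (1 - q ^ (k + i + 1))‖ ≤ C := by
  have hs : Summable fun n : ℕ => ‖q‖ ^ n := summable_geometric_of_lt_one (norm_nonneg _) hq
  refine ⟨Real.exp (∑' n : ℕ, ‖q‖ ^ n), (Real.exp_pos _).le, fun k n => ?_⟩
  rw [norm_prod]
  calc ∏ i ∈ Finset.range n, ‖1 - q ^ (k + i + 1)‖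
      ≤ ∏ i ∈ Finset.range n, (1 + ‖q‖ ^ i) := by
        refine Finset.prod_le_prod (fun _ _ => norm_nonneg _) fun i _ => ?_
        refine (norm_sub_le _ _).trans ?_
        rw [norm_one, norm_pow]
        gcongr 1 + ?_
        exact pow_le_pow_of_le_one (norm_nonneg _) hq.le (by omega)
    _ ≤ Real.exp (∑ i ∈ Finset.range n, ‖q‖ ^ i) :=
        Real.prod_one_add_le_exp_sum _ fun _ => by positivity
    _ ≤ _ := Real.exp_le_exp.mpr (hs.sum_le_tsum _ fun _ _ => by positivity)

lemma summable_pow_of_le {q : ℂ} (hq : ‖q‖ < 1) {ι : Type*} {f : ι → ℂ} {e g : ι → ℕ}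
    (hg : Summable fun i => ‖q‖ ^ g i) (hle : ∀ i, g i ≤ e i) (hf : ∀ i, ‖f i‖ ≤ 1) :
    Summable fun i => f i * q ^ e i := by
  refine Summable.of_norm_bounded hg fun i => ?_
  rw [norm_mul, norm_pow]
  calc ‖f i‖ * ‖q‖ ^ e i ≤ 1 * ‖q‖ ^ g i :=
        mul_le_mul (hf i) (pow_le_pow_of_le_one (norm_nonneg _) hq.le (hle i)) (by positivity)
          zero_le_one
    _ = _ := one_mul _

lemma natAbs_le_pentagonal (k : ℤ) : k.natAbs ≤ pentagonal k := by
  have h := two_mul_natCast_pentagonal k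
  zify
  rcases le_total 0 k with hk | hk
  · rw [abs_of_nonneg hk]
    rcases hk.eq_or_lt with rfl | hk
    · positivity
    · nlinarith
  · rw [abs_of_nonpos hk]
    nlinarith

/-- The identity is formal once the remainder after `k` steps tends to zero. It does so like `‖q‖ ^
k`, because the finite products in it are uniformly bounded. -/
lemma tprod_one_sub_pow_eq_tsum {q : ℂ} (hq : ‖q‖ < 1) :
    euler q = ∑' k : ℕ, (-1) ^ k * (q ^ pentagonal (-k) - q ^ pentagonal (k + 1)) := by
  have hgeo : Summable fun n : ℕ => ‖q‖ ^ n := summable_geometric_of_lt_one (norm_nonneg _) hq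
  obtain ⟨C, hC0, hC⟩ := norm_prod_one_sub_le hq
  have hterm : ∀ k n : ℕ, ‖q ^ ((k + 1) * n) * ∏ i ∈ Finset.range (n + 1), (1 - q ^ (k + i + 1))‖
      ≤ ‖q‖ ^ n * C := fun k n => by
    rw [norm_mul, norm_pow]
    refine mul_le_mul (pow_le_pow_of_le_one (norm_nonneg _) hq.le ?_) (hC k (n + 1))
      (norm_nonneg _) (by positivity)
    nlinarith
  have hsgn : ∀ k : ℕ, ‖(-1 : ℂ) ^ k‖ ≤ 1 := by simp
  have hp1 : ∀ k : ℕ, k ≤ pentagonal (-k) := fun k => by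
    simpa using natAbs_le_pentagonal (-k)
  have hp2 : ∀ k : ℕ, k ≤ pentagonal (k + 1) := fun k => by
    have := natAbs_le_pentagonal (k + 1)
    omega
  have hrhs : Summable fun k : ℕ => (-1 : ℂ) ^ k * (q ^ pentagonal (-k) - q ^ pentagonal (k + 1)) := by
    have h1 := summable_pow_of_le hq (e := fun k : ℕ => pentagonal (-k)) hgeo hp1 hsgn
    have h2 := summable_pow_of_le hq (e := fun k : ℕ => pentagonal (k + 1)) hgeo hp2 hsgn
    exact (h1.sub h2).congr fun k => by rw [mul_sub]
  have htail : Filter.Tendsto (fun k => (-1 : ℂ) ^ (k + 1) * q ^ ((k + 1) * (3 * k + 4) / 2) *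
      ∑' (n : ℕ), q ^ ((k + 1) * n) * ∏ i ∈ Finset.range (n + 1), (1 - q ^ (k + i + 1)))
      Filter.atTop (nhds 0) := by
    refine squeeze_zero_norm (a := fun k : ℕ => ‖q‖ ^ k * ∑' n : ℕ, ‖q‖ ^ n * C) (fun k => ?_) ?_
    · rw [norm_mul, norm_mul, norm_pow, norm_pow, norm_neg, norm_one, one_pow, one_mul]
      refine mul_le_mul (pow_le_pow_of_le_one (norm_nonneg _) hq.le ?_)
        (tsum_of_norm_bounded (hgeo.mul_right C).hasSum (hterm k)) (norm_nonneg _) (by positivity)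
      rw [Nat.le_div_iff_mul_le two_pos]
      nlinarith
    · simpa using (tendsto_pow_atTop_nhds_zero_of_lt_one (norm_nonneg _) hq).mul_const
        (∑' n : ℕ, ‖q‖ ^ n * C)
  refine Pentagonal.tprod_one_sub_pow ?_ (fun k => ?_) (fun k => ?_) hrhs htail
  · exact tendsto_pow_atTop_nhds_zero_of_norm_lt_one hq
  · exact Summable.of_norm_bounded (hgeo.mul_right C) (hterm k)
  · refine (multipliable_one_add_mul_pow hq (-q ^ (k + 1))).congr fun n => ?_
    ring

lemma summable_norm_pow_natAbs {q : ℂ} (hq : ‖q‖ < 1) :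
    Summable fun k : ℤ => ‖q‖ ^ k.natAbs := by
  have hgeo : Summable fun n : ℕ => ‖q‖ ^ n := summable_geometric_of_lt_one (norm_nonneg _) hq
  exact Summable.of_nat_of_neg (by simpa using hgeo) (by simpa using hgeo)

/-- The pentagonal number theorem. -/
theorem hasSum_pentagonal {q : ℂ} (hq : ‖q‖ < 1) :
    HasSum (fun k : ℤ => (-1 : ℂ) ^ k * q ^ pentagonal k) (euler q) := by
  have hs : Summable fun k : ℤ => (-1 : ℂ) ^ k * q ^ pentagonal k :=
    summable_pow_of_le hq (summable_norm_pow_natAbs hq) natAbs_le_pentagonal (by simp)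
  rw [hs.hasSum_iff, tprod_one_sub_pow_eq_tsum hq]
  set f : ℤ → ℂ := fun k => (-1 : ℂ) ^ k * q ^ pentagonal k with hf
  have hs' : Summable fun k => f (-k) := (Equiv.neg ℤ).summable_iff.mpr hs
  have h1 : Summable fun n : ℕ => f (-n) := hs'.comp_injective Nat.cast_injective
  have h2 : Summable fun n : ℕ => f (-(-((n : ℤ) + 1))) :=
    hs'.comp_injective (i := fun n : ℕ => -((n : ℤ) + 1)) fun a b h => by simpa using h
  rw [← (Equiv.neg ℤ).tsum_eq f]
  change ∑' k : ℤ, f (-k) = _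
  rw [tsum_of_nat_of_neg_add_one (f := fun k => f (-k)) h1 h2, ← h1.tsum_add h2]
  refine tsum_congr fun k => ?_
  simp only [hf, neg_neg, zpow_neg, zpow_natCast]
  rw [zpow_add₀ (by norm_num), zpow_natCast, ← inv_pow]
  norm_num
  ring

/-- Specialise to `q = r³`, `z = -r⁻¹`. The sum becomes the pentagonal series in `r` times
`chargeSum q 0`; the two products run over the exponents 1 and 2 modulo 3, so together with `euler
(r³)` they make up `euler r`. Comparison gives the constant. -/
lemma chargeSum_zero {q : ℂ} (hq : ‖q‖ < 1) (hq0 : q ≠ 0) : chargeSum q 0 = (euler q)⁻¹ := by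
  obtain ⟨r, rfl⟩ : ∃ r : ℂ, r ^ 3 = q := IsAlgClosed.exists_pow_nat_eq q (by norm_num)
  have hr : ‖r‖ < 1 := by
    rw [norm_pow] at hq
    by_contra h
    exact absurd hq (not_lt.mpr (one_le_pow₀ (not_lt.mp h)))
  have hr0 : r ≠ 0 := by rintro rfl; simp at hq0
  have hz : -r⁻¹ ≠ 0 := neg_ne_zero.mpr (inv_ne_zero hr0)
  have h1 := hasSum_chargeSum hq hz
  have h2 := (hasSum_pentagonal hr).mul_right (chargeSum (r ^ 3) 0)
  have h3 : ∀ k : ℤ, (-r⁻¹) ^ k * chargeSum (r ^ 3) k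
      = (-1 : ℂ) ^ (-k) * r ^ pentagonal (-k) * chargeSum (r ^ 3) 0 := fun k => by
    rw [chargeSum_eq hq0, ← mul_assoc, neg_eq_neg_one_mul, mul_zpow, inv_zpow', ← zpow_natCast r 3,
      ← zpow_mul, ← zpow_natCast r (pentagonal _), mul_assoc ((-1) ^ k), ← zpow_add₀ hr0,
      zpow_neg (-1 : ℂ), ← inv_zpow]
    congr 3
    · norm_num
    · have h4 := two_mul_natCast_pentagonal_neg k
      have h5 : k * (k + 1) / 2 * 2 = k * (k + 1) :=
        Int.ediv_mul_cancel (Int.even_mul_succ_self k).two_dvd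
      push_cast
      linarith
  have h2' := (Equiv.neg ℤ).hasSum_iff.mpr h2
  have h6 := h1.unique (h2'.congr_fun h3)
  have hme : Multipliable fun n : ℕ => 1 - r ^ (n + 1) :=
    (multipliable_one_add_mul_pow hr (-r)).congr fun n => by ring
  have h7 := tprod_residues 3 hme fun i _ => by
    refine (multipliable_one_add_mul_pow hq (-r ^ (i + 1))).congr fun n => ?_
    ring
  have e0 : ∏' n : ℕ, (1 + (-r⁻¹)⁻¹ * (r ^ 3) ^ n) = ∏' n : ℕ, (1 - r ^ (3 * n + 0 + 1)) :=
    tprod_congr fun n => by rw [inv_neg, inv_inv]; ring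
  have e1 : ∏' n : ℕ, (1 + -r⁻¹ * (r ^ 3) ^ (n + 1)) = ∏' n : ℕ, (1 - r ^ (3 * n + 1 + 1)) :=
    tprod_congr fun n => by field_simp; ring
  have e2 : euler (r ^ 3) = ∏' n : ℕ, (1 - r ^ (3 * n + 2 + 1)) :=
    tprod_congr fun n => by ring
  have e3 : euler r = (∏' n : ℕ, (1 - r ^ (3 * n + 0 + 1))) * (∏' n : ℕ, (1 - r ^ (3 * n + 1 + 1))) *
      euler (r ^ 3) := by
    rw [e2, euler, h7]
    simp [Finset.prod_range_succ]
  rw [e0, e1] at h6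
  have h8 := euler_ne_zero hr
  have h9 := euler_ne_zero hq
  rw [e3] at h6 h8
  refine eq_inv_of_mul_eq_one_left ?_
  have h10 := left_ne_zero_of_mul h8
  apply mul_left_cancel₀ h10
  linear_combination -h6

/-- The Jacobi triple product. -/
theorem hasSum_tripleProduct {q z : ℂ} (hq : ‖q‖ < 1) (hq0 : q ≠ 0) (hz : z ≠ 0) :
    HasSum (fun k : ℤ => z ^ k * q ^ (k * (k + 1) / 2))
      (euler q * ((∏' n : ℕ, (1 + z * q ^ (n + 1))) * ∏' n : ℕ, (1 + z⁻¹ * q ^ n))) := by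
  have h := (hasSum_chargeSum hq hz).mul_left (euler q)
  refine h.congr_fun fun k => ?_
  rw [chargeSum_eq hq0, chargeSum_zero hq hq0]
  have := euler_ne_zero hq
  field_simp

section

/-! ### Theta functions as eta quotients -/

lemma multipliable_one_sub_pow_succ {q : ℂ} (hq : ‖q‖ < 1) :
    Multipliable fun n : ℕ => 1 - q ^ (n + 1) :=
  (multipliable_one_add_mul_pow hq (-q)).congr fun n => by ring

lemma multipliable_one_add_pow_succ {q : ℂ} (hq : ‖q‖ < 1) :
    Multipliable fun n : ℕ => 1 + q ^ (n + 1) :=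
  (multipliable_one_add_mul_pow hq q).congr fun n => by ring

lemma norm_pow_lt_one {q : ℂ} (hq : ‖q‖ < 1) {n : ℕ} (hn : n ≠ 0) : ‖q ^ n‖ < 1 := by
  rw [norm_pow]
  exact pow_lt_one₀ (norm_nonneg _) hq hn

/-- The product `∏ (1 + q ^ n)`. -/
def eulerPlus (q : ℂ) : ℂ := ∏' n : ℕ, (1 + q ^ (n + 1))

lemma eulerPlus_mul_euler {q : ℂ} (hq : ‖q‖ < 1) : eulerPlus q * euler q = euler (q ^ 2) := by
  rw [eulerPlus, euler, ← (multipliable_one_add_pow_succ hq).tprod_mul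
    (multipliable_one_sub_pow_succ hq)]
  exact tprod_congr fun n => by ring

lemma tprod_odd_mul_eulerPlus {q : ℂ} (hq : ‖q‖ < 1) :
    (∏' n : ℕ, (1 + q ^ (2 * n + 1))) * eulerPlus (q ^ 2) = eulerPlus q := by
  rw [eulerPlus, eulerPlus, tprod_residues 2 (multipliable_one_add_pow_succ hq) fun i _ =>
    (multipliable_one_add_mul_pow (norm_pow_lt_one hq two_ne_zero) (q ^ (i + 1))).congr
      fun n => by ring]
  simp only [Finset.prod_range_succ, Finset.prod_range_zero, one_mul, add_zero]
  congr 1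
  exact tprod_congr fun n => by ring

lemma tprod_odd_mul_euler {q : ℂ} (hq : ‖q‖ < 1) :
    (∏' n : ℕ, (1 - q ^ (2 * n + 1))) * euler (q ^ 2) = euler q := by
  rw [euler, euler, tprod_residues 2 (multipliable_one_sub_pow_succ hq) fun i _ =>
    (multipliable_one_add_mul_pow (norm_pow_lt_one hq two_ne_zero) (-q ^ (i + 1))).congr
      fun n => by ring]
  simp only [Finset.prod_range_succ, Finset.prod_range_zero, one_mul, add_zero]
  congr 1
  exact tprod_congr fun n => by ring

lemma even_mul_succ_ediv (k : ℤ) : k * (k + 1) / 2 * 2 = k * (k + 1) :=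
  Int.ediv_mul_cancel (Int.even_mul_succ_self k).two_dvd

lemma hasSum_sq {q : ℂ} (hq : ‖q‖ < 1) (hq0 : q ≠ 0) :
    HasSum (fun k : ℤ => q ^ (k ^ 2)) (euler (q ^ 2) ^ 5 / (euler q ^ 2 * euler (q ^ 4) ^ 2)) := by
  have hq2 := norm_pow_lt_one hq two_ne_zero
  -- With base `q²` and `z = q⁻¹` the exponent is `k(k+1) - k = k²`, and both products run over the
  -- odd powers of `q`.
  have h := hasSum_tripleProduct hq2 (pow_ne_zero 2 hq0) (inv_ne_zero hq0)
  convert h using 1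
  · ext k
    rw [inv_zpow', ← zpow_natCast q 2, ← zpow_mul, ← zpow_add₀ hq0]
    congr 1
    have := even_mul_succ_ediv k
    push_cast
    linarith
  · have e1 : ∏' n : ℕ, (1 + q⁻¹ * (q ^ 2) ^ (n + 1)) = ∏' n : ℕ, (1 + q ^ (2 * n + 1)) :=
      tprod_congr fun n => by field_simp; ring
    have e2 : ∏' n : ℕ, (1 + q⁻¹⁻¹ * (q ^ 2) ^ n) = ∏' n : ℕ, (1 + q ^ (2 * n + 1)) :=
      tprod_congr fun n => by rw [inv_inv]; ring
    have h1 := eulerPlus_mul_euler hq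
    have h2 := eulerPlus_mul_euler hq2
    have h3 := tprod_odd_mul_eulerPlus hq
    rw [← pow_mul] at h2
    have n1 := euler_ne_zero hq
    have n2 := euler_ne_zero hq2
    have n4 := euler_ne_zero (norm_pow_lt_one hq four_ne_zero)
    norm_num at h2
    rw [e1, e2]
    have n5 : eulerPlus (q ^ 2) ≠ 0 := by
      intro h0
      rw [h0, zero_mul] at h2
      exact n4 h2.symm
    rw [← eq_div_iff n5] at h3
    rw [← eq_div_iff n1] at h1
    rw [← eq_div_iff n2] at h2
    rw [h3, h1, h2]
    field_simp

lemma hasSum_alternating_sq {q : ℂ} (hq : ‖q‖ < 1) (hq0 : q ≠ 0) :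
    HasSum (fun k : ℤ => (-1) ^ k * q ^ (k ^ 2)) (euler q ^ 2 / euler (q ^ 2)) := by
  have hq2 := norm_pow_lt_one hq two_ne_zero
  have h := hasSum_tripleProduct hq2 (pow_ne_zero 2 hq0) (neg_ne_zero.mpr (inv_ne_zero hq0))
  convert h using 1
  · ext k
    rw [neg_eq_neg_one_mul q⁻¹, mul_zpow, mul_assoc, inv_zpow', ← zpow_natCast q 2, ← zpow_mul,
      ← zpow_add₀ hq0]
    congr 2
    have := even_mul_succ_ediv k
    push_cast
    linarith
  · have e1 : ∏' n : ℕ, (1 + -q⁻¹ * (q ^ 2) ^ (n + 1)) = ∏' n : ℕ, (1 - q ^ (2 * n + 1)) :=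
      tprod_congr fun n => by field_simp; ring
    have e2 : ∏' n : ℕ, (1 + (-q⁻¹)⁻¹ * (q ^ 2) ^ n) = ∏' n : ℕ, (1 - q ^ (2 * n + 1)) :=
      tprod_congr fun n => by rw [inv_neg, inv_inv]; ring
    have h3 := tprod_odd_mul_euler hq
    have n2 := euler_ne_zero hq2
    rw [e1, e2]
    rw [← eq_div_iff n2] at h3
    rw [h3]
    field_simp

lemma hasSum_mul_succ {q : ℂ} (hq : ‖q‖ < 1) (hq0 : q ≠ 0) :
    HasSum (fun k : ℤ => q ^ (k * (k + 1) / 2)) (2 * euler (q ^ 2) ^ 2 / euler q) := by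
  have h := hasSum_tripleProduct hq hq0 one_ne_zero
  convert h using 1
  · ext k
    simp
  · have e1 : ∏' n : ℕ, (1 + 1 * q ^ (n + 1)) = eulerPlus q :=
      tprod_congr fun n => by rw [one_mul]
    -- The factor 2 is the term `n = 0`.
    have e2 : ∏' n : ℕ, (1 + (1 : ℂ)⁻¹ * q ^ n) = 2 * eulerPlus q := by
      rw [tprod_eq_zero_mul']
      · simp only [inv_one, one_mul, pow_zero]
        norm_num [eulerPlus]
      · simpa using multipliable_one_add_pow_succ hq
    have h1 := eulerPlus_mul_euler hq
    have n1 := euler_ne_zero hq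
    rw [← eq_div_iff n1] at h1
    rw [e1, e2, h1]
    field_simp

/-- `e(z) = exp(2πiz)`. -/
def ee (z : ℂ) : ℂ := Complex.exp (2 * Real.pi * Complex.I * z)

lemma ee_add (z w : ℂ) : ee (z + w) = ee z * ee w := by
  rw [ee, ee, ee, ← Complex.exp_add, mul_add]

lemma ee_ne_zero (z : ℂ) : ee z ≠ 0 := Complex.exp_ne_zero _

lemma ee_zsmul (n : ℤ) (z : ℂ) : ee (n * z) = ee z ^ n := by
  rw [ee, ee, ← Complex.exp_int_mul]
  congr 1
  ring

lemma ee_nsmul (n : ℕ) (z : ℂ) : ee (n * z) = ee z ^ n := by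
  rw [ee, ee, ← Complex.exp_nat_mul]
  congr 1
  ring

lemma ee_int (n : ℤ) : ee n = 1 := by
  rw [ee, Complex.exp_eq_one_iff]
  exact ⟨n, by ring⟩

lemma norm_ee (z : ℂ) : ‖ee z‖ = Real.exp (-2 * Real.pi * z.im) := by
  rw [ee, Complex.norm_exp]
  congr 1
  simp

lemma norm_ee_lt_one {z : ℂ} (hz : 0 < z.im) : ‖ee z‖ < 1 := by
  rw [norm_ee, Real.exp_lt_one_iff]
  have := Real.pi_pos
  nlinarith [mul_pos this hz]

lemma qParam_eq_ee (z : ℂ) : Function.Periodic.qParam 1 z = ee z := by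
  simp [Function.Periodic.qParam, ee]

lemma eta_eq (z : ℂ) : ModularForm.eta z = ee (z / 24) * euler (ee z) := by
  have h : Function.Periodic.qParam 24 z = ee (z / 24) := by
    rw [Function.Periodic.qParam, ee]
    congr 1
    push_cast
    ring
  simp_rw [ModularForm.eta, euler, ModularForm.eta_q, qParam_eq_ee, h]

/-- The theta function `∑ e(n² z)`. -/
def thA (z : ℂ) : ℂ := ∑' n : ℤ, ee ((n : ℂ) ^ 2 * z)

/-- The theta function `∑ e((n + 1/2)² z)`. -/
def thB (z : ℂ) : ℂ := ∑' n : ℤ, ee (((n : ℂ) + 1 / 2) ^ 2 * z)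

/-- The theta function `∑ (-1)ⁿ e(n² z)`. -/
def thD (z : ℂ) : ℂ := ∑' n : ℤ, (-1) ^ n * ee ((n : ℂ) ^ 2 * z)

lemma ee_sq_mul (n : ℤ) (z : ℂ) : ee ((n : ℂ) ^ 2 * z) = ee z ^ (n ^ 2) := by
  rw [← ee_zsmul]
  push_cast
  rfl

lemma hasSum_thA {z : ℂ} (hz : 0 < z.im) : HasSum (fun n : ℤ => ee ((n : ℂ) ^ 2 * z)) (thA z) := by
  have h := hasSum_sq (norm_ee_lt_one hz) (ee_ne_zero z)
  simp_rw [← ee_sq_mul] at h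
  exact h.summable.hasSum

lemma hasSum_thD {z : ℂ} (hz : 0 < z.im) :
    HasSum (fun n : ℤ => (-1) ^ n * ee ((n : ℂ) ^ 2 * z)) (thD z) := by
  have h := hasSum_alternating_sq (norm_ee_lt_one hz) (ee_ne_zero z)
  simp_rw [← ee_sq_mul] at h
  exact h.summable.hasSum

lemma ee_half_sq (n : ℤ) (z : ℂ) :
    ee (((n : ℂ) + 1 / 2) ^ 2 * z) = ee (z / 4) * ee (2 * z) ^ (n * (n + 1) / 2) := by
  rw [← ee_zsmul, ← ee_add]
  congr 1
  have h : (((n * (n + 1) / 2 : ℤ) : ℂ)) * 2 = n * (n + 1) := by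
    exact_mod_cast even_mul_succ_ediv n
  linear_combination -z * h

lemma im_ofNat_mul {z : ℂ} (hz : 0 < z.im) (n : ℕ) (hn : 0 < n) : 0 < ((n : ℂ) * z).im := by
  simpa using mul_pos (Nat.cast_pos.mpr hn) hz

lemma hasSum_thB' {z : ℂ} (hz : 0 < z.im) : HasSum (fun n : ℤ => ee (((n : ℂ) + 1 / 2) ^ 2 * z))
    (ee (z / 4) * (2 * euler (ee (2 * z) ^ 2) ^ 2 / euler (ee (2 * z)))) := by
  have h := hasSum_mul_succ (norm_ee_lt_one (im_ofNat_mul hz 2 two_pos)) (ee_ne_zero _)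
  simp_rw [ee_half_sq]
  exact_mod_cast h.mul_left (ee (z / 4))

lemma hasSum_thB {z : ℂ} (hz : 0 < z.im) :
    HasSum (fun n : ℤ => ee (((n : ℂ) + 1 / 2) ^ 2 * z)) (thB z) :=
  (hasSum_thB' hz).summable.hasSum

open ModularForm (eta)

lemma eta_ne_zero' {z : ℂ} (hz : 0 < z.im) : eta z ≠ 0 := ModularForm.eta_ne_zero hz

lemma eta_nat_mul (d : ℕ) (z : ℂ) : eta (d * z) = ee (z / 24) ^ d * euler (ee z ^ d) := by
  rw [eta_eq, mul_div_assoc, ee_nsmul, ee_nsmul]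

theorem thA_eq {z : ℂ} (hz : 0 < z.im) :
    thA z = eta (2 * z) ^ 5 / (eta z ^ 2 * eta (4 * z) ^ 2) := by
  have h := hasSum_sq (norm_ee_lt_one hz) (ee_ne_zero z)
  simp_rw [← ee_sq_mul] at h
  have h2 := eta_nat_mul 2 z
  have h4 := eta_nat_mul 4 z
  push_cast at h2 h4
  rw [thA, h.tsum_eq, h2, h4, eta_eq]
  have := ee_ne_zero (z / 24)
  have := euler_ne_zero (norm_ee_lt_one hz)
  have := euler_ne_zero (norm_pow_lt_one (norm_ee_lt_one hz) four_ne_zero)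
  field_simp

theorem thD_eq {z : ℂ} (hz : 0 < z.im) : thD z = eta z ^ 2 / eta (2 * z) := by
  have h := hasSum_alternating_sq (norm_ee_lt_one hz) (ee_ne_zero z)
  simp_rw [← ee_sq_mul] at h
  have h2 := eta_nat_mul 2 z
  push_cast at h2
  rw [thD, h.tsum_eq, h2, eta_eq]
  have := ee_ne_zero (z / 24)
  have := euler_ne_zero (norm_pow_lt_one (norm_ee_lt_one hz) two_ne_zero)
  field_simp

theorem thB_eq {z : ℂ} (hz : 0 < z.im) : thB z = 2 * eta (4 * z) ^ 2 / eta (2 * z) := by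
  have h := hasSum_thB' hz
  have h2 := eta_nat_mul 2 z
  have h4 := eta_nat_mul 4 z
  have e2 := ee_nsmul 2 z
  have e4 : ee (z / 4) = ee (z / 24) ^ 6 := by
    rw [← ee_nsmul]
    congr 1
    push_cast
    ring
  push_cast at h2 h4 e2
  rw [thB, h.tsum_eq, h2, h4, e2, e4, ← pow_mul]
  have := ee_ne_zero (z / 24)
  have := euler_ne_zero (norm_pow_lt_one (norm_ee_lt_one hz) two_ne_zero)
  field_simp

/-- Euler's series for the eta function. -/
theorem hasSum_eta {z : ℂ} (hz : 0 < z.im) :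
    HasSum (fun n : ℤ => (-1) ^ n * ee (((6 * n - 1) ^ 2 : ℤ) * z / 24)) (eta z) := by
  rw [eta_eq]
  refine ((hasSum_pentagonal (norm_ee_lt_one hz)).mul_left (ee (z / 24))).congr_fun fun n => ?_
  rw [mul_left_comm, ← ee_nsmul, ← ee_add]
  congr 2
  have h : (2 : ℂ) * (pentagonal n : ℂ) = n * (3 * n - 1) := by
    exact_mod_cast two_mul_natCast_pentagonal n
  push_cast
  linear_combination -(z / 2) * h

end

section

open ModularForm (eta)

/-! ### Identities between theta functions -/

lemma tsum_comp_equiv {α β : Type*} (e : α ≃ β) (F : β → ℂ) :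
    ∑' a, (F ∘ e) a = ∑' b, F b := e.tsum_eq F

lemma tsum_int_residues (m : ℕ) [NeZero m] {f : ℤ → ℂ} (hf : Summable f) :
    ∑' n, f n = ∑ i ∈ Finset.range m, ∑' n : ℤ, f (m * n + i) := by
  let e : Fin m × ℤ ≃ ℤ := (Equiv.prodComm _ _).trans (Int.divModEquiv m).symm
  have h1 : Summable fun x : Fin m × ℤ => f (e x) := e.summable_iff.mpr hf
  rw [← e.tsum_eq f, h1.tsum_prod, tsum_fintype, Finset.sum_range]
  refine Finset.sum_congr rfl fun i _ => tsum_congr fun p => ?_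
  simp [e, Int.divModEquiv, mul_comm]

lemma tsum_fst_residues (m : ℕ) [NeZero m] {F : ℤ × ℤ → ℂ} (hF : Summable F) :
    ∑' p, F p = ∑ i ∈ Finset.range m, ∑' p : ℤ × ℤ, F (m * p.1 + i, p.2) := by
  let e : Fin m × (ℤ × ℤ) ≃ ℤ × ℤ := (Equiv.prodAssoc _ _ _).symm.trans
    (((Equiv.prodComm _ _).trans (Int.divModEquiv m).symm).prodCongr (Equiv.refl ℤ))
  have h1 : Summable fun x : Fin m × (ℤ × ℤ) => F (e x) := e.summable_iff.mpr hF
  rw [← e.tsum_eq F, h1.tsum_prod, tsum_fintype, Finset.sum_range]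
  refine Finset.sum_congr rfl fun i _ => tsum_congr fun p => ?_
  simp [e, Int.divModEquiv, mul_comm]

lemma tsum_snd_residues (m : ℕ) [NeZero m] {F : ℤ × ℤ → ℂ} (hF : Summable F) :
    ∑' p, F p = ∑ i ∈ Finset.range m, ∑' p : ℤ × ℤ, F (p.1, m * p.2 + i) := by
  have h := tsum_fst_residues m (F := F ∘ Equiv.prodComm ℤ ℤ)
    ((Equiv.prodComm ℤ ℤ).summable_iff.mpr hF)
  rw [tsum_comp_equiv (Equiv.prodComm ℤ ℤ) F] at h
  rw [h]
  refine Finset.sum_congr rfl fun i _ => ?_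
  exact tsum_comp_equiv (Equiv.prodComm ℤ ℤ) fun p : ℤ × ℤ => F (p.1, m * p.2 + i)

/-- The affine change of variables `(k, l) ↦ (a k + b l + e, c k + d l + f)`. -/
lemma tsum_affine (F : ℤ × ℤ → ℂ) (a b c d e f : ℤ) (h : a * d - b * c = 1 ∨ a * d - b * c = -1) :
    ∑' p : ℤ × ℤ, F (a * p.1 + b * p.2 + e, c * p.1 + d * p.2 + f) = ∑' p, F p := by
  have hδ : (a * d - b * c) ^ 2 = 1 := by rcases h with h | h <;> simp [h]
  let E : ℤ × ℤ ≃ ℤ × ℤ :=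
    { toFun := fun p => (a * p.1 + b * p.2 + e, c * p.1 + d * p.2 + f)
      invFun := fun p => ((a * d - b * c) * (d * (p.1 - e) - b * (p.2 - f)),
        (a * d - b * c) * (a * (p.2 - f) - c * (p.1 - e)))
      left_inv := fun p => by
        ext
        · linear_combination p.1 * hδ
        · linear_combination p.2 * hδ
      right_inv := fun p => by
        ext
        · linear_combination (p.1 - e) * hδ
        · linear_combination (p.2 - f) * hδ }
  exact E.tsum_eq F

lemma im_div_pos {z : ℂ} (hz : 0 < z.im) {n : ℕ} (hn : 0 < n) : 0 < (z / n).im := by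
  rw [Complex.div_natCast_im]
  exact div_pos hz (Nat.cast_pos.mpr hn)

lemma summable_ee_sq {z : ℂ} (hz : 0 < z.im) : Summable fun n : ℤ => ee ((n : ℂ) ^ 2 * z) :=
  (hasSum_thA hz).summable

lemma tsum_int_parity {f : ℤ → ℂ} (hf : Summable f) :
    ∑' n, f n = ∑' n, f (2 * n) + ∑' n, f (2 * n + 1) := by
  rw [tsum_int_residues 2 hf]
  simp [Finset.sum_range_succ]

/-- Split `∑ e(n² z/4)` by the parity of `n`. With signs `(-1)^n` the same splitting gives the
difference, so that `A² - B²` factors into eta quotients. -/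
lemma thA_add_thB {z : ℂ} (hz : 0 < z.im) : thA z + thB z = thA (z / 4) := by
  have hz4 := im_div_pos hz four_pos
  push_cast at hz4
  rw [thA, thB, thA, tsum_int_parity (summable_ee_sq hz4)]
  congr 1 <;> refine tsum_congr fun n => ?_ <;> congr 1 <;> push_cast <;> ring

lemma thA_sub_thB {z : ℂ} (hz : 0 < z.im) : thA z - thB z = thD (z / 4) := by
  have hz4 := im_div_pos hz four_pos
  push_cast at hz4
  rw [thA, thB, thD, tsum_int_parity (hasSum_thD hz4).summable, sub_eq_add_neg, ← tsum_neg]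
  congr 1 <;> refine tsum_congr fun n => ?_
  · rw [zpow_mul]
    norm_num
    ring_nf
  · rw [zpow_add₀ (by norm_num), zpow_mul]
    norm_num
    ring_nf

lemma thA_add_one (z : ℂ) : thA (z + 1) = thA z := by
  refine tsum_congr fun n => ?_
  rw [mul_add, ee_add]
  have := ee_int (n ^ 2)
  push_cast at this
  rw [mul_one, this, mul_one]

lemma ee_quarter : ee (1 / 4) = Complex.I := by
  rw [ee, show 2 * Real.pi * Complex.I * (1 / 4) = Real.pi / 2 * Complex.I by ring,
    Complex.exp_pi_div_two_mul_I]

lemma ee_half : ee (1 / 2) = -1 := by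
  rw [ee, show 2 * Real.pi * Complex.I * (1 / 2) = Real.pi * Complex.I by ring,
    Complex.exp_pi_mul_I]

lemma thB_add_one (z : ℂ) : thB (z + 1) = Complex.I * thB z := by
  rw [thB, thB, ← tsum_mul_left]
  refine tsum_congr fun n => ?_
  rw [mul_add, ee_add, mul_comm]
  congr 1
  rw [show ((n : ℂ) + 1 / 2) ^ 2 * 1 = ((n ^ 2 + n : ℤ) : ℂ) + 1 / 4 by push_cast; ring, ee_add,
    ee_int, ee_quarter, one_mul]

lemma thD_add_half (z : ℂ) : thD (z + 1 / 2) = thA z := by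
  refine tsum_congr fun n => ?_
  have h : ee ((n : ℂ) ^ 2 * (1 / 2)) = (-1) ^ n := by
    have := ee_zsmul (n ^ 2) (1 / 2)
    push_cast at this
    rw [this, ee_half]
    rcases Int.even_or_odd n with hn | hn
    · rw [hn.neg_one_zpow, (hn.pow_of_ne_zero two_ne_zero).neg_one_zpow]
    · rw [hn.neg_one_zpow, hn.pow.neg_one_zpow]
  rw [mul_add, ee_add, h, mul_left_comm, ← mul_zpow]
  simp

/-- The theta form of Jacobi's quartic identity. -/
theorem thA_pow_four_sub {z : ℂ} (hz : 0 < z.im) :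
    thA z ^ 4 - thB z ^ 4 = (eta z ^ 2 / eta (2 * z)) ^ 4 := by
  have hm : ∀ w : ℂ, 0 < w.im → thA w ^ 2 - thB w ^ 2 = eta (w / 2) ^ 4 / eta w ^ 2 := by
    intro w hw
    have h4 := im_div_pos hw four_pos
    have h2 := im_div_pos hw two_pos
    push_cast at h4 h2
    have n4 := eta_ne_zero' h4
    have n2 := eta_ne_zero' h2
    have n1 := eta_ne_zero' hw
    rw [show thA w ^ 2 - thB w ^ 2 = (thA w + thB w) * (thA w - thB w) by ring,
      thA_add_thB hw, thA_sub_thB hw, thA_eq h4, thD_eq h4]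
    have e2 : 2 * (w / 4) = w / 2 := by ring
    have e4 : 4 * (w / 4) = w := by ring
    rw [e2, e4]
    field_simp
  have h1 : 0 < (z + 1).im := by simpa using hz
  have h2 := im_div_pos hz two_pos
  push_cast at h2
  have n1 := eta_ne_zero' h1
  have n2 := eta_ne_zero' h2
  have nz := eta_ne_zero' hz
  have n22 := eta_ne_zero' (im_ofNat_mul hz 2 two_pos)
  push_cast at n22
  -- Replacing `z` by `z + 1` multiplies `B` by `i` and fixes `A`, which turns the formula for `A² -
  -- B²` into one for `A² + B²`.
  have hp : thA z ^ 2 + thB z ^ 2 = thA (z / 2) ^ 2 := by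
    have := hm (z + 1) h1
    rw [thA_add_one, thB_add_one, mul_pow, Complex.I_sq] at this
    have h3 : thA (z / 2) = eta ((z + 1) / 2) ^ 2 / eta (z + 1) := by
      rw [← thD_add_half, thD_eq (by simpa using h2)]
      congr 3 <;> ring
    rw [h3]
    linear_combination this
  have ha := thA_eq h2
  have e2 : 2 * (z / 2) = z := by ring
  have e4 : 4 * (z / 2) = 2 * z := by ring
  rw [e2, e4] at ha
  rw [show thA z ^ 4 - thB z ^ 4 = (thA z ^ 2 + thB z ^ 2) * (thA z ^ 2 - thB z ^ 2) by ring, hp,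
    hm z hz, ha]
  field_simp

end

/-! ### Binary lattice sums and theta identities of level 5 -/

section

open ModularForm (eta)

lemma summable_mul_prod {f g : ℤ → ℂ} (hf : Summable f) (hg : Summable g) :
    Summable fun p : ℤ × ℤ => f p.1 * g p.2 :=
  summable_mul_of_summable_norm hf.norm hg.norm

lemma tsum_mul_tsum_prod {f g : ℤ → ℂ} (hf : Summable f) (hg : Summable g) :
    (∑' n, f n) * ∑' n, g n = ∑' p : ℤ × ℤ, f p.1 * g p.2 :=
  tsum_mul_tsum_of_summable_norm hf.norm hg.norm

lemma neg_one_zpow_add_two_mul (n k : ℤ) : (-1 : ℂ) ^ (n + 2 * k) = (-1) ^ n := by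
  rw [zpow_add₀ (by norm_num), zpow_mul]
  norm_num

lemma neg_one_zpow_add_odd (n k : ℤ) : (-1 : ℂ) ^ (n + (2 * k + 1)) = -(-1) ^ n := by
  rw [← add_assoc, zpow_add₀ (by norm_num), neg_one_zpow_add_two_mul]
  simp

lemma norm_neg_one_zpow (n : ℤ) : ‖(-1 : ℂ) ^ n‖ = 1 := by simp

/-- The twisted lattice sum over `M² + 5 N²` with `M - N = 2 k + 1`. -/
def latticeTerm (z : ℂ) (p : ℤ × ℤ) : ℂ :=
  (-1) ^ p.2 * ee ((((p.2 + 2 * p.1 + 1) ^ 2 + 5 * p.2 ^ 2 : ℤ) : ℂ) * z / 4)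

lemma summable_latticeTerm {z : ℂ} (hz : 0 < z.im) : Summable (latticeTerm z) := by
  have h4 := im_div_pos hz four_pos
  push_cast at h4
  have h5 := im_ofNat_mul h4 5 (by norm_num)
  push_cast at h5
  have h := summable_mul_prod (summable_ee_sq h4) (summable_ee_sq h5)
  have hinj : Function.Injective fun p : ℤ × ℤ => (p.2 + 2 * p.1 + 1, p.2) := by
    rintro ⟨a, b⟩ ⟨c, d⟩ h
    simp only [Prod.mk.injEq] at h
    ext <;> simp <;> omega
  refine Summable.of_norm ((h.comp_injective hinj).norm.congr fun p => ?_)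
  rw [latticeTerm, norm_mul, norm_neg_one_zpow, one_mul, Function.comp_apply, ← ee_add]
  congr 2
  push_cast
  ring

/-- Split by the parity of `N`: for even `N` the number `M` is odd and the sign is `+`, for odd `N`
it is even and the sign is `-`. -/
lemma tsum_latticeTerm {z : ℂ} (hz : 0 < z.im) :
    ∑' p, latticeTerm z p = thA (5 * z) * thB z - thA z * thB (5 * z) := by
  have h5 := im_ofNat_mul hz 5 (by norm_num)
  push_cast at h5
  rw [tsum_snd_residues 2 (summable_latticeTerm hz), Finset.sum_range_succ, Finset.sum_range_one,
    sub_eq_add_neg]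
  congr 1
  · rw [thA, thB, tsum_mul_tsum_prod (hasSum_thA h5).summable (hasSum_thB' hz).summable]
    refine Eq.trans ?_ (tsum_affine _ 0 1 1 1 0 0 (by norm_num))
    refine tsum_congr fun p => ?_
    rw [latticeTerm, ← ee_add]
    have : (-1 : ℂ) ^ (2 * p.2) = 1 := by rw [zpow_mul]; norm_num
    simp only [Nat.cast_ofNat, Nat.cast_zero, add_zero, this, one_mul]
    congr 1
    push_cast
    ring
  · rw [thA, thB, tsum_mul_tsum_prod (hasSum_thA hz).summable (hasSum_thB' h5).summable,
      ← tsum_neg]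
    refine Eq.trans ?_ (tsum_affine _ 1 1 0 1 1 0 (by norm_num))
    refine tsum_congr fun p => ?_
    rw [latticeTerm, ← ee_add]
    have : (-1 : ℂ) ^ (2 * p.2 + 1) = -1 := by
      rw [zpow_add₀ (by norm_num), zpow_mul]; norm_num
    simp only [Nat.cast_ofNat, Nat.cast_one, this, neg_one_mul]
    congr 2
    push_cast
    ring

/-- The identity `6(M² + 5N²) = (M + 5N)² + 5(M - N)²` brings in the exponents of the eta series.
Split `M - N = 2k + 1` by `k` modulo 3. The class of 0 is `η(z) η(5z)`, and the class of 2 is its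
image under negation. On the class of 1 the reflection `M + 5N ↦ -(M + 5N)` with fixed `M - N` is
integral and changes the parity of `N`, so that this part cancels. -/
lemma tsum_latticeTerm_eq_eta {z : ℂ} (hz : 0 < z.im) :
    ∑' p, latticeTerm z p = 2 * (eta z * eta (5 * z)) := by
  have h5 := im_ofNat_mul hz 5 (by norm_num)
  push_cast at h5
  have hS : ∑' p : ℤ × ℤ, latticeTerm z (3 * p.1, p.2) = eta z * eta (5 * z) := by
    rw [← (hasSum_eta hz).tsum_eq, ← (hasSum_eta h5).tsum_eq,
      tsum_mul_tsum_prod (hasSum_eta hz).summable (hasSum_eta h5).summable]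
    refine Eq.trans ?_ (tsum_affine _ (-1) (-1) (-1) 0 0 0 (by norm_num))
    refine tsum_congr fun p => ?_
    rw [latticeTerm, mul_mul_mul_comm, ← ee_add, ← zpow_add₀ (by norm_num)]
    congr 1
    · rw [← neg_one_zpow_add_two_mul _ (-p.1 - p.2)]
      congr 1
      ring
    · congr 1
      push_cast
      ring
  have hM : ∑' p : ℤ × ℤ, latticeTerm z (3 * p.1 + 1, p.2) = 0 := by
    rw [← self_eq_neg]
    refine (tsum_affine (fun p => latticeTerm z (3 * p.1 + 1, p.2)) 1 0 (-2) (-1) 0 (-1)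
      (by norm_num)).symm.trans ?_
    rw [← tsum_neg]
    refine tsum_congr fun p => ?_
    simp only [latticeTerm]
    rw [← neg_mul]
    congr 1
    · rw [← neg_one_zpow_add_odd _ (-p.1 - p.2 - 1)]
      congr 1
      ring
    · congr 1
      push_cast
      ring
  have hT : ∑' p : ℤ × ℤ, latticeTerm z (3 * p.1 + 2, p.2) = eta z * eta (5 * z) := by
    rw [← hS]
    refine Eq.trans ?_ (tsum_affine _ (-1) 0 0 (-1) (-1) 0 (by norm_num))
    refine tsum_congr fun p => ?_
    simp only [latticeTerm]
    congr 1
    · rw [← neg_one_zpow_add_two_mul _ (-p.2)]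
      congr 1
      ring
    · congr 1
      push_cast
      ring
  rw [tsum_fst_residues 3 (summable_latticeTerm hz)]
  simp only [Finset.sum_range_succ, Finset.sum_range_zero, zero_add]
  push_cast
  simp only [add_zero]
  rw [hS, hM, hT]
  ring

theorem thA_mul_thB_sub {z : ℂ} (hz : 0 < z.im) :
    thA z * thB (5 * z) - thA (5 * z) * thB z = -2 * (eta z * eta (5 * z)) := by
  have h1 := tsum_latticeTerm hz
  have h2 := tsum_latticeTerm_eq_eta hz
  linear_combination h1 - h2

theorem thA_mul_thD_sub {z : ℂ} (hz : 0 < z.im) :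
    thA z * thD (5 * z) - thD z * thA (5 * z) = 4 * (eta (4 * z) * eta (20 * z)) := by
  have h4 := im_ofNat_mul hz 4 (by norm_num)
  have h5 := im_ofNat_mul hz 5 (by norm_num)
  have h20 := im_ofNat_mul hz 20 (by norm_num)
  push_cast at h4 h5 h20
  have hk := thA_mul_thB_sub h4
  have a1 := thA_add_thB h4
  have a2 := thA_sub_thB h4
  have a3 := thA_add_thB h20
  have a4 := thA_sub_thB h20
  rw [show 5 * (4 * z) = 20 * z by ring] at hk
  rw [show 4 * z / 4 = z by ring] at a1 a2
  rw [show 20 * z / 4 = 5 * z by ring] at a3 a4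
  rw [← a1, ← a2, ← a3, ← a4]
  linear_combination -2 * hk

def oddSquareTerm (z : ℂ) (p : ℤ × ℤ) : ℂ :=
  ee ((((2 * p.1 + 1) ^ 2 + (2 * p.2 + 1) ^ 2 : ℤ) : ℂ) * z / 8)

lemma oddSquareTerm_eq (z : ℂ) (p : ℤ × ℤ) : oddSquareTerm z p =
    ee (((p.1 : ℂ) + 1 / 2) ^ 2 * (z / 2)) * ee (((p.2 : ℂ) + 1 / 2) ^ 2 * (z / 2)) := by
  rw [oddSquareTerm, ← ee_add]
  congr 1
  push_cast
  ring

lemma summable_oddSquareTerm {z : ℂ} (hz : 0 < z.im) : Summable (oddSquareTerm z) := by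
  have h2 := im_div_pos hz two_pos
  push_cast at h2
  exact (summable_mul_prod (hasSum_thB' h2).summable (hasSum_thB' h2).summable).congr
    fun p => (oddSquareTerm_eq z p).symm

lemma tsum_oddSquareTerm {z : ℂ} (hz : 0 < z.im) :
    ∑' p, oddSquareTerm z p = thB (z / 2) ^ 2 := by
  have h2 := im_div_pos hz two_pos
  push_cast at h2
  simp_rw [oddSquareTerm_eq]
  rw [sq, thB, tsum_mul_tsum_prod (hasSum_thB' h2).summable (hasSum_thB' h2).summable]

/-- Triple product with base `q⁵` and `z = q⁻¹`, since `(10n+3)²/40 = 5n(n+1)/2 - n + 9/40`. -/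
lemma hasSum_ten_mul_add_three {z : ℂ} (hz : 0 < z.im) :
    HasSum (fun n : ℤ => ee (((10 * n + 3) ^ 2 : ℤ) * z / 40))
      (ee (9 * z / 40) * (euler (ee z ^ 5) *
        ((∏' n : ℕ, (1 + ee z ^ (5 * n + 4))) * ∏' n : ℕ, (1 + ee z ^ (5 * n + 1))))) := by
  have hq := norm_ee_lt_one hz
  have h0 := ee_ne_zero z
  have h := (hasSum_tripleProduct (norm_pow_lt_one hq (n := 5) (by norm_num)) (pow_ne_zero 5 h0)
    (inv_ne_zero h0)).mul_left (ee (9 * z / 40))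
  have e1 : ∀ n : ℕ, (ee z)⁻¹ * (ee z ^ 5) ^ (n + 1) = ee z ^ (5 * n + 4) := fun n => by
    field_simp
    ring
  have e2 : ∀ n : ℕ, ((ee z)⁻¹)⁻¹ * (ee z ^ 5) ^ n = ee z ^ (5 * n + 1) := fun n => by
    rw [inv_inv]
    ring
  simp only [e1, e2] at h
  refine h.congr_fun fun n => ?_
  rw [inv_zpow', ← zpow_natCast, ← zpow_mul, ← ee_zsmul, ← ee_zsmul, ← ee_add, ← ee_add]
  congr 1
  have h2 : (((n * (n + 1) / 2 : ℤ) : ℂ)) * 2 = n * (n + 1) := by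
    exact_mod_cast even_mul_succ_ediv n
  push_cast
  linear_combination -(5 / 2) * z * h2

lemma hasSum_ten_mul_add_one {z : ℂ} (hz : 0 < z.im) :
    HasSum (fun n : ℤ => ee (((10 * n + 1) ^ 2 : ℤ) * z / 40))
      (ee (z / 40) * (euler (ee z ^ 5) *
        ((∏' n : ℕ, (1 + ee z ^ (5 * n + 3))) * ∏' n : ℕ, (1 + ee z ^ (5 * n + 2))))) := by
  have hq := norm_ee_lt_one hz
  have h0 := ee_ne_zero z
  have h := (hasSum_tripleProduct (norm_pow_lt_one hq (n := 5) (by norm_num)) (pow_ne_zero 5 h0)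
    (inv_ne_zero (pow_ne_zero 2 h0))).mul_left (ee (z / 40))
  have e1 : ∀ n : ℕ, (ee z ^ 2)⁻¹ * (ee z ^ 5) ^ (n + 1) = ee z ^ (5 * n + 3) := fun n => by
    field_simp
    ring
  have e2 : ∀ n : ℕ, ((ee z ^ 2)⁻¹)⁻¹ * (ee z ^ 5) ^ n = ee z ^ (5 * n + 2) := fun n => by
    rw [inv_inv]
    ring
  simp only [e1, e2] at h
  refine h.congr_fun fun n => ?_
  rw [inv_zpow', ← zpow_natCast, ← zpow_natCast, ← zpow_mul, ← zpow_mul, ← ee_zsmul, ← ee_zsmul,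
    ← ee_add, ← ee_add]
  congr 1
  have h2 : (((n * (n + 1) / 2 : ℤ) : ℂ)) * 2 = n * (n + 1) := by
    exact_mod_cast even_mul_succ_ediv n
  push_cast
  linear_combination -(5 / 2) * z * h2

lemma eulerPlus_residues {q : ℂ} (hq : ‖q‖ < 1) : eulerPlus q =
    (∏' n : ℕ, (1 + q ^ (5 * n + 1))) * (∏' n : ℕ, (1 + q ^ (5 * n + 2))) *
      (∏' n : ℕ, (1 + q ^ (5 * n + 3))) * (∏' n : ℕ, (1 + q ^ (5 * n + 4))) *
      eulerPlus (q ^ 5) := by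
  rw [eulerPlus, tprod_residues 5 (multipliable_one_add_pow_succ hq)]
  · simp only [Finset.prod_range_succ, Finset.prod_range_zero, one_mul, add_assoc]
    norm_num
    exact Or.inl (tprod_congr fun n => by ring)
  · intro i _
    have := multipliable_one_add_mul_pow (norm_pow_lt_one hq (n := 5) (by norm_num)) (q ^ (i + 1))
    exact this.congr fun n => by ring

/-- The square `thB(z/2)²` runs over pairs of odd integers `(M, N)`, here split by `2M + N` modulo
5. Where 5 divides `2M + N` the pair is a multiple of a Gaussian prime above 5, and the sum is the
same series at `5z`. Quarter turns and negation permute the other four classes, so they have equal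
sums, and one of them factors as a product of two one-dimensional series. -/
lemma thB_sq_sub_eq_mul {z : ℂ} (hz : 0 < z.im) :
    thB (z / 2) ^ 2 - thB (5 * z / 2) ^ 2 =
      4 * ((∑' n : ℤ, ee (((10 * n + 3) ^ 2 : ℤ) * z / 40)) *
        ∑' n : ℤ, ee (((10 * n + 1) ^ 2 : ℤ) * z / 40)) := by
  have h5 := im_ofNat_mul hz 5 (by norm_num)
  push_cast at h5
  let G : ℤ × ℤ → ℂ := fun p => oddSquareTerm z (p.1, p.2 - 2 * p.1 - 1)
  have hG : Summable G := by
    refine (summable_oddSquareTerm hz).comp_injective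
      (i := fun p : ℤ × ℤ => (p.1, p.2 - 2 * p.1 - 1)) ?_
    rintro ⟨a, b⟩ ⟨c, d⟩ h
    simp only [Prod.mk.injEq] at h
    ext <;> simp <;> omega
  have h0 : ∑' p, G p = thB (z / 2) ^ 2 := by
    rw [← tsum_oddSquareTerm hz, ← tsum_affine (oddSquareTerm z) 1 0 (-2) 1 0 (-1) (by norm_num)]
    refine tsum_congr fun p => ?_
    simp only [G]
    congr 2 <;> ring
  have hc2 : ∑' p : ℤ × ℤ, G (p.1, 5 * p.2 + 2) = thB (5 * z / 2) ^ 2 := by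
    rw [← tsum_oddSquareTerm h5, ← tsum_affine (oddSquareTerm (5 * z)) 1 (-2) 0 1 (-1) 0 (by norm_num)]
    refine tsum_congr fun p => ?_
    simp only [G, oddSquareTerm]
    congr 1
    push_cast
    ring
  have h04 : ∑' p : ℤ × ℤ, G (p.1, 5 * p.2 + 4) = ∑' p : ℤ × ℤ, G (p.1, 5 * p.2) := by
    refine Eq.trans ?_ (tsum_affine _ (-1) 0 0 (-1) (-1) (-1) (by norm_num))
    refine tsum_congr fun p => ?_
    simp only [G, oddSquareTerm]
    congr 1
    push_cast
    ring
  have h13 : ∑' p : ℤ × ℤ, G (p.1, 5 * p.2 + 3) = ∑' p : ℤ × ℤ, G (p.1, 5 * p.2 + 1) := by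
    refine Eq.trans ?_ (tsum_affine _ (-1) 0 0 (-1) (-1) (-1) (by norm_num))
    refine tsum_congr fun p => ?_
    simp only [G, oddSquareTerm]
    congr 1
    push_cast
    ring
  have h03 : ∑' p : ℤ × ℤ, G (p.1, 5 * p.2 + 3) = ∑' p : ℤ × ℤ, G (p.1, 5 * p.2) := by
    rw [← tsum_affine (fun p : ℤ × ℤ => G (p.1, 5 * p.2 + 3)) (-2) 5 (-1) 2 (-1) (-1) (by norm_num)]
    refine tsum_congr fun p => ?_
    simp only [G, oddSquareTerm]
    congr 1
    push_cast
    ring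
  have hs1 : ∑' p : ℤ × ℤ, G (p.1, 5 * p.2 + 1) =
      (∑' n : ℤ, ee (((10 * n + 3) ^ 2 : ℤ) * z / 40)) *
        ∑' n : ℤ, ee (((10 * n + 1) ^ 2 : ℤ) * z / 40) := by
    rw [tsum_mul_tsum_prod (hasSum_ten_mul_add_three hz).summable
      (hasSum_ten_mul_add_one hz).summable]
    refine Eq.trans ?_ (tsum_affine _ 0 1 (-1) 2 0 0 (by norm_num))
    refine tsum_congr fun p => ?_
    simp only [G, oddSquareTerm]
    rw [← ee_add]
    congr 1
    push_cast
    ring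
  rw [← h0, ← hc2, ← hs1, tsum_snd_residues 5 hG]
  simp only [Finset.sum_range_succ, Finset.sum_range_zero, zero_add]
  push_cast
  simp only [add_zero]
  rw [h04, ← h03, h13]
  ring
-- The four products from the two series run over the exponents prime to 5, so together they are
-- `eulerPlus q / eulerPlus (q⁵)`.
theorem thB_sq_sub {z : ℂ} (hz : 0 < z.im) :
    thB (z / 2) ^ 2 - thB (5 * z / 2) ^ 2 =
      4 * (eta (2 * z) * eta (5 * z) ^ 3 / (eta z * eta (10 * z))) := by
  have hq := norm_ee_lt_one hz
  have hq5 := norm_pow_lt_one hq (n := 5) (by norm_num)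
  rw [thB_sq_sub_eq_mul hz, (hasSum_ten_mul_add_three hz).tsum_eq,
    (hasSum_ten_mul_add_one hz).tsum_eq]
  have h1 := eta_eq z
  have h2 := eta_nat_mul 2 z
  have h5 := eta_nat_mul 5 z
  have h10 := eta_nat_mul 10 z
  have p1 := eulerPlus_mul_euler hq
  have p5 := eulerPlus_mul_euler hq5
  rw [← pow_mul] at p5
  have hr := eulerPlus_residues hq
  have n1 := euler_ne_zero hq
  have n5 := euler_ne_zero hq5
  have n10 := euler_ne_zero (norm_pow_lt_one hq (n := 10) (by norm_num))
  have n0 := ee_ne_zero (z / 24)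
  have hm : ee (9 * z / 40) * ee (z / 40) = ee (z / 24) ^ 6 := by
    rw [← ee_add, ← ee_nsmul]
    congr 1
    push_cast
    ring
  push_cast at h2 h5 h10
  rw [h1, h2, h5, h10]
  rw [hr] at p1
  generalize (∏' n : ℕ, (1 + ee z ^ (5 * n + 1))) = a1 at *
  generalize (∏' n : ℕ, (1 + ee z ^ (5 * n + 2))) = a2 at *
  generalize (∏' n : ℕ, (1 + ee z ^ (5 * n + 3))) = a3 at *
  generalize (∏' n : ℕ, (1 + ee z ^ (5 * n + 4))) = a4 at *
  rw [← p1]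
  norm_num at p5
  rw [← p5]
  rw [← p5] at n10
  have n6 := left_ne_zero_of_mul n10
  field_simp
  linear_combination a1 * a2 * a3 * a4 * hm

end

section

open ModularForm (eta)

/-! ### The relations between `t`, `x` and `y` -/

lemma csqrt_sq (z : ℂ) : Complex.sqrt z ^ 2 = z := by
  rw [Complex.sqrt, ← Complex.cpow_mul_nat]
  norm_num

lemma csqrt_ne_zero {z : ℂ} (hz : z ≠ 0) : Complex.sqrt z ≠ 0 := fun h => hz (by
  rw [← csqrt_sq z, h]
  norm_num)

lemma csqrt_natCast_mul (d : ℕ) (hd : d ≠ 0) {z : ℂ} (hz : z ≠ 0) :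
    Complex.sqrt (d * z) = Complex.sqrt d * Complex.sqrt z := by
  have hd' : (d : ℂ) ≠ 0 := Nat.cast_ne_zero.mpr hd
  have h := Complex.log_ofReal_mul (r := (d : ℝ)) (by positivity) hz
  rw [sqrt_eq_exp (mul_ne_zero hd' hz), sqrt_eq_exp hd', sqrt_eq_exp hz, ← Complex.exp_add]
  congr 1
  rw [← Complex.ofReal_natCast, h, Complex.ofReal_log (Nat.cast_nonneg d)]
  push_cast
  ring

lemma eta_inv {z : ℂ} (hz : 0 < z.im) :
    eta (-1 / z) = (Complex.sqrt Complex.I)⁻¹ * (Complex.sqrt z * eta z) := by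
  simpa using ModularForm.eta_comp_eq_csqrt_I_inv hz

/-- The values `η(d z)` for `d ∣ 20` and the relations between them. -/
structure EtaRelations (e1 e2 e4 e5 e10 e20 : ℂ) : Prop where
  h1 : e1 ≠ 0
  h2 : e2 ≠ 0
  h4 : e4 ≠ 0
  h5 : e5 ≠ 0
  h10 : e10 ≠ 0
  h20 : e20 ≠ 0
  hV : 1 + 4 * (e2 * e10 ^ 3 / (e1 ^ 3 * e5)) = e5 ^ 4 * e2 ^ 2 / (e10 ^ 2 * e1 ^ 4)
  hW : 1 + 5 * (e2 * e10 ^ 3 / (e1 ^ 3 * e5)) = e2 ^ 5 * e5 / (e1 ^ 5 * e10)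
  hS : e2 * e10 ^ 3 / (e1 ^ 3 * e5) + 4 * (e2 ^ 2 * e4 * e5 * e20 ^ 3 / (e1 ^ 5 * e10 ^ 2)) =
    e2 ^ 7 * e5 ^ 3 * e20 ^ 2 / (e1 ^ 7 * e4 ^ 2 * e10 ^ 3)
  hJ : (e2 ^ 5 / (e1 ^ 2 * e4 ^ 2)) ^ 4 - (2 * e4 ^ 2 / e2) ^ 4 = (e1 ^ 2 / e2) ^ 4
  hJ5 : (e10 ^ 5 / (e5 ^ 2 * e20 ^ 2)) ^ 4 - (2 * e20 ^ 2 / e10) ^ 4 = (e5 ^ 2 / e10) ^ 4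
  hK : 1 + e2 ^ 5 * e20 ^ 2 / (e1 ^ 3 * e5 * e4 ^ 2 * e10) =
    e4 ^ 2 * e10 ^ 5 / (e1 * e2 * e5 ^ 3 * e20 ^ 2)

/-- With `V`, `W` for the eta quotients on the right of `hV`, `hW`: `thB_sq_sub` gives `W - x = V`,
and its image under `z ↦ -1/(10z)` gives `5V - 1 = 4W`. Solving this linear system yields `hV` and
`hW`. The relations `hS` and `hK` are the two bilinear theta identities of level 5, and `hJ`, `hJ5`
are Jacobi's identity at `z` and `5z`. -/
theorem etaRelations {z : ℂ} (hz : 0 < z.im) :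
    EtaRelations (eta z) (eta (2 * z)) (eta (4 * z)) (eta (5 * z)) (eta (10 * z))
      (eta (20 * z)) := by
  have i2 := im_ofNat_mul hz 2 (by norm_num)
  have i4 := im_ofNat_mul hz 4 (by norm_num)
  have i5 := im_ofNat_mul hz 5 (by norm_num)
  have i10 := im_ofNat_mul hz 10 (by norm_num)
  have i20 := im_ofNat_mul hz 20 (by norm_num)
  push_cast at i2 i4 i5 i10 i20
  have h1 := eta_ne_zero' hz
  have h2 := eta_ne_zero' i2
  have h4 := eta_ne_zero' i4
  have h5 := eta_ne_zero' i5
  have h10 := eta_ne_zero' i10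
  have h20 := eta_ne_zero' i20
  have hsub : ∀ {w : ℂ}, 0 < w.im → (2 * eta (2 * w) ^ 2 / eta w) ^ 2 -
      (2 * eta (10 * w) ^ 2 / eta (5 * w)) ^ 2 =
      4 * (eta (2 * w) * eta (5 * w) ^ 3 / (eta w * eta (10 * w))) := by
    intro w hw
    have j2 := im_div_pos hw two_pos
    have j52 := im_div_pos (im_ofNat_mul hw 5 (by norm_num)) two_pos
    push_cast at j2 j52
    have h := thB_sq_sub hw
    rw [thB_eq j2, thB_eq j52] at h
    rwa [show 4 * (w / 2) = 2 * w by ring, show 2 * (w / 2) = w by ring,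
      show 4 * (5 * w / 2) = 10 * w by ring, show 2 * (5 * w / 2) = 5 * w by ring] at h
  have r1 := hsub hz
  have hz0 : z ≠ 0 := by rintro rfl; simp at hz
  have r2 : 5 * (eta (5 * z) ^ 4 / eta (10 * z) ^ 2) - eta z ^ 4 / eta (2 * z) ^ 2 =
      4 * (eta (5 * z) * eta (2 * z) ^ 3 / (eta z * eta (10 * z))) := by
    have i0 : 0 < (-1 / (10 * z)).im := by
      rw [neg_div, Complex.neg_im, one_div, Complex.inv_im, neg_div, neg_neg]
      exact div_pos i10 (Complex.normSq_pos.mpr (by simpa using hz0))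
    have h := hsub i0
    rw [show 2 * (-1 / (10 * z)) = -1 / (5 * z) by field_simp; norm_num,
      show 5 * (-1 / (10 * z)) = -1 / (2 * z) by field_simp; norm_num,
      show 10 * (-1 / (10 * z)) = -1 / z by field_simp, eta_inv hz, eta_inv i2, eta_inv i5,
      eta_inv i10] at h
    have s2 := csqrt_natCast_mul 2 (by norm_num) hz0
    have s5 := csqrt_natCast_mul 5 (by norm_num) hz0
    have s10 := csqrt_natCast_mul 10 (by norm_num) hz0
    have s25 := csqrt_natCast_mul 2 (by norm_num) (z := 5) (by norm_num)
    have q2 : Complex.sqrt 2 ^ 2 = 2 := csqrt_sq 2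
    have q5 : Complex.sqrt 5 ^ 2 = 5 := csqrt_sq 5
    norm_num at s2 s5 s10 s25
    rw [s2, s5, s10, s25] at h
    have nI : Complex.sqrt Complex.I ≠ 0 := csqrt_ne_zero Complex.I_ne_zero
    have nz : Complex.sqrt z ≠ 0 := csqrt_ne_zero hz0
    have n2 : Complex.sqrt 2 ≠ 0 := csqrt_ne_zero two_ne_zero
    have n5 : Complex.sqrt 5 ≠ 0 := csqrt_ne_zero (by norm_num)
    generalize Complex.sqrt Complex.I = cI at *
    generalize Complex.sqrt z = cz at *
    generalize Complex.sqrt 2 = c2 at *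
    generalize Complex.sqrt 5 = c5 at *
    generalize eta z = e1 at *
    generalize eta (2 * z) = e2 at *
    generalize eta (5 * z) = e5 at *
    generalize eta (10 * z) = e10 at *
    clear hsub r1 s2 s5 s10 s25 i0
    field_simp at h ⊢
    rw [q5] at h
    linear_combination h / 4 + e5 * e10 * e2 ^ 5 * (c2 ^ 2 + 2) * q2
  have r3 := thA_mul_thD_sub hz
  have r4 := thA_mul_thB_sub hz
  have hJ := thA_pow_four_sub hz
  have hJ5 := thA_pow_four_sub i5
  rw [thA_eq hz, thB_eq hz] at hJ
  rw [thA_eq i5, thB_eq i5] at hJ5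
  rw [thA_eq hz, thD_eq i5, thD_eq hz, thA_eq i5] at r3
  rw [thA_eq hz, thB_eq i5, thB_eq hz, thA_eq i5] at r4
  rw [show 2 * (5 * z) = 10 * z by ring, show 4 * (5 * z) = 20 * z by ring] at r3 r4 hJ5
  generalize eta z = e1 at *
  generalize eta (2 * z) = e2 at *
  generalize eta (4 * z) = e4 at *
  generalize eta (5 * z) = e5 at *
  generalize eta (10 * z) = e10 at *
  generalize eta (20 * z) = e20 at *
  have r1' : e2 ^ 5 * e5 / (e1 ^ 5 * e10) - e2 * e10 ^ 3 / (e1 ^ 3 * e5) =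
      e5 ^ 4 * e2 ^ 2 / (e10 ^ 2 * e1 ^ 4) := by
    field_simp at r1 ⊢
    linear_combination r1 / 4
  have r2' : 5 * (e5 ^ 4 * e2 ^ 2 / (e10 ^ 2 * e1 ^ 4)) - 1 =
      4 * (e2 ^ 5 * e5 / (e1 ^ 5 * e10)) := by
    field_simp at r2 ⊢
    linear_combination r2
  refine ⟨h1, h2, h4, h5, h10, h20, ?_, ?_, ?_, hJ, hJ5, ?_⟩
  · linear_combination -4 * r1' - r2'
  · linear_combination -5 * r1' - r2'
  · clear r1 r2 r1' r2' r4
    field_simp at r3 ⊢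
    linear_combination -r3
  · clear r1 r2 r1' r2' r3
    field_simp at r4 ⊢
    linear_combination r4

/-- The polynomial expression of `p_a^{(β)}` in `t`, `x`, `y`. -/
def genPoly {K : Type*} [CommRing K] (β a : Fin 2) (t x y : K) : K :=
  match β, a with
  | 0, 0 => 1 + 5 * t + 64 * x + 600 * t * x + 208 * x ^ 2 + 2000 * t * x ^ 2 + 4 * y +
      1000 * t * y + 12500 * t ^ 2 * y - 992 * x * y - 12000 * t * x * y - 3520 * x ^ 2 * y -
      40000 * t * x ^ 2 * y
  | 0, 1 => 1 + 9 * t + 8 * x + 64 * t * x + 16 * x ^ 2 + 80 * t * x ^ 2 + 4 * y + 8 * t * y +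
      500 * t ^ 2 * y + 32 * x * y - 480 * t * x * y + 64 * x ^ 2 * y - 1600 * t * x ^ 2 * y
  | 1, 0 => 85 * t + 625 * t ^ 2 - 24 * x - 64 * x ^ 2 - 4 * y - 1000 * t * y -
      12500 * t ^ 2 * y + 992 * x * y + 12000 * t * x * y + 3520 * x ^ 2 * y +
      40000 * t * x ^ 2 * y
  | 1, 1 => t + 25 * t ^ 2 - 8 * t * x - 4 * y - 8 * t * y - 500 * t ^ 2 * y - 32 * x * y +
      480 * t * x * y - 64 * x ^ 2 * y + 1600 * t * x ^ 2 * y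

lemma p_eq_genPoly : ∀ β a : Fin 2, p β a = genPoly β a t x y := by
  have h00 : p 0 0 = genPoly 0 0 t x y := by
    rw [show p 0 0 = p00 from rfl]
    rw [p00, genPoly]
  have h01 : p 0 1 = genPoly 0 1 t x y := by
    rw [show p 0 1 = p01 from rfl]
    rw [p01, genPoly]
  have h10 : p 1 0 = genPoly 1 0 t x y := by
    rw [show p 1 0 = p10 from rfl]
    rw [p10, genPoly]
  have h11 : p 1 1 = genPoly 1 1 t x y := by
    rw [show p 1 1 = p11 from rfl]
    rw [p11, genPoly]
  exact Fin.forall_fin_two.mpr ⟨Fin.forall_fin_two.mpr ⟨h00, h01⟩, Fin.forall_fin_two.mpr ⟨h10, h11⟩⟩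

/-- Points of the curve `4 y² + y + 6 x y = x² (1 + 5 x)` away from the zeros and poles of the
units `x`, `1 + 4 x`, `1 + 5 x`, `x + 4 y`. -/
structure CurvePoint (x y V W S : ℂ) : Prop where
  hV : V = 1 + 4 * x
  hW : W = 1 + 5 * x
  hS : S = x + 4 * y
  nx : x ≠ 0
  nV : V ≠ 0
  nW : W ≠ 0
  nS : S ≠ 0
  hE : 4 * y ^ 2 + y + 6 * x * y = x ^ 2 * (1 + 5 * x)

namespace CurvePoint

variable {x y V W S : ℂ}

/-- On the curve `S (S + V) = x V W`, and `S + V = W + 4 y`. Division by `S` thus becomes linear in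
`y`. -/
lemma v_div_s (h : CurvePoint x y V W S) : V / S = (W + 4 * y) / (x * W) := by
  have ⟨hV, hW, hS, nx, nV, nW, nS, hE⟩ := h
  field_simp
  subst hV hW hS
  linear_combination -4 * hE

/-- For the eta quotients, `V W³ y² / S³` is `(η(4z)/η(z))^8` and `y² S / (V³ W)` is its value at
`5z`. Reducing such products to the form `A(x) + B(x) y` by the curve equation makes them comparable
with the generators, which are linear in `y`. -/
lemma m_mul_z (h : CurvePoint x y V W S) : S / (x * W) * (V * W ^ 3 * y ^ 2 / S ^ 3) =
    (5 * x ^ 2 * W - y * (1 + 10 * x)) / (4 * x) := by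
  have ⟨hV, hW, hS, nx, nV, nW, nS, hE⟩ := h
  field_simp
  subst hV hW hS
  linear_combination (4 * y + 40 * x * y + 5 * x ^ 2) * hE

lemma n_mul_z (h : CurvePoint x y V W S) : V / S * (V * W ^ 3 * y ^ 2 / S ^ 3) =
    (4 * W ^ 2 + 25 * x ^ 2 * W + 5 * y * (3 + 10 * x)) / (4 * W) := by
  have ⟨hV, hW, hS, nx, nV, nW, nS, hE⟩ := h
  field_simp
  subst hV hW hS
  linear_combination (4*y - 16*y^2 - 960*y^3 + 88*x*y - 1280*x*y^2 - 3200*x*y^3 + 4*x^2 +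
    360*x^2*y - 6400*x^2*y^2 + 20*x^3 + 400*x^3*y - 8000*x^3*y^2 + 25*x^4) * hE

lemma n_mul_z5 (h : CurvePoint x y V W S) : V / S * (y ^ 2 * S / (V ^ 3 * W)) =
    (x ^ 2 * W - y * (1 + 6 * x)) / (4 * V ^ 2 * W) := by
  have ⟨hV, hW, hS, nx, nV, nW, nS, hE⟩ := h
  field_simp
  subst hV hW hS
  linear_combination hE

lemma m_mul_z5 (h : CurvePoint x y V W S) : S / (x * W) * (y ^ 2 * S / (V ^ 3 * W)) =
    (x ^ 2 * (1 + x) - y * (1 + 2 * x)) / (4 * x * V ^ 2) := by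
  have ⟨hV, hW, hS, nx, nV, nW, nS, hE⟩ := h
  field_simp
  subst hV hW hS
  linear_combination (1 - 4*y + 16*y^2 + 10*x - 16*x*y + 29*x^2 + 20*x^3) * hE

lemma genPoly_one_one (h : CurvePoint x y V W S) : genPoly 1 1 (x * V ^ 2 / W) x y = x * V ^ 2 / W / 5 *
    (6 - S / (x * W) * (1 - 64 * (V * W ^ 3 * y ^ 2 / S ^ 3))) := by
  rw [mul_sub (S / (x * W)), mul_left_comm (S / (x * W)), h.m_mul_z]
  have ⟨hV, hW, hS, nx, nV, nW, nS, hE⟩ := h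
  simp only [genPoly]
  field_simp
  subst hV hW hS
  ring

lemma genPoly_zero_one (h : CurvePoint x y V W S) : genPoly 0 1 (x * V ^ 2 / W) x y = x * V ^ 2 / W / 5 *
    (6 + V / S * (5 + 64 * (V * W ^ 3 * y ^ 2 / S ^ 3))) := by
  rw [mul_add (V / S), mul_left_comm (V / S), h.n_mul_z, h.v_div_s]
  have ⟨hV, hW, hS, nx, nV, nW, nS, hE⟩ := h
  simp only [genPoly]
  field_simp
  subst hV hW hS
  ring

lemma genPoly_one_zero (h : CurvePoint x y V W S) : genPoly 1 0 (x * V ^ 2 / W) x y =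
    1 + 64 * (x * V ^ 2 / W) + 625 * (x * V ^ 2 / W) ^ 2 - x * V ^ 2 / W *
    (V / S * (1 - 64 * (y ^ 2 * S / (V ^ 3 * W)))) := by
  rw [mul_sub (V / S), mul_left_comm (V / S), h.n_mul_z5, h.v_div_s]
  have ⟨hV, hW, hS, nx, nV, nW, nS, hE⟩ := h
  simp only [genPoly]
  field_simp
  subst hV hW hS
  ring

lemma genPoly_zero_zero (h : CurvePoint x y V W S) : genPoly 0 0 (x * V ^ 2 / W) x y =
    1 + 64 * (x * V ^ 2 / W) + 625 * (x * V ^ 2 / W) ^ 2 + x * V ^ 2 / W *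
    (S / (x * W) * (5 + 64 * (y ^ 2 * S / (V ^ 3 * W)))) := by
  rw [mul_add (S / (x * W)), mul_left_comm (S / (x * W)), h.m_mul_z5]
  have ⟨hV, hW, hS, nx, nV, nW, nS, hE⟩ := h
  simp only [genPoly]
  field_simp
  subst hV hW hS
  ring

/-- The sum in brackets is a rational function of `x` times `1 + 6x + 8y`, whose square is the
discriminant `(1 + 4x)(1 + 8x + 20x²)` of the curve equation in `y`. So the square depends on `x`
only, and it equals `100 (1 + 12x + 40x²)² (1 + 8x + 20x²) / W²`, a polynomial in `t`. -/
lemma sq_odd (h : CurvePoint x y V W S) : 4 * x ^ 2 / V * (S / (x * W) * (1 - 64 * (V * W ^ 3 * y ^ 2 / S ^ 3)) +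
    V / S * (5 + 64 * (V * W ^ 3 * y ^ 2 / S ^ 3))) ^ 2 =
    100 * (1 + 22 * (x * V ^ 2 / W) + 125 * (x * V ^ 2 / W) ^ 2) := by
  have key : S / (x * W) * (1 - 64 * (V * W ^ 3 * y ^ 2 / S ^ 3)) +
      V / S * (5 + 64 * (V * W ^ 3 * y ^ 2 / S ^ 3)) =
      5 * (1 + 12 * x + 40 * x ^ 2) * (1 + 6 * x + 8 * y) / (x * W) := by
    rw [mul_sub, mul_add, mul_left_comm _ 64, mul_left_comm _ 64, h.m_mul_z, h.n_mul_z, h.v_div_s]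
    have ⟨hV, hW, hS, nx, nV, nW, nS, hE⟩ := h
    field_simp
    subst hV hW hS
    ring
  rw [key]
  have ⟨hV, hW, hS, nx, nV, nW, nS, hE⟩ := h
  field_simp
  subst hV hW hS
  linear_combination (1600 * (1 + 12 * x + 40 * x ^ 2) ^ 2) * hE

lemma sq_even (h : CurvePoint x y V W S) : 4 * W ^ 2 / V * (V / S * (1 - 64 * (y ^ 2 * S / (V ^ 3 * W))) +
    S / (x * W) * (5 + 64 * (y ^ 2 * S / (V ^ 3 * W)))) ^ 2 * (x * V ^ 2 / W) ^ 2 =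
    4 * (1 + 22 * (x * V ^ 2 / W) + 125 * (x * V ^ 2 / W) ^ 2) := by
  have key : V / S * (1 - 64 * (y ^ 2 * S / (V ^ 3 * W))) +
      S / (x * W) * (5 + 64 * (y ^ 2 * S / (V ^ 3 * W))) =
      (1 + 12 * x + 40 * x ^ 2) * (1 + 6 * x + 8 * y) / (x * W * V ^ 2) := by
    rw [mul_sub, mul_add, mul_left_comm _ 64, mul_left_comm _ 64, h.m_mul_z5, h.n_mul_z5, h.v_div_s]
    have ⟨hV, hW, hS, nx, nV, nW, nS, hE⟩ := h
    field_simp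
    subst hV hW hS
    ring
  rw [key]
  have ⟨hV, hW, hS, nx, nV, nW, nS, hE⟩ := h
  field_simp
  subst hV hW hS
  linear_combination (16 * (1 + 12 * x + 40 * x ^ 2) ^ 2) * hE

end CurvePoint

namespace EtaRelations

variable {e1 e2 e4 e5 e10 e20 : ℂ}

lemma curvePoint (h : EtaRelations e1 e2 e4 e5 e10 e20) :
    CurvePoint (e2 * e10 ^ 3 / (e1 ^ 3 * e5)) (e2 ^ 2 * e4 * e5 * e20 ^ 3 / (e1 ^ 5 * e10 ^ 2))
      (e5 ^ 4 * e2 ^ 2 / (e10 ^ 2 * e1 ^ 4)) (e2 ^ 5 * e5 / (e1 ^ 5 * e10))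
      (e2 ^ 7 * e5 ^ 3 * e20 ^ 2 / (e1 ^ 7 * e4 ^ 2 * e10 ^ 3)) := by
  have ⟨h1, h2, h4, h5, h10, h20, hV, hW, hS, hJ, hJ5, hK⟩ := h
  have hprod : e2 ^ 7 * e5 ^ 3 * e20 ^ 2 / (e1 ^ 7 * e4 ^ 2 * e10 ^ 3) *
      (e2 ^ 7 * e5 ^ 3 * e20 ^ 2 / (e1 ^ 7 * e4 ^ 2 * e10 ^ 3) +
        e5 ^ 4 * e2 ^ 2 / (e10 ^ 2 * e1 ^ 4)) =
      e2 * e10 ^ 3 / (e1 ^ 3 * e5) * (e5 ^ 4 * e2 ^ 2 / (e10 ^ 2 * e1 ^ 4)) *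
        (e2 ^ 5 * e5 / (e1 ^ 5 * e10)) := by
    clear hV hW hS hJ hJ5
    field_simp at hK ⊢
    linear_combination hK
  refine ⟨hV.symm, hW.symm, hS.symm, by positivity, by positivity, by positivity, by positivity, ?_⟩
  rw [← hV, ← hW, ← hS] at hprod
  linear_combination hprod / 4

lemma t_eq (h : EtaRelations e1 e2 e4 e5 e10 e20) : e5 ^ 6 / e1 ^ 6 =
    e2 * e10 ^ 3 / (e1 ^ 3 * e5) * (e5 ^ 4 * e2 ^ 2 / (e10 ^ 2 * e1 ^ 4)) ^ 2 /
      (e2 ^ 5 * e5 / (e1 ^ 5 * e10)) := by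
  have ⟨h1, h2, h4, h5, h10, h20, hV, hW, hS, hJ, hJ5, hK⟩ := h
  field_simp

end EtaRelations

/-- `η(5z)⁶ / η(z)⁶` -/
def tFun (z : ℂ) : ℂ := eta (5 * z) ^ 6 / eta z ^ 6

/-- `η(2z) η(10z)³ / (η(z)³ η(5z))` -/
def xFun (z : ℂ) : ℂ := eta (2 * z) * eta (10 * z) ^ 3 / (eta z ^ 3 * eta (5 * z))

/-- `η(2z)² η(4z) η(5z) η(20z)³ / (η(z)⁵ η(10z)²)` -/
def yFun (z : ℂ) : ℂ :=
  eta (2 * z) ^ 2 * eta (4 * z) * eta (5 * z) * eta (20 * z) ^ 3 / (eta z ^ 5 * eta (10 * z) ^ 2)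

/-! ### Generators and cross products in terms of theta vectors -/

section values

variable {z : ℂ}

theorem yFun_sq (hz : 0 < z.im) :
    4 * yFun z ^ 2 + yFun z + 6 * xFun z * yFun z = xFun z ^ 2 * (1 + 5 * xFun z) :=
  (etaRelations hz).curvePoint.hE

theorem tFun_mul (hz : 0 < z.im) :
    tFun z * (1 + 5 * xFun z) = xFun z * (1 + 4 * xFun z) ^ 2 := by
  have h := (etaRelations hz).curvePoint
  rw [tFun, (etaRelations hz).t_eq, xFun, ← h.hV, ← h.hW, div_mul_cancel₀ _ h.nW]

/-- The gradient vector `(f_Y, -f_X)` of the sextic form `f = X Y (X⁴ - Y⁴)`. -/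
def sexticGrad (v : Fin 2 → ℂ) : Fin 2 → ℂ :=
  ![v 0 ^ 5 - 5 * v 1 ^ 4 * v 0, v 1 ^ 5 - 5 * v 1 * v 0 ^ 4]

/-- The vector of theta functions `(∑ q^((n + 1/2)²), ∑ q^(n²))`. -/
def theta (z : ℂ) : Fin 2 → ℂ := ![thB z, thA z]

lemma theta_ne_zero (hz : 0 < z.im) (β : Fin 2) : theta z β ≠ 0 := by
  have h1 := eta_ne_zero' hz
  have h2 := eta_ne_zero' (im_ofNat_mul hz 2 (by norm_num))
  have h4 := eta_ne_zero' (im_ofNat_mul hz 4 (by norm_num))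
  push_cast at h2 h4
  fin_cases β
  · simp [theta, thB_eq hz, h2, h4]
  · simp [theta, thA_eq hz, h1, h2, h4]

/-- The cross product of two vectors of length two. -/
def wedge (v w : Fin 2 → ℂ) : ℂ := v 1 * w 0 - v 0 * w 1

/-- The eta quotient has weight -2 and lowers the weight 5/2 of the gradient to 1/2. Its multiplier
is such that the result transforms under Γ₀(5) like `theta (5z)`, although it is built from `theta
z`; `gradEven` is the counterpart with `z` and `5z` exchanged. -/
def gradOdd (z : ℂ) : Fin 2 → ℂ := (eta (5 * z) / eta z ^ 5) • sexticGrad (theta z)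

def gradEven (z : ℂ) : Fin 2 → ℂ := (eta z / eta (5 * z) ^ 5) • sexticGrad (theta (5 * z))

lemma sexticGrad_zero {A B D k : ℂ} (hJ : A ^ 4 - B ^ 4 = D ^ 4) (hB : B ^ 4 = 16 * k * D ^ 4) :
    sexticGrad ![B, A] 0 = -(B * D ^ 4 * (5 + 64 * k)) := by
  simp [sexticGrad]
  linear_combination -5 * B * hJ - 4 * B * hB

lemma sexticGrad_one {A B D k : ℂ} (hJ : A ^ 4 - B ^ 4 = D ^ 4) (hB : B ^ 4 = 16 * k * D ^ 4) :
    sexticGrad ![B, A] 1 = A * D ^ 4 * (1 - 64 * k) := by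
  simp [sexticGrad]
  linear_combination A * hJ - 4 * A * hB

lemma five_mul_im_pos (hz : 0 < z.im) : 0 < (5 * z).im := by
  have := im_ofNat_mul hz 5 (by norm_num)
  exact_mod_cast this

/-- This explains the shape of the generators: apart from coefficients in ℂ(t), `p_1^{(β)}` is the
quotient of the `β`-components of two vectors that transform alike. -/
theorem genPoly_odd (hz : 0 < z.im) (β : Fin 2) :
    genPoly β 1 (tFun z) (xFun z) (yFun z) =
      6 * tFun z / 5 - tFun z / 5 * (gradOdd z β / theta (5 * z) β) := by
  have i5 := five_mul_im_pos hz
  have hr := etaRelations hz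
  have hc := hr.curvePoint
  rw [tFun, xFun, yFun, gradOdd, theta, theta, thA_eq hz, thB_eq hz, thA_eq i5, thB_eq i5,
    show 2 * (5 * z) = 10 * z by ring, show 4 * (5 * z) = 20 * z by ring]
  generalize eta z = e1 at *
  generalize eta (2 * z) = e2 at *
  generalize eta (4 * z) = e4 at *
  generalize eta (5 * z) = e5 at *
  generalize eta (10 * z) = e10 at *
  generalize eta (20 * z) = e20 at *
  have hB : (2 * e4 ^ 2 / e2) ^ 4 = 16 * (e4 ^ 8 / e1 ^ 8) * (e1 ^ 2 / e2) ^ 4 := by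
    have ⟨h1, h2, h4, h5, h10, h20, hV, hW, hS, hJ, hJ5, hK⟩ := hr
    field_simp
    norm_num
  have hk : e4 ^ 8 / e1 ^ 8 = (e5 ^ 4 * e2 ^ 2 / (e10 ^ 2 * e1 ^ 4)) *
      (e2 ^ 5 * e5 / (e1 ^ 5 * e10)) ^ 3 *
      (e2 ^ 2 * e4 * e5 * e20 ^ 3 / (e1 ^ 5 * e10 ^ 2)) ^ 2 /
      (e2 ^ 7 * e5 ^ 3 * e20 ^ 2 / (e1 ^ 7 * e4 ^ 2 * e10 ^ 3)) ^ 3 := by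
    have ⟨h1, h2, h4, h5, h10, h20, hV, hW, hS, hJ, hJ5, hK⟩ := hr
    field_simp
  fin_cases β
  · have h0 := sexticGrad_zero hr.hJ hB
    have hp := hc.genPoly_zero_one
    rw [← hk] at hp
    simp only [Fin.zero_eta, Pi.smul_apply, smul_eq_mul]
    rw [h0, hr.t_eq, hp, ← hr.t_eq]
    generalize e4 ^ 8 / e1 ^ 8 = k at *
    have ⟨h1, h2, h4, h5, h10, h20, hV, hW, hS, hJ, hJ5, hK⟩ := hr
    clear hV hW hS hJ hJ5 hK hB hp hk h0 hc
    simp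
    field_simp
    ring
  · have h0 := sexticGrad_one hr.hJ hB
    have hp := hc.genPoly_one_one
    rw [← hk] at hp
    simp only [Fin.mk_one, Pi.smul_apply, smul_eq_mul]
    rw [h0, hr.t_eq, hp, ← hr.t_eq]
    generalize e4 ^ 8 / e1 ^ 8 = k at *
    have ⟨h1, h2, h4, h5, h10, h20, hV, hW, hS, hJ, hJ5, hK⟩ := hr
    clear hV hW hS hJ hJ5 hK hB hp hk h0 hc
    simp
    field_simp

theorem genPoly_even (hz : 0 < z.im) (β : Fin 2) :
    genPoly β 0 (tFun z) (xFun z) (yFun z) =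
      1 + 64 * tFun z + 625 * tFun z ^ 2 - tFun z * (gradEven z β / theta z β) := by
  have i5 := five_mul_im_pos hz
  have hr := etaRelations hz
  have hc := hr.curvePoint
  rw [tFun, xFun, yFun, gradEven, theta, theta, thA_eq hz, thB_eq hz, thA_eq i5, thB_eq i5,
    show 2 * (5 * z) = 10 * z by ring, show 4 * (5 * z) = 20 * z by ring]
  generalize eta z = e1 at *
  generalize eta (2 * z) = e2 at *
  generalize eta (4 * z) = e4 at *
  generalize eta (5 * z) = e5 at *
  generalize eta (10 * z) = e10 at *
  generalize eta (20 * z) = e20 at *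
  have hB : (2 * e20 ^ 2 / e10) ^ 4 = 16 * (e20 ^ 8 / e5 ^ 8) * (e5 ^ 2 / e10) ^ 4 := by
    have ⟨h1, h2, h4, h5, h10, h20, hV, hW, hS, hJ, hJ5, hK⟩ := hr
    field_simp
    norm_num
  have hk : e20 ^ 8 / e5 ^ 8 = (e2 ^ 2 * e4 * e5 * e20 ^ 3 / (e1 ^ 5 * e10 ^ 2)) ^ 2 *
      (e2 ^ 7 * e5 ^ 3 * e20 ^ 2 / (e1 ^ 7 * e4 ^ 2 * e10 ^ 3)) /
      ((e5 ^ 4 * e2 ^ 2 / (e10 ^ 2 * e1 ^ 4)) ^ 3 * (e2 ^ 5 * e5 / (e1 ^ 5 * e10))) := by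
    have ⟨h1, h2, h4, h5, h10, h20, hV, hW, hS, hJ, hJ5, hK⟩ := hr
    field_simp
  fin_cases β
  · have h0 := sexticGrad_zero hr.hJ5 hB
    have hp := hc.genPoly_zero_zero
    rw [← hk] at hp
    simp only [Fin.zero_eta, Pi.smul_apply, smul_eq_mul]
    rw [h0, hr.t_eq, hp, ← hr.t_eq]
    generalize e20 ^ 8 / e5 ^ 8 = k at *
    have ⟨h1, h2, h4, h5, h10, h20, hV, hW, hS, hJ, hJ5, hK⟩ := hr
    clear hV hW hS hJ hJ5 hK hB hp hk h0 hc
    simp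
    field_simp
    ring
  · have h0 := sexticGrad_one hr.hJ5 hB
    have hp := hc.genPoly_one_zero
    rw [← hk] at hp
    simp only [Fin.mk_one, Pi.smul_apply, smul_eq_mul]
    rw [h0, hr.t_eq, hp, ← hr.t_eq]
    generalize e20 ^ 8 / e5 ^ 8 = k at *
    have ⟨h1, h2, h4, h5, h10, h20, hV, hW, hS, hJ, hJ5, hK⟩ := hr
    clear hV hW hS hJ hJ5 hK hB hp hk h0 hc
    simp
    field_simp
    simp

/-- Used twice: comparing both sides at `τ` and `gτ` determines the multipliers up to sign, and the
right side is the denominator when `thetaSum` is expanded in `grad` and `theta`. -/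
theorem wedge_gradOdd_sq (hz : 0 < z.im) :
    wedge (gradOdd z) (theta (5 * z)) ^ 2 =
      (eta z * eta (5 * z)) ^ 2 * (100 * (1 + 22 * tFun z + 125 * tFun z ^ 2)) := by
  have i5 := five_mul_im_pos hz
  have hr := etaRelations hz
  have hc := hr.curvePoint
  rw [tFun, wedge, gradOdd, theta, theta, thA_eq hz, thB_eq hz, thA_eq i5, thB_eq i5,
    show 2 * (5 * z) = 10 * z by ring, show 4 * (5 * z) = 20 * z by ring]
  generalize eta z = e1 at *
  generalize eta (2 * z) = e2 at *
  generalize eta (4 * z) = e4 at *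
  generalize eta (5 * z) = e5 at *
  generalize eta (10 * z) = e10 at *
  generalize eta (20 * z) = e20 at *
  have hB : (2 * e4 ^ 2 / e2) ^ 4 = 16 * (e4 ^ 8 / e1 ^ 8) * (e1 ^ 2 / e2) ^ 4 := by
    have ⟨h1, h2, h4, h5, h10, h20, hV, hW, hS, hJ, hJ5, hK⟩ := hr
    field_simp
    norm_num
  have hk : e4 ^ 8 / e1 ^ 8 = (e5 ^ 4 * e2 ^ 2 / (e10 ^ 2 * e1 ^ 4)) *
      (e2 ^ 5 * e5 / (e1 ^ 5 * e10)) ^ 3 *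
      (e2 ^ 2 * e4 * e5 * e20 ^ 3 / (e1 ^ 5 * e10 ^ 2)) ^ 2 /
      (e2 ^ 7 * e5 ^ 3 * e20 ^ 2 / (e1 ^ 7 * e4 ^ 2 * e10 ^ 3)) ^ 3 := by
    have ⟨h1, h2, h4, h5, h10, h20, hV, hW, hS, hJ, hJ5, hK⟩ := hr
    field_simp
  have hp := hc.sq_odd
  rw [← hk, ← hr.t_eq] at hp
  simp only [Pi.smul_apply, smul_eq_mul]
  rw [sexticGrad_zero hr.hJ hB, sexticGrad_one hr.hJ hB, ← hp]
  generalize e4 ^ 8 / e1 ^ 8 = k at *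
  have ⟨h1, h2, h4, h5, h10, h20, hV, hW, hS, hJ, hJ5, hK⟩ := hr
  clear hV hW hS hJ hJ5 hK hB hp hk hc
  simp
  field_simp
  ring

theorem wedge_gradEven_sq (hz : 0 < z.im) :
    tFun z ^ 2 * wedge (gradEven z) (theta z) ^ 2 =
      (eta z * eta (5 * z)) ^ 2 * (4 * (1 + 22 * tFun z + 125 * tFun z ^ 2)) := by
  have i5 := five_mul_im_pos hz
  have hr := etaRelations hz
  have hc := hr.curvePoint
  rw [tFun, wedge, gradEven, theta, theta, thA_eq hz, thB_eq hz, thA_eq i5, thB_eq i5,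
    show 2 * (5 * z) = 10 * z by ring, show 4 * (5 * z) = 20 * z by ring]
  generalize eta z = e1 at *
  generalize eta (2 * z) = e2 at *
  generalize eta (4 * z) = e4 at *
  generalize eta (5 * z) = e5 at *
  generalize eta (10 * z) = e10 at *
  generalize eta (20 * z) = e20 at *
  have hB : (2 * e20 ^ 2 / e10) ^ 4 = 16 * (e20 ^ 8 / e5 ^ 8) * (e5 ^ 2 / e10) ^ 4 := by
    have ⟨h1, h2, h4, h5, h10, h20, hV, hW, hS, hJ, hJ5, hK⟩ := hr
    field_simp
    norm_num
  have hk : e20 ^ 8 / e5 ^ 8 = (e2 ^ 2 * e4 * e5 * e20 ^ 3 / (e1 ^ 5 * e10 ^ 2)) ^ 2 *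
      (e2 ^ 7 * e5 ^ 3 * e20 ^ 2 / (e1 ^ 7 * e4 ^ 2 * e10 ^ 3)) /
      ((e5 ^ 4 * e2 ^ 2 / (e10 ^ 2 * e1 ^ 4)) ^ 3 * (e2 ^ 5 * e5 / (e1 ^ 5 * e10))) := by
    have ⟨h1, h2, h4, h5, h10, h20, hV, hW, hS, hJ, hJ5, hK⟩ := hr
    field_simp
  have hp := hc.sq_even
  rw [← hk, ← hr.t_eq] at hp
  simp only [Pi.smul_apply, smul_eq_mul]
  rw [sexticGrad_zero hr.hJ5 hB, sexticGrad_one hr.hJ5 hB, ← hp]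
  generalize e20 ^ 8 / e5 ^ 8 = k at *
  have ⟨h1, h2, h4, h5, h10, h20, hV, hW, hS, hJ, hJ5, hK⟩ := hr
  clear hV hW hS hJ hJ5 hK hB hp hk hc
  simp
  field_simp
  ring

/-- A bilinear relation between the theta vectors at `z` and `5z` whose value has no zeros. It makes
the matrices at the two levels proportional. -/
theorem wedge_theta (hz : 0 < z.im) :
    wedge (theta z) (theta (5 * z)) = -2 * (eta z * eta (5 * z)) := by
  rw [← thA_mul_thB_sub hz]
  simp [wedge, theta]
  ring

end values

end

section

open ModularForm (eta)
open Matrix ModularGroup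

/-! ### Transformation of theta functions under the modular group -/

/-- The automorphy factor `c τ + d`. -/
def autFactor (g : SL(2, ℤ)) (τ : ℍ) : ℂ := (g 1 0 : ℂ) * τ + (g 1 1 : ℂ)

lemma coe_smul_eq (g : SL(2, ℤ)) (τ : ℍ) :
    ((g • τ : ℍ) : ℂ) = ((g 0 0 : ℂ) * τ + (g 0 1 : ℂ)) / autFactor g τ := by
  rw [coe_specialLinearGroup_apply, autFactor]
  simp

lemma autFactor_eq_denom (g : SL(2, ℤ)) (τ : ℍ) : autFactor g τ = denom g τ := by
  rw [ModularGroup.denom_apply, autFactor]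

lemma autFactor_ne_zero (g : SL(2, ℤ)) (τ : ℍ) : autFactor g τ ≠ 0 := by
  rw [autFactor_eq_denom]
  exact denom_ne_zero _ _

lemma autFactor_mul (g h : SL(2, ℤ)) (τ : ℍ) :
    autFactor (g * h) τ = autFactor g (h • τ) * autFactor h τ := by
  have hn := autFactor_ne_zero h τ
  rw [autFactor, autFactor, coe_smul_eq, add_mul, mul_assoc, div_mul_cancel₀ _ hn, autFactor]
  simp [Matrix.mul_apply, Fin.sum_univ_two]
  ring

lemma im_smul_eq (g : SL(2, ℤ)) (τ : ℍ) : (g • τ).im = τ.im / ‖autFactor g τ‖ ^ 2 := by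
  rw [ModularGroup.im_smul_eq_div_normSq, autFactor_eq_denom, Complex.normSq_eq_norm_sq]

/-- `s`, `U`, `ε` describe the transformation of `theta` and `eta` under `g`. -/
structure Multiplier (g : SL(2, ℤ)) (s : ℍ → ℂ) (U : Matrix (Fin 2) (Fin 2) ℂ) (ε : ℂ) : Prop where
  theta_smul : ∀ τ : ℍ, theta (g • τ : ℍ) = s τ • (U *ᵥ theta τ)
  eta_smul : ∀ τ : ℍ, eta (g • τ : ℍ) = ε * s τ * eta τ
  unitary : star U * U = 1
  norm_eq : ‖ε‖ = 1
  grad_mulVec : ∀ v, U.det • sexticGrad (U *ᵥ v) = ε ^ 6 • (U *ᵥ sexticGrad v)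

lemma sexticGrad_smul (c : ℂ) (v : Fin 2 → ℂ) : sexticGrad (c • v) = c ^ 5 • sexticGrad v := by
  ext i
  fin_cases i <;> simp [sexticGrad] <;> ring

namespace Multiplier

variable {g h : SL(2, ℤ)} {s r : ℍ → ℂ} {U V : Matrix (Fin 2) (Fin 2) ℂ} {ε δ : ℂ}

lemma unitary' (H : Multiplier g s U ε) : U * star U = 1 :=
  mul_eq_one_comm.mp H.unitary

lemma eps_ne_zero (H : Multiplier g s U ε) : ε ≠ 0 := fun h0 => by
  simpa [h0] using H.norm_eq

lemma mul (H : Multiplier g s U ε) (K : Multiplier h r V δ) :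
    Multiplier (g * h) (fun τ => s (h • τ) * r τ) (U * V) (ε * δ) where
  theta_smul τ := by
    rw [mul_smul, H.theta_smul, K.theta_smul, mulVec_smul, smul_smul, mulVec_mulVec]
  eta_smul τ := by
    rw [mul_smul, H.eta_smul, K.eta_smul]
    ring
  unitary := by
    rw [star_mul, mul_assoc, ← mul_assoc (star U), H.unitary, one_mul, K.unitary]
  norm_eq := by rw [norm_mul, H.norm_eq, K.norm_eq, one_mul]
  grad_mulVec v := by
    rw [← mulVec_mulVec, det_mul, mul_comm, ← smul_smul, H.grad_mulVec, smul_comm, ← mulVec_smul,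
      K.grad_mulVec, mulVec_smul, mulVec_mulVec, smul_smul, mul_pow]

lemma inv (H : Multiplier g s U ε) :
    Multiplier g⁻¹ (fun τ => (s (g⁻¹ • τ))⁻¹) (star U) ε⁻¹ where
  theta_smul τ := by
    have h := H.theta_smul (g⁻¹ • τ)
    rw [smul_inv_smul] at h
    have hs : s (g⁻¹ • τ) ≠ 0 := fun h0 => by
      rw [h0, zero_smul] at h
      exact theta_ne_zero τ.im_pos 0 (congrFun h 0)
    rw [h, mulVec_smul, mulVec_mulVec, H.unitary, one_mulVec, smul_smul, inv_mul_cancel₀ hs,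
      one_smul]
  eta_smul τ := by
    have h := H.eta_smul (g⁻¹ • τ)
    rw [smul_inv_smul] at h
    have hs : ε * s (g⁻¹ • τ) ≠ 0 := fun h0 => by
      rw [h0, zero_mul] at h
      exact eta_ne_zero' τ.im_pos h
    rw [h, ← mul_inv, inv_mul_cancel_left₀ hs]
  unitary := by rw [star_star, H.unitary']
  norm_eq := by rw [norm_inv, H.norm_eq, inv_one]
  grad_mulVec v := by
    have h := congrArg (star U *ᵥ ·) (H.grad_mulVec (star U *ᵥ v))
    simp only [mulVec_smul, mulVec_mulVec, H.unitary, H.unitary', one_mulVec] at h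
    have hd : (star U).det * U.det = 1 := by rw [← det_mul, H.unitary, det_one]
    have he := pow_ne_zero 6 H.eps_ne_zero
    rw [← inv_smul_smul₀ he (sexticGrad (star U *ᵥ v)), ← h, inv_pow, smul_comm, smul_smul _ U.det,
      hd, one_smul]

lemma neg (H : Multiplier g s U ε) : Multiplier g (-s) (-U) (-ε) where
  theta_smul τ := by
    rw [H.theta_smul, Pi.neg_apply, neg_mulVec, smul_neg]
    module
  eta_smul τ := by
    rw [H.eta_smul, Pi.neg_apply]
    ring
  unitary := by rw [star_neg, neg_mul_neg, H.unitary]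
  norm_eq := by rw [norm_neg, H.norm_eq]
  grad_mulVec v := by
    have h := H.grad_mulVec v
    have h2 : sexticGrad (-(U *ᵥ v)) = -sexticGrad (U *ᵥ v) := by
      rw [← neg_one_smul ℂ, sexticGrad_smul]
      norm_num
    rw [neg_mulVec, neg_mulVec, h2, det_neg, Fintype.card_fin, smul_neg, smul_neg,
      Even.neg_pow (by decide) ε, Even.neg_one_pow (by decide), one_mul, h]

end Multiplier

lemma thA_inv {z : ℂ} (hz : 0 < z.im) :
    thA (-1 / z) = (Complex.sqrt Complex.I)⁻¹ * (Complex.sqrt z / Complex.sqrt 2) * thA (z / 4) := by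
  have hz0 : z ≠ 0 := by rintro rfl; simp at hz
  have i2 := im_div_pos hz two_pos
  have i4 := im_div_pos hz four_pos
  push_cast at i2 i4
  have iS : 0 < (-1 / z).im := by
    rw [neg_div, Complex.neg_im, one_div, Complex.inv_im, neg_div, neg_neg]
    exact div_pos hz (Complex.normSq_pos.mpr hz0)
  rw [thA_eq iS, thA_eq i4, show 2 * (-1 / z) = -1 / (z / 2) by field_simp,
    show 4 * (-1 / z) = -1 / (z / 4) by field_simp, eta_inv hz, eta_inv i2, eta_inv i4,
    show 2 * (z / 4) = z / 2 by ring, show 4 * (z / 4) = z by ring]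
  have s2 := csqrt_natCast_mul 2 (by norm_num) (z := z / 2) (by simpa using hz0)
  have s4 := csqrt_natCast_mul 2 (by norm_num) (z := z / 4) (by simpa using hz0)
  have q2 := csqrt_sq 2
  push_cast at s2 s4
  rw [show 2 * (z / 2) = z by ring] at s2
  rw [show 2 * (z / 4) = z / 2 by ring] at s4
  rw [s2, s4]
  have nI := csqrt_ne_zero Complex.I_ne_zero
  have nz := csqrt_ne_zero (show z / 4 ≠ 0 by simpa using hz0)
  have n2 := csqrt_ne_zero (show (2 : ℂ) ≠ 0 by norm_num)
  have h1 := eta_ne_zero' hz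
  have h2 := eta_ne_zero' i2
  have h4 := eta_ne_zero' i4
  field_simp

lemma thA_inv' {z : ℂ} (hz : 0 < z.im) : thA (-1 / z) =
    (Complex.sqrt Complex.I)⁻¹ * (Complex.sqrt z / Complex.sqrt 2) * (thA z + thB z) := by
  rw [thA_inv hz, thA_add_thB hz]

lemma thB_inv {z : ℂ} (hz : 0 < z.im) : thB (-1 / z) =
    (Complex.sqrt Complex.I)⁻¹ * (Complex.sqrt z / Complex.sqrt 2) * (thA z - thB z) := by
  have hz0 : z ≠ 0 := by rintro rfl; simp at hz
  have iS : 0 < (-1 / z).im := by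
    rw [neg_div, Complex.neg_im, one_div, Complex.inv_im, neg_div, neg_neg]
    exact div_pos hz (Complex.normSq_pos.mpr hz0)
  have i4 := im_ofNat_mul hz 4 four_pos
  push_cast at i4
  -- `thB(-1/z)` is obtained as `thA(-1/(4z)) - thA(-1/z)`, so the transformation of `thA` suffices.
  have h := thA_add_thB iS
  rw [thA_inv' hz, show -1 / z / 4 = -1 / (4 * z) by field_simp, thA_inv i4,
    show 4 * z / 4 = z by ring] at h
  have s4 := csqrt_natCast_mul 4 (by norm_num) hz0
  have q4 := csqrt_natCast_mul 2 (by norm_num) (z := 2) (by norm_num)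
  have q2 := csqrt_sq 2
  push_cast at s4 q4
  norm_num at q4
  rw [s4, q4, ← sq, q2] at h
  linear_combination h

/-- The matrices for `S` and `T` generate, up to scalars, the octahedral group, and `XY(X⁴ - Y⁴)` is
a semi-invariant of it. This is the source of the covariance of the gradient. -/
lemma multiplier_T : Multiplier T (fun _ => 1) !![Complex.I, 0; 0, 1] (ee (1 / 24)) := by
  have hc : ∀ τ : ℍ, ((T • τ : ℍ) : ℂ) = τ + 1 := fun τ => by
    rw [modular_T_smul, coe_vadd, add_comm]
    simp
  refine ⟨fun τ => ?_, fun τ => ?_, ?_, ?_, fun v => ?_⟩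
  · rw [hc]
    ext i
    fin_cases i
    · simp [theta, thB_add_one, mul_comm]
    · simp [theta, thA_add_one]
  · rw [hc, eta_eq, eta_eq, add_div, ee_add, ee_add]
    have := ee_int 1
    push_cast at this
    rw [this]
    ring_nf
  · ext i j
    fin_cases i <;> fin_cases j <;> simp [Matrix.mul_apply]
  · rw [norm_ee]
    norm_num
  · have h6 : ee (1 / 24) ^ 6 = Complex.I := by
      rw [← ee_nsmul, ← ee_quarter]
      norm_num
    rw [h6, det_fin_two_of]
    ext i
    have h5 : Complex.I ^ 5 = Complex.I := by rw [pow_succ, Complex.I_pow_four, one_mul]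
    fin_cases i
    · simp [sexticGrad, mulVec, dotProduct]
      rw [mul_pow, h5]
      ring
    · simp [sexticGrad, mulVec, dotProduct]
      rw [mul_pow, Complex.I_pow_four, one_mul]
      simp

lemma norm_csqrt_I : ‖Complex.sqrt Complex.I‖ = 1 := by
  have h : ‖Complex.sqrt Complex.I‖ ^ 2 = 1 := by rw [← norm_pow, csqrt_sq, Complex.norm_I]
  exact (pow_eq_one_iff_of_nonneg (norm_nonneg _) two_ne_zero).mp h

lemma multiplier_S : Multiplier S (fun τ => Complex.sqrt τ)
    (((Complex.sqrt Complex.I)⁻¹ / Complex.sqrt 2) • !![-1, 1; 1, 1]) (Complex.sqrt Complex.I)⁻¹ := by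
  have hc : ∀ τ : ℍ, ((S • τ : ℍ) : ℂ) = -1 / τ := fun τ => by
    rw [modular_S_smul]
    simp [neg_div, inv_neg]
  have hI := csqrt_sq Complex.I
  have h2 := csqrt_sq 2
  have nI := csqrt_ne_zero Complex.I_ne_zero
  have n2 := csqrt_ne_zero (show (2 : ℂ) ≠ 0 by norm_num)
  have hsI : star (Complex.sqrt Complex.I)⁻¹ * (Complex.sqrt Complex.I)⁻¹ = 1 := by
    have := Complex.conj_mul' (Complex.sqrt Complex.I)⁻¹
    rw [norm_inv, norm_csqrt_I] at this
    simpa using this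
  have hs2 : star (Complex.sqrt 2) * Complex.sqrt 2 = 2 := by
    have := Complex.conj_mul' (Complex.sqrt 2)
    have h3 : ‖Complex.sqrt 2‖ ^ 2 = 2 := by
      rw [← norm_pow, h2]
      norm_num
    rw [← Complex.ofReal_pow, h3] at this
    simpa using this
  refine ⟨fun τ => ?_, fun τ => ?_, ?_, ?_, fun v => ?_⟩
  · rw [hc]
    ext i
    fin_cases i
    · simp [theta, thB_inv τ.im_pos]
      ring
    · simp [theta, thA_inv' τ.im_pos]
      ring
  · rw [hc, eta_inv τ.im_pos]
    ring
  · have hk : star ((Complex.sqrt Complex.I)⁻¹ / Complex.sqrt 2) *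
        ((Complex.sqrt Complex.I)⁻¹ / Complex.sqrt 2) = 1 / 2 := by
      rw [star_div₀, div_mul_div_comm, hsI, hs2]
    rw [star_smul, smul_mul_smul_comm, hk]
    ext i j
    fin_cases i <;> fin_cases j <;> simp [Matrix.mul_apply, Fin.sum_univ_two] <;> norm_num
  · rw [norm_inv, norm_csqrt_I, inv_one]
  · set k := (Complex.sqrt Complex.I)⁻¹ / Complex.sqrt 2 with hk
    have hk4 : k ^ 4 = -1 / 4 := by
      rw [hk, div_pow, inv_pow, show 4 = 2 * 2 by norm_num, pow_mul, pow_mul, hI, h2]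
      norm_num
    have hd : (k • !![(-1 : ℂ), 1; 1, 1]).det = (Complex.sqrt Complex.I)⁻¹ ^ 6 := by
      rw [det_smul, det_fin_two_of, Fintype.card_fin, hk, div_pow, h2, inv_pow, inv_pow,
        show 6 = 2 * 3 by norm_num, pow_mul, hI, Complex.I_pow_three]
      simp
      ring
    rw [hd, smul_mulVec, sexticGrad_smul]
    congr 1
    have h5 : k ^ 5 = -1 / 4 * k := by rw [pow_succ, hk4]
    rw [h5, smul_mulVec, mul_comm, mul_smul]
    congr 1
    ext i
    fin_cases i <;> simp [sexticGrad, mulVec, dotProduct, Fin.sum_univ_two] <;> ring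

/-- Multipliers compose and invert, so the generators `S` and `T` suffice. Continuity of `s` is
recorded because two continuous square roots of `cτ + d` differ by a global sign only. -/
lemma exists_multiplier (g : SL(2, ℤ)) : ∃ s U ε, Continuous s ∧
    (∀ τ, s τ ^ 2 = autFactor g τ) ∧ Multiplier g s U ε := by
  have hg : g ∈ Subgroup.closure {S, T} := by simp [SpecialLinearGroup.SL2Z_generators]
  have hcont : ∀ g : SL(2, ℤ), Continuous fun τ : ℍ => g • τ := fun g =>
    (mdifferentiable_smul (g := ((g : SL(2, ℝ)) : GL (Fin 2) ℝ)) (by simp)).continuous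
  induction hg using Subgroup.closure_induction with
  | mem g hg =>
    rcases hg with rfl | rfl
    · refine ⟨_, _, _, ?_, fun τ => ?_, multiplier_S⟩
      · refine continuous_iff_continuousAt.mpr fun τ => ?_
        exact (Complex.differentiableAt_sqrt (mem_slitPlane τ)).continuousAt.comp
          continuous_coe.continuousAt
      · rw [csqrt_sq, autFactor]
        simp [S]
    · refine ⟨_, _, _, continuous_const, fun τ => ?_, multiplier_T⟩
      rw [autFactor]
      simp [T]
  | one =>
    refine ⟨fun _ => 1, 1, 1, continuous_const, fun τ => by simp [autFactor], ?_⟩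
    refine ⟨fun τ => ?_, fun τ => ?_, ?_, ?_, fun v => ?_⟩ <;> simp
  | mul g h _ _ hg hh =>
    obtain ⟨s, U, ε, hs, hs2, H⟩ := hg
    obtain ⟨r, V, δ, hr, hr2, K⟩ := hh
    refine ⟨_, _, _, (hs.comp (hcont h)).mul hr, fun τ => ?_, H.mul K⟩
    rw [autFactor_mul, ← hs2, ← hr2, ← mul_pow]
    rfl
  | inv g _ hg =>
    obtain ⟨s, U, ε, hs, hs2, H⟩ := hg
    refine ⟨_, _, _, (hs.comp (hcont g⁻¹)).inv₀ fun τ h0 => ?_, fun τ => ?_, H.inv⟩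
    · have := hs2 (g⁻¹ • τ)
      rw [show s (g⁻¹ • τ) = 0 from h0] at this
      exact autFactor_ne_zero g (g⁻¹ • τ) (by rw [← this]; norm_num)
    · have := autFactor_mul g g⁻¹ τ
      rw [mul_inv_cancel, ← hs2, show autFactor 1 τ = 1 by simp [autFactor]] at this
      change (s (g⁻¹ • τ))⁻¹ ^ 2 = _
      rw [inv_pow]
      exact inv_eq_of_mul_eq_one_right this.symm

/-- The square root of the automorphy factor can be chosen freely. -/
theorem exists_multiplier_of_sq (g : SL(2, ℤ)) {s : ℍ → ℂ} (hs : Continuous s)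
    (hs2 : ∀ τ, s τ ^ 2 = autFactor g τ) : ∃ U ε, Multiplier g s U ε := by
  obtain ⟨r, U, ε, hr, hr2, H⟩ := exists_multiplier g
  have hp : IsPreconnected (Set.univ : Set ℍ) := isPreconnected_univ
  rcases hp.eq_or_eq_neg_of_sq_eq hs.continuousOn hr.continuousOn
    (fun τ _ => by simp [hs2, hr2]) (fun {τ} _ h0 => autFactor_ne_zero g τ (by
      rw [← hr2, h0]; norm_num)) with h | h
  · rw [show s = r from funext fun τ => h (Set.mem_univ τ)]
    exact ⟨U, ε, H⟩
  · rw [show s = -r from funext fun τ => h (Set.mem_univ τ)]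
    exact ⟨-U, -ε, H.neg⟩

end

section

open ModularForm (eta)
open Matrix ModularGroup

/-! ### The points `(τ + 24 j) / N` -/

/-- `(τ + 24 j) / N` -/
def node (N : ℕ) [NeZero N] (j : ℤ) (τ : ℍ) : ℍ :=
  ⟨(τ + 24 * j) / N, im_div_pos (by simpa using τ.im_pos) (NeZero.pos N)⟩

/-- `N τ - 24 j`, the inverse of `node N j`. -/
def unnode (N : ℕ) [NeZero N] (j : ℤ) (τ : ℍ) : ℍ :=
  ⟨N * τ - 24 * j, by simpa using mul_pos (Nat.cast_pos.mpr (NeZero.pos N)) τ.im_pos⟩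

lemma coe_node (N : ℕ) [NeZero N] (j : ℤ) (τ : ℍ) :
    ((node N j τ : ℍ) : ℂ) = (τ + 24 * j) / N := rfl

lemma coe_unnode (N : ℕ) [NeZero N] (j : ℤ) (τ : ℍ) :
    ((unnode N j τ : ℍ) : ℂ) = N * τ - 24 * j := rfl

lemma node_unnode (N : ℕ) [NeZero N] (j : ℤ) (τ : ℍ) : node N j (unnode N j τ) = τ := by
  have hN : (N : ℂ) ≠ 0 := NeZero.ne _
  ext
  rw [coe_node, coe_unnode]
  field_simp
  ring

lemma unnode_node (N : ℕ) [NeZero N] (j : ℤ) (τ : ℍ) : unnode N j (node N j τ) = τ := by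
  have hN : (N : ℂ) ≠ 0 := NeZero.ne _
  ext
  rw [coe_unnode, coe_node]
  field_simp
  ring

lemma continuous_node (N : ℕ) [NeZero N] (j : ℤ) : Continuous (node N j) :=
  Continuous.upperHalfPlaneMk (by fun_prop) _

lemma continuous_unnode (N : ℕ) [NeZero N] (j : ℤ) : Continuous (unnode N j) :=
  Continuous.upperHalfPlaneMk (by fun_prop) _

/-- `N τ` -/
def scale (N : ℕ) [NeZero N] (τ : ℍ) : ℍ := unnode N 0 τ

lemma coe_scale (N : ℕ) [NeZero N] (τ : ℍ) : ((scale N τ : ℍ) : ℂ) = N * τ := by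
  rw [scale, coe_unnode]
  simp

lemma smul_eq_of_mul_eq {g : SL(2, ℤ)} {w w' : ℍ}
    (h : (w' : ℂ) * autFactor g w = (g 0 0 : ℂ) * w + (g 0 1 : ℂ)) : g • w = w' := by
  ext
  rw [coe_smul_eq, div_eq_iff (autFactor_ne_zero g w), h]

lemma coe_smul_mul (g : SL(2, ℤ)) (τ : ℍ) :
    ((g • τ : ℍ) : ℂ) * autFactor g τ = (g 0 0 : ℂ) * τ + (g 0 1 : ℂ) := by
  rw [coe_smul_eq, div_mul_cancel₀ _ (autFactor_ne_zero g τ)]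

lemma exists_scale_smul (N : ℕ) [NeZero N] (g : SL(2, ℤ)) (hN : (N : ℤ) ∣ g 1 0) :
    ∃ γ : SL(2, ℤ), ∀ τ, γ • scale N τ = scale N (g • τ) ∧
      autFactor γ (scale N τ) = autFactor g τ := by
  obtain ⟨c, hc⟩ := hN
  have hdet := g.det_coe
  rw [det_fin_two, hc] at hdet
  let γ : SL(2, ℤ) := ⟨!![g 0 0, N * g 0 1; c, g 1 1], by rw [det_fin_two_of]; linarith⟩
  have hcC : (g 1 0 : ℂ) = N * c := by exact_mod_cast congrArg (Int.cast (R := ℂ)) hc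
  have h2 : ∀ τ, autFactor γ (scale N τ) = autFactor g τ := fun τ => by
    rw [autFactor, autFactor, coe_scale, hcC]
    simp [γ]
    ring
  refine ⟨γ, fun τ => ⟨smul_eq_of_mul_eq ?_, h2 τ⟩⟩
  rw [h2, coe_scale, mul_assoc, coe_smul_mul, coe_scale]
  simp [γ]
  ring

lemma exists_node_smul_of_eq (N : ℕ) [NeZero N] {g : SL(2, ℤ)} {a b c d : ℤ}
    (hg : (g : Matrix (Fin 2) (Fin 2) ℤ) = !![a, b; c, d]) (hdet : a * d - b * c = 1) {k l : ℤ}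
    {q : ℤ} (hq : b + 24 * l * d - 24 * k * (a + 24 * l * c) = N * q) :
    ∃ γ : SL(2, ℤ), ∀ τ, γ • node N k τ = node N l (g • τ) ∧
      autFactor γ (node N k τ) = autFactor g τ := by
  let γ : SL(2, ℤ) := ⟨!![a + 24 * l * c, q; N * c, d - 24 * k * c], by
    rw [det_fin_two_of]
    linear_combination hdet + c * hq⟩
  have hqC : (b : ℂ) + 24 * l * d - 24 * k * (a + 24 * l * c) = (N : ℂ) * q := by
    exact_mod_cast congrArg (Int.cast (R := ℂ)) hq
  have hN : (N : ℂ) ≠ 0 := NeZero.ne _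
  have h2 : ∀ τ, autFactor γ (node N k τ) = autFactor g τ := fun τ => by
    rw [autFactor, autFactor, coe_node]
    simp only [γ, hg]
    simp only [of_apply, cons_val', cons_val_zero, cons_val_one, cons_val_fin_one]
    push_cast
    field_simp
    ring
  refine ⟨γ, fun τ => ⟨smul_eq_of_mul_eq ?_, h2 τ⟩⟩
  have h3 := coe_smul_mul g τ
  rw [h2, coe_node, div_mul_eq_mul_div, add_mul, h3, coe_node, autFactor]
  simp only [γ, hg]
  simp only [of_apply, cons_val', cons_val_zero, cons_val_one, cons_val_fin_one]
  push_cast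
  field_simp
  linear_combination hqC

/-- Conjugate `g` by the matrices with rows `(1, 24j)` and `(0, 5^α)`. As 5 divides `c`, the number
`a + 24jc` is prime to 5. The Möbius map that `g` induces on the index modulo `5^α` therefore has no
pole and is a permutation. -/
lemma exists_node_smul (α : ℕ) (g : SL(2, ℤ)) (h5 : (5 : ℤ) ∣ g 1 0) :
    ∃ e : Equiv.Perm (ZMod (5 ^ α)), ∀ j, ∃ γ : SL(2, ℤ), ∀ τ,
      γ • node (5 ^ α) (e j).val τ = node (5 ^ α) j.val (g • τ) ∧
      autFactor γ (node (5 ^ α) (e j).val τ) = autFactor g τ := by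
  obtain ⟨a, b, c, d, hg, hdet⟩ : ∃ a b c d : ℤ, (g : Matrix (Fin 2) (Fin 2) ℤ) = !![a, b; c, d] ∧
      a * d - b * c = 1 := ⟨g 0 0, g 0 1, g 1 0, g 1 1, Matrix.eta_fin_two _, by
    rw [← det_fin_two]; exact g.det_coe⟩
  have hc : g 1 0 = c := by rw [hg]; rfl
  rw [hc] at h5
  obtain ⟨c', hc'⟩ := h5
  have hunit : ∀ j : ℤ, IsUnit ((24 * (a + 24 * j * c) : ℤ) : ZMod (5 ^ α)) := fun j => by
    rw [ZMod.coe_int_isUnit_iff_isCoprime]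
    push_cast
    refine IsCoprime.pow_left (IsCoprime.mul_right ?_ ?_)
    · exact ⟨5, -1, by norm_num⟩
    · refine ⟨-(b * c' + 24 * j * c' * d), d, ?_⟩
      rw [hc'] at hdet ⊢
      linear_combination hdet
  let f : ZMod (5 ^ α) → ZMod (5 ^ α) := fun j =>
    ((24 * (a + 24 * j.val * c) : ℤ) : ZMod (5 ^ α))⁻¹ * ((b + 24 * j.val * d : ℤ) : ZMod (5 ^ α))
  have hf : ∀ j, ((24 * (a + 24 * j.val * c) : ℤ) : ZMod (5 ^ α)) * f j =
      ((b + 24 * j.val * d : ℤ) : ZMod (5 ^ α)) := fun j => by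
    rw [← mul_assoc, ZMod.mul_inv_of_unit _ (hunit _), one_mul]
  have hinj : Function.Injective f := by
    intro j k hjk
    have h1 := hf j
    have h2 := hf k
    rw [hjk] at h1
    have h24 : IsUnit (24 : ZMod (5 ^ α)) := by
      have := (ZMod.coe_int_isUnit_iff_isCoprime 24 (5 ^ α)).mpr (by
        push_cast
        exact IsCoprime.pow_left ⟨5, -1, by norm_num⟩)
      exact_mod_cast this
    have hd : ((a : ZMod (5 ^ α)) * d - b * c) = 1 := by
      have := congrArg (Int.cast (R := ZMod (5 ^ α))) hdet
      push_cast at this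
      exact this
    push_cast at h1 h2
    rw [ZMod.natCast_zmod_val] at h1 h2
    refine h24.mul_left_cancel ?_
    linear_combination -(a + 24 * k * c) * h1 + (a + 24 * j * c) * h2 - 24 * (j - k) * hd
  let e := Equiv.ofBijective f (Finite.injective_iff_bijective.mp hinj)
  refine ⟨e, fun j => ?_⟩
  have hdvd : ((5 ^ α : ℕ) : ℤ) ∣ b + 24 * j.val * d - 24 * (e j).val * (a + 24 * j.val * c) := by
    rw [← ZMod.intCast_zmod_eq_zero_iff_dvd]
    have := hf j
    push_cast at this ⊢
    rw [ZMod.natCast_zmod_val] at this ⊢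
    rw [ZMod.natCast_zmod_val]
    change _ - 24 * f j * _ = 0
    linear_combination -this
  obtain ⟨q, hq⟩ := hdvd
  exact exists_node_smul_of_eq (5 ^ α) hg hdet hq

/-- The transformation of `theta` and `eta`, composed with maps `φ`, `ψ`, under `g`. -/
structure Transforms (g : SL(2, ℤ)) (s : ℍ → ℂ) (φ ψ : ℍ → ℍ) (U : Matrix (Fin 2) (Fin 2) ℂ)
    (ε : ℂ) : Prop where
  theta_smul : ∀ τ : ℍ, theta (φ (g • τ)) = s τ • (U *ᵥ theta (ψ τ))
  eta_smul : ∀ τ : ℍ, eta (φ (g • τ)) = ε * s τ * eta (ψ τ)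
  unitary : star U * U = 1
  norm_eq : ‖ε‖ = 1
  grad_mulVec : ∀ v, U.det • sexticGrad (U *ᵥ v) = ε ^ 6 • (U *ᵥ sexticGrad v)

/-- The automorphy factor of `γ` at `ψ τ` is that of `g` at `τ`. A single square root `s` for `g`
therefore serves all points, and `ψ'` transports it to a continuous square root for `γ`. -/
lemma exists_transforms {g γ : SL(2, ℤ)} {s : ℍ → ℂ} (hs : Continuous s)
    (hs2 : ∀ τ, s τ ^ 2 = autFactor g τ) {φ ψ ψ' : ℍ → ℍ} (hψ' : Continuous ψ')
    (h1 : ∀ w, ψ (ψ' w) = w) (h2 : ∀ τ, ψ' (ψ τ) = τ)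
    (hγ : ∀ τ, γ • ψ τ = φ (g • τ) ∧ autFactor γ (ψ τ) = autFactor g τ) :
    ∃ U ε, Transforms g s φ ψ U ε := by
  obtain ⟨U, ε, H⟩ := exists_multiplier_of_sq γ (hs.comp hψ') fun w => by
    rw [Function.comp_apply, hs2, ← (hγ _).2, h1]
  refine ⟨U, ε, fun τ => ?_, fun τ => ?_, H.unitary, H.norm_eq, H.grad_mulVec⟩
  · rw [← (hγ τ).1, H.theta_smul, Function.comp_apply, h2]
  · rw [← (hγ τ).1, H.eta_smul, Function.comp_apply, h2]

/-! ### Unitary multipliers with a unitary mean -/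

section averaging

open ComplexOrder in
/-- If the mean of unitary matrices is unitary, they are all equal to it. -/
lemma eq_of_sum_unitary {ι J : Type*} [Fintype ι] [DecidableEq ι] [Fintype J]
    {U : J → Matrix ι ι ℂ} {V : Matrix ι ι ℂ} (hU : ∀ j, star (U j) * U j = 1)
    (hV : star V * V = 1) (hsum : ∑ j, U j = (Fintype.card J : ℂ) • V) (j : J) : U j = V := by
  -- Each summand is `2 - U_j* V - V* U_j`, so the assumption on the mean makes the total zero. Each
  -- summand has nonnegative trace, hence every one vanishes.
  have h0 : ∑ j, (star (U j - V) * (U j - V)) = 0 := by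
    have h1 : ∀ j, star (U j - V) * (U j - V) = (1 : Matrix ι ι ℂ) + 1 - star (U j) * V -
        star V * U j := fun j => by
      rw [star_sub, sub_mul, mul_sub, mul_sub, hU, hV]
      abel
    simp_rw [h1]
    rw [Finset.sum_sub_distrib, Finset.sum_sub_distrib, ← Finset.sum_mul, ← Finset.mul_sum, hsum,
      ← star_sum, hsum, star_smul, smul_mul_assoc, mul_smul_comm, hV]
    rw [Finset.sum_const, Finset.card_univ, ← Nat.cast_smul_eq_nsmul ℂ, Complex.star_def,
      Complex.conj_natCast, smul_add]
    abel
  have h2 : ∑ j, ((U j - V)ᴴ * (U j - V)).trace = 0 := by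
    simp_rw [← star_eq_conjTranspose]
    rw [← trace_sum, h0, trace_zero]
  rw [Finset.sum_eq_zero_iff_of_nonneg fun j _ =>
    (posSemidef_conjTranspose_mul_self (U j - V)).trace_nonneg] at h2
  exact sub_eq_zero.mp (trace_conjTranspose_mul_self_eq_zero_iff.mp (h2 j (Finset.mem_univ j)))

lemma node_shift (N : ℕ) [NeZero N] (j : ℤ) (τ : ℍ) (k : ℕ) :
    node N j ((24 * k : ℝ) +ᵥ τ) = node N (j + k) τ := by
  ext
  rw [coe_node, coe_node, coe_vadd]
  push_cast
  ring

lemma node_eq_of_zmod {N : ℕ} [NeZero N] {X : Type*} {F : ℍ → X}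
    (hF : ∀ τ, F ((24 : ℝ) +ᵥ τ) = F τ) {j k : ℤ} (h : (j : ZMod N) = k) (τ : ℍ) :
    F (node N j τ) = F (node N k τ) := by
  have key : ∀ (m : ℕ) τ, F ((24 * m : ℝ) +ᵥ τ) = F τ := by
    intro m
    induction m with
    | zero => intro τ; simp
    | succ m ih =>
      intro τ
      rw [show (24 * ((m + 1 : ℕ) : ℝ)) = 24 + 24 * m by push_cast; ring, ← vadd_vadd, hF, ih]
  have hN : (N : ℂ) ≠ 0 := NeZero.ne _
  have h3 : ∀ (j : ℤ) (m : ℕ), F (node N (j + N * m) τ) = F (node N j τ) := fun j m => by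
    rw [← key m (node N j τ)]
    congr 1
    ext
    rw [coe_vadd, coe_node, coe_node]
    push_cast
    field_simp
    ring
  rw [ZMod.intCast_eq_intCast_iff_dvd_sub] at h
  obtain ⟨m, hm⟩ := h
  rcases Int.eq_nat_or_neg m with ⟨n, rfl | rfl⟩
  · rw [show k = j + N * n by linarith, h3]
  · rw [show j = k + N * n by linarith, h3]

/-- If the sum of `F` over the nodes is a multiple of `F ∘ w`, then the multiplier matrices of `F`
at all nodes coincide with the one of `F ∘ w`. -/
lemma eq_of_sum_node {ι : Type*} [Fintype ι] [DecidableEq ι] {N : ℕ} [NeZero N] {F : ℍ → ι → ℂ}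
    (hF : ∀ τ, F ((24 : ℝ) +ᵥ τ) = F τ) {w : ℍ → ℍ} {C : ℂ} (hC : C ≠ 0)
    (hsum : ∀ τ, ∑ j : ZMod N, F (node N j.val τ) = C • F (w τ))
    (hind : ∀ M : Matrix ι ι ℂ, (∀ τ, M *ᵥ F (w τ) = 0) → M = 0)
    {g : SL(2, ℤ)} {s : ℍ → ℂ} (hs : ∀ τ, s τ ≠ 0) {e : Equiv.Perm (ZMod N)}
    {U : ZMod N → Matrix ι ι ℂ} {V : Matrix ι ι ℂ} (hU : ∀ j, star (U j) * U j = 1)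
    (hV : star V * V = 1)
    (hFU : ∀ j τ, F (node N j.val (g • τ)) = s τ • (U j *ᵥ F (node N (e j).val τ)))
    (hFV : ∀ τ, F (w (g • τ)) = s τ • (V *ᵥ F (w τ))) (j : ZMod N) : U j = V := by
  refine eq_of_sum_unitary hU hV ?_ j
  have h1 : ∀ τ, ∑ j, (U j - V) *ᵥ F (node N (e j).val τ) = 0 := fun τ => by
    have h := hsum (g • τ)
    simp_rw [hFU, hFV, ← Finset.smul_sum, smul_comm C (s τ)] at h
    have h' := smul_right_injective _ (hs τ) h
    rw [← mulVec_smul, ← hsum, ← Equiv.sum_comp e (fun j => F (node N j.val τ))] at h'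
    simp_rw [sub_mulVec]
    rw [Finset.sum_sub_distrib, h', mulVec_sum, sub_self]
  rw [← sub_eq_zero, ZMod.card]
  refine hind _ fun τ => ?_
  -- Translation by `24k` permutes the points cyclically. Summing over `k` replaces each `F`-value
  -- by the full sum `C • F (w τ)`, which no longer depends on `j`, so only the sum of the matrices
  -- remains.
  have h2 : ∑ k : ZMod N, ∑ j, (U j - V) *ᵥ F (node N (e j).val ((24 * k.val : ℝ) +ᵥ τ)) = 0 :=
    Finset.sum_eq_zero fun k _ => h1 _
  have h3 : ∀ j, ∑ k : ZMod N, F (node N (e j).val ((24 * k.val : ℝ) +ᵥ τ)) = C • F (w τ) :=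
    fun j => by
    rw [← hsum, ← Equiv.sum_comp (Equiv.addLeft (e j)) (fun j => F (node N j.val τ))]
    refine Finset.sum_congr rfl fun k _ => ?_
    rw [node_shift]
    refine node_eq_of_zmod hF ?_ τ
    simp
  rw [Finset.sum_comm] at h2
  simp_rw [← mulVec_sum, h3, mulVec_smul, ← Finset.smul_sum] at h2
  have h4 := (smul_eq_zero.mp h2).resolve_left hC
  rw [← sum_mulVec, Finset.sum_sub_distrib] at h4
  simpa [Nat.cast_smul_eq_nsmul] using h4

end averaging

end

section

open ModularForm (eta)
open Matrix ModularGroup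

/-! ### Sums over the points `(τ + 24 j) / 5^α` -/

lemma sum_zmod_val (N : ℕ) [NeZero N] (f : ℕ → ℂ) :
    ∑ j : ZMod N, f j.val = ∑ i ∈ Finset.range N, f i := by
  obtain ⟨n, rfl⟩ := Nat.exists_eq_succ_of_ne_zero (NeZero.ne N)
  exact Fin.sum_univ_eq_sum_range f (n + 1)

lemma sum_ee_div (N : ℕ) [NeZero N] (x : ℤ) :
    ∑ j : ZMod N, ee (x * j.val / N) = if (N : ℤ) ∣ x then (N : ℂ) else 0 := by
  have hN : (N : ℂ) ≠ 0 := NeZero.ne _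
  have h1 : ∀ j : ℕ, ee (x * j / N) = ee (x / N) ^ j := fun j => by
    rw [← ee_nsmul]
    congr 1
    ring
  rw [sum_zmod_val N fun j => ee (x * j / N)]
  simp_rw [h1]
  split_ifs with h
  · obtain ⟨y, rfl⟩ := h
    have : ee (((N * y : ℤ) : ℂ) / N) = 1 := by
      rw [← ee_int y]
      congr 1
      push_cast
      field_simp
    simp only [this, one_pow, Finset.sum_const, Finset.card_range, nsmul_eq_mul, mul_one]
  · have hz : ee (x / N) ≠ 1 := fun h1 => h (by
      rw [ee, Complex.exp_eq_one_iff] at h1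
      obtain ⟨n, hn⟩ := h1
      have h2 : (x : ℂ) = N * n := by
        have hpi : (2 * Real.pi * Complex.I : ℂ) ≠ 0 := Complex.two_pi_I_ne_zero
        have h3 : (x : ℂ) / N = n := by
          apply mul_left_cancel₀ hpi
          rw [hn]
          ring
        rw [← h3]
        field_simp
      exact ⟨n, by exact_mod_cast h2⟩)
    rw [geom_sum_eq hz, ← ee_nsmul, mul_div_cancel₀ _ hN, ee_int, sub_self, zero_div]

lemma five_pow_dvd_sq (α : ℕ) (r : ℤ) : (5 : ℤ) ^ α ∣ r ^ 2 ↔ (5 : ℤ) ^ ((α + 1) / 2) ∣ r := by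
  constructor
  · intro h
    rcases Nat.even_or_odd' α with ⟨k, rfl | rfl⟩
    · rw [show (2 * k + 1) / 2 = k by omega]
      rw [mul_comm, pow_mul] at h
      exact (Int.pow_dvd_pow_iff two_ne_zero).mp h
    · rw [show (2 * k + 1 + 1) / 2 = k + 1 by omega]
      have h1 : (5 : ℤ) ^ k ∣ r := by
        rw [← Int.pow_dvd_pow_iff two_ne_zero, ← pow_mul, mul_comm]
        exact (pow_dvd_pow 5 (by omega)).trans h
      obtain ⟨u, rfl⟩ := h1
      rw [pow_succ] 
      refine mul_dvd_mul_left _ ?_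
      rw [mul_pow, ← pow_mul, mul_comm k, pow_succ] at h
      have h2 := (mul_dvd_mul_iff_left (by positivity)).mp h
      exact (Nat.prime_iff_prime_int.mp Nat.prime_five).dvd_of_dvd_pow h2
  · intro h
    have h1 := pow_dvd_pow_of_dvd h 2
    rw [← pow_mul] at h1
    exact (pow_dvd_pow 5 (by omega)).trans h1

/-- The sum over `j` is a character sum that keeps only those `r` with `5^α ∣ r²`, that is `r =
5^⌈α/2⌉ r'`. Then `r²/5^α = 5^(α mod 2) r'²`, so the average is the same theta series at `5^(α mod
2) τ`. This is why only the parity of `α` enters. The condition `K * m = 24` makes the characters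
well defined with `m` prime to 5. -/
lemma sum_node_tsum (α : ℕ) {c : ℤ → ℂ} {K m : ℕ} (hK : K * m = 24)
    (hsum : ∀ z : ℂ, 0 < z.im → Summable fun r : ℤ => c r * ee ((r : ℂ) ^ 2 * z / K)) {χ : ℂ}
    (hχ : ∀ r, c (5 ^ ((α + 1) / 2) * r) = χ * c r) (τ : ℍ) :
    ∑ j : ZMod (5 ^ α), ∑' r : ℤ, c r * ee ((r : ℂ) ^ 2 * (node (5 ^ α) j.val τ : ℍ) / K) =
      (5 ^ α * χ) * ∑' r : ℤ, c r * ee ((r : ℂ) ^ 2 * (scale (5 ^ (α % 2)) τ : ℍ) / K) := by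
  have hK0 : (K : ℂ) ≠ 0 := by
    rintro h
    rw [Nat.cast_eq_zero] at h
    simp [h] at hK
  have hKC : (K : ℂ) * m = 24 := by exact_mod_cast congrArg (Nat.cast (R := ℂ)) hK
  have hN : ((5 ^ α : ℕ) : ℂ) ≠ 0 := NeZero.ne _
  have hm : IsCoprime ((5 : ℤ) ^ α) m := by
    refine IsCoprime.pow_left ?_
    have h : Nat.Coprime 5 m := Nat.Coprime.coprime_dvd_right (Dvd.intro_left K hK) (by norm_num)
    exact_mod_cast Nat.isCoprime_iff_coprime.mpr h
  rw [← Summable.tsum_finsetSum fun j _ => hsum _ (node (5 ^ α) j.val τ).im_pos]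
  have h1 : ∀ r : ℤ, ∑ j : ZMod (5 ^ α),
      c r * ee ((r : ℂ) ^ 2 * (node (5 ^ α) j.val τ : ℍ) / K) =
      c r * ee ((r : ℂ) ^ 2 * (τ / (5 ^ α : ℕ)) / K) *
        if (5 : ℤ) ^ ((α + 1) / 2) ∣ r then ((5 ^ α : ℕ) : ℂ) else 0 := by
    intro r
    have h2 := sum_ee_div (5 ^ α) (m * r ^ 2)
    have h3 : ((5 ^ α : ℕ) : ℤ) ∣ m * r ^ 2 ↔ (5 : ℤ) ^ ((α + 1) / 2) ∣ r := by
      rw [← five_pow_dvd_sq]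
      push_cast
      exact ⟨fun h => hm.dvd_of_dvd_mul_left h, fun h => h.mul_left _⟩
    simp only [h3] at h2
    rw [← h2, Finset.mul_sum]
    refine Finset.sum_congr rfl fun j _ => ?_
    rw [mul_assoc, ← ee_add, coe_node, ← hKC]
    congr 2
    generalize ((5 ^ α : ℕ) : ℂ) = N at *
    push_cast
    field_simp
  simp_rw [h1]
  have hinj : Function.Injective fun r : ℤ => (5 : ℤ) ^ ((α + 1) / 2) * r :=
    mul_right_injective₀ (by positivity)
  rw [← hinj.tsum_eq, ← tsum_mul_left]
  · refine tsum_congr fun r => ?_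
    rw [if_pos (Dvd.intro _ rfl), hχ, coe_scale]
    have h5 : ((5 : ℂ) ^ ((α + 1) / 2)) ^ 2 = 5 ^ (α % 2) * 5 ^ α := by
      rw [← pow_mul, ← pow_add]
      congr 1
      omega
    have h6 : (((5 ^ ((α + 1) / 2) * r : ℤ) : ℂ)) ^ 2 * (τ / (5 ^ α : ℕ)) / K =
        (r : ℂ) ^ 2 * ((5 ^ (α % 2) : ℕ) * τ) / K := by
      push_cast at hN ⊢
      rw [mul_pow, h5]
      field_simp
    rw [h6]
    push_cast
    ring
  · intro r hr
    by_contra hn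
    have h : ¬(5 : ℤ) ^ ((α + 1) / 2) ∣ r := fun ⟨u, hu⟩ => hn ⟨u, hu.symm⟩
    exact hr (by simp only [if_neg h, mul_zero])

lemma thA_eq_tsum (z : ℂ) : thA z = ∑' r : ℤ, (1 : ℂ) * ee ((r : ℂ) ^ 2 * z / (1 : ℕ)) := by
  simp [thA]

lemma hasSum_thB_odd {z : ℂ} (hz : 0 < z.im) :
    HasSum (fun r : ℤ => (if r % 2 = 1 then (1 : ℂ) else 0) * ee ((r : ℂ) ^ 2 * z / (4 : ℕ)))
      (thB z) := by
  have hinj : Function.Injective fun n : ℤ => 2 * n + 1 := fun a b h => by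
    simp only at h
    omega
  refine (hinj.hasSum_iff fun r hr => ?_).mp ((hasSum_thB' hz).summable.hasSum.congr_fun fun n => ?_)
  · rw [if_neg, zero_mul]
    intro h
    exact hr ⟨r / 2, by simp only; omega⟩
  · rw [Function.comp_apply, if_pos (by omega), one_mul]
    congr 1
    push_cast
    ring

/-- Half of the even character modulo `12` with conductor `12`. -/
def chiTwelve (r : ℤ) : ℂ :=
  if r % 12 = 1 ∨ r % 12 = 11 then 1 / 2 else if r % 12 = 5 ∨ r % 12 = 7 then -1 / 2 else 0

/-- Euler's series lives on `r ≡ 5 (mod 6)`, which is not stable under multiplication by 5.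
Averaging with `r ↦ -r` gives a coefficient function that multiplication by 5 merely negates. -/
lemma hasSum_eta_chiTwelve {z : ℂ} (hz : 0 < z.im) :
    HasSum (fun r : ℤ => chiTwelve r * ee ((r : ℂ) ^ 2 * z / (24 : ℕ))) (eta z) := by
  have hinj : Function.Injective fun n : ℤ => 6 * n - 1 := fun a b h => by
    simp only at h
    omega
  have h1 : HasSum (fun r : ℤ => (if r % 6 = 5 then (-1 : ℂ) ^ ((r + 1) / 6) else 0) *
      ee ((r : ℂ) ^ 2 * z / (24 : ℕ))) (eta z) := by
    refine (hinj.hasSum_iff fun r hr => ?_).mp ((hasSum_eta hz).congr_fun fun n => ?_)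
    · rw [if_neg, zero_mul]
      intro h
      exact hr ⟨(r + 1) / 6, by simp only; omega⟩
    · rw [Function.comp_apply, if_pos (by omega), show (6 * n - 1 + 1) / 6 = n by omega]
      congr 2
      push_cast
      ring
  have h2 := (Equiv.neg ℤ).hasSum_iff.mpr h1
  have h3 := (h1.add h2).mul_left (1 / 2)
  rw [show 1 / 2 * (eta z + eta z) = eta z by ring] at h3
  refine h3.congr_fun fun r => ?_
  simp only [Function.comp_apply, Equiv.neg_apply, Int.cast_neg, neg_sq]
  rw [← add_mul, ← mul_assoc]
  congr 1
  have key : ∀ n : ℤ, (-1 : ℂ) ^ n = if n % 2 = 0 then 1 else -1 := fun n => by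
    rcases Int.even_or_odd n with hn | hn
    · rw [hn.neg_one_zpow, if_pos (Int.even_iff.mp hn)]
    · rw [hn.neg_one_zpow, if_neg (by rw [Int.odd_iff.mp hn]; norm_num)]
  rw [key, key, chiTwelve]
  split_ifs <;> first | omega | norm_num

lemma chiTwelve_five_pow (k : ℕ) (r : ℤ) : chiTwelve (5 ^ k * r) = (-1) ^ k * chiTwelve r := by
  have h5 : ∀ r, chiTwelve (5 * r) = -chiTwelve r := fun r => by
    rw [chiTwelve, chiTwelve]
    split_ifs <;> first | omega | norm_num
  induction k with
  | zero => simp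
  | succ k ih => rw [pow_succ', mul_assoc, h5, ih, pow_succ']; ring

lemma sum_node_theta (α : ℕ) (τ : ℍ) :
    ∑ j : ZMod (5 ^ α), theta (node (5 ^ α) j.val τ : ℍ) =
      (5 ^ α : ℂ) • theta (scale (5 ^ (α % 2)) τ : ℍ) := by
  ext i
  rw [Finset.sum_apply]
  fin_cases i
  · have h := sum_node_tsum α (c := fun r => if r % 2 = 1 then (1 : ℂ) else 0) (K := 4) (m := 6)
      (by norm_num) (fun z hz => (hasSum_thB_odd hz).summable) (χ := 1) (fun r => by
        rw [one_mul]
        have : (5 ^ ((α + 1) / 2) * r) % 2 = r % 2 := by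
          have : (5 : ℤ) ^ ((α + 1) / 2) % 2 = 1 := by
            rw [← Int.odd_iff]
            exact Odd.pow (by decide)
          rw [Int.mul_emod, this, one_mul, Int.emod_emod_of_dvd _ (dvd_refl 2)]
        rw [this]) τ
    simp_rw [fun w : ℍ => (hasSum_thB_odd w.im_pos).tsum_eq] at h
    simpa [theta] using h
  · have h := sum_node_tsum α (c := fun r => (1 : ℂ)) (K := 1) (m := 24)
      (by norm_num) (fun z hz => by simpa using summable_ee_sq hz) (χ := 1) (fun r => by simp) τ
    simp_rw [← thA_eq_tsum] at h
    simpa [theta] using h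

lemma sum_node_eta (α : ℕ) (τ : ℍ) :
    ∑ j : ZMod (5 ^ α), eta (node (5 ^ α) j.val τ : ℍ) =
      (5 ^ α * (-1) ^ ((α + 1) / 2)) * eta (scale (5 ^ (α % 2)) τ : ℍ) := by
  have h := sum_node_tsum α (c := chiTwelve) (K := 24) (m := 1) (by norm_num)
    (fun z hz => (hasSum_eta_chiTwelve hz).summable) (chiTwelve_five_pow _) τ
  simp_rw [fun w : ℍ => (hasSum_eta_chiTwelve w.im_pos).tsum_eq] at h
  exact h

lemma theta_vadd (τ : ℍ) : theta (((24 : ℝ) +ᵥ τ : ℍ)) = theta τ := by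
  have hB : ∀ z, thB (z + 4) = thB z := fun z => by
    rw [show z + 4 = z + 1 + 1 + 1 + 1 by ring, thB_add_one, thB_add_one, thB_add_one, thB_add_one]
    linear_combination thB z * Complex.I_pow_four
  have hA : ∀ (n : ℕ) z, thA (z + n) = thA z := fun n => by
    induction n with
    | zero => simp
    | succ n ih => intro z; push_cast; rw [← add_assoc, thA_add_one, ih]
  have h24 : (((24 : ℝ) +ᵥ τ : ℍ) : ℂ) = τ + 4 + 4 + 4 + 4 + 4 + 4 := by
    rw [coe_vadd]
    push_cast
    ring
  have h24' : (((24 : ℝ) +ᵥ τ : ℍ) : ℂ) = τ + (24 : ℕ) := by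
    rw [coe_vadd]
    push_cast
    ring
  rw [theta, theta]
  congr 1
  · rw [h24, hB, hB, hB, hB, hB, hB]
  · rw [h24', hA]

lemma eta_vadd (τ : ℍ) : eta (((24 : ℝ) +ᵥ τ : ℍ)) = eta τ := by
  have h24 : (((24 : ℝ) +ᵥ τ : ℍ) : ℂ) = τ + (24 : ℤ) := by
    rw [coe_vadd]
    push_cast
    ring
  rw [eta_eq, eta_eq, h24, ee_add, ee_int, mul_one, add_div, ee_add]
  have := ee_int 1
  norm_num at this ⊢
  rw [this, mul_one]
  simp

/-- The components are eigenvectors of `τ ↦ τ + 1` with the distinct eigenvalues `i` and `1`. -/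
lemma theta_independent {φ : ℍ → ℍ} (hφ : Function.Surjective φ) (M : Matrix (Fin 2) (Fin 2) ℂ)
    (h : ∀ τ, M *ᵥ theta (φ τ) = 0) : M = 0 := by
  have key : ∀ i, M i = 0 := fun i => by
    have h1 : ∀ τ : ℍ, M i 0 * thB τ + M i 1 * thA τ = 0 := fun τ => by
      obtain ⟨w, rfl⟩ := hφ τ
      have := congrFun (h w) i
      simpa [mulVec, dotProduct, theta] using this
    have e1 := h1 I
    have e2 := h1 ((1 : ℝ) +ᵥ I)
    have hB := theta_ne_zero I.im_pos 0
    have hA := theta_ne_zero I.im_pos 1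
    simp only [theta, cons_val_zero, cons_val_one] at hB hA
    have hc : (((1 : ℝ) +ᵥ I : ℍ) : ℂ) = (I : ℂ) + 1 := by
      rw [coe_vadd, Complex.ofReal_one, add_comm]
    rw [hc, thB_add_one, thA_add_one] at e2
    have h0 : M i 0 = 0 := by
      have : M i 0 * ((Complex.I - 1) * thB I) = 0 := by linear_combination e2 - e1
      refine (mul_eq_zero.mp this).resolve_right (mul_ne_zero (sub_ne_zero.mpr fun hI => ?_) hB)
      simpa using congrArg Complex.re hI
    have h2 : M i 1 = 0 := by
      rw [h0, zero_mul, zero_add] at e1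
      exact (mul_eq_zero.mp e1).resolve_right hA
    ext j
    fin_cases j <;> simp [h0, h2]
  ext i j
  rw [key i]
  rfl

/-- The averaging principle is applied twice, to the two-dimensional `theta` and to the scalar
`eta`; both average to a multiple of their value at `5^(α mod 2) τ`. So all points share the matrix
and the eta multiplier found there. -/
theorem node_transforms (α : ℕ) {g : SL(2, ℤ)} (h5 : (5 : ℤ) ∣ g 1 0) {s : ℍ → ℂ}
    (hs : Continuous s) (hs2 : ∀ τ, s τ ^ 2 = autFactor g τ) {U : Matrix (Fin 2) (Fin 2) ℂ} {ε : ℂ}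
    (H : Transforms g s (scale (5 ^ (α % 2))) (scale (5 ^ (α % 2))) U ε) :
    ∃ e : Equiv.Perm (ZMod (5 ^ α)), ∀ j,
      Transforms g s (node (5 ^ α) j.val) (node (5 ^ α) (e j).val) U ε := by
  obtain ⟨e, he⟩ := exists_node_smul α g h5
  have hex : ∀ j, ∃ U ε, Transforms g s (node (5 ^ α) j.val) (node (5 ^ α) (e j).val) U ε :=
    fun j => by
    obtain ⟨γ, hγ⟩ := he j
    exact exists_transforms hs hs2 (continuous_unnode _ _) (node_unnode _ _) (unnode_node _ _) hγ
  choose V δ hV using hex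
  have hs0 : ∀ τ, s τ ≠ 0 := fun τ h0 => autFactor_ne_zero g τ (by rw [← hs2, h0]; norm_num)
  have hUV : ∀ j, V j = U := eq_of_sum_node (F := fun τ : ℍ => theta τ) theta_vadd
    (w := scale (5 ^ (α % 2))) (C := 5 ^ α) (pow_ne_zero _ (by norm_num)) (sum_node_theta α)
    (theta_independent fun τ => ⟨node _ 0 τ, unnode_node _ _ _⟩) hs0 (fun j => (hV j).unitary)
    H.unitary (fun j => (hV j).theta_smul) H.theta_smul
  have hεδ : ∀ j, δ j = ε := fun j => by
    have hone : ∀ {x : ℂ}, ‖x‖ = 1 → star (x • (1 : Matrix (Fin 1) (Fin 1) ℂ)) *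
        (x • (1 : Matrix (Fin 1) (Fin 1) ℂ)) = 1 := fun {x} hx => by
      rw [star_smul, smul_mul_smul_comm, star_one, one_mul, Complex.star_def, Complex.conj_mul', hx]
      simp
    have h := eq_of_sum_node (F := fun τ : ℍ => fun _ : Fin 1 => eta τ) (g := g) (s := s)
      (fun τ => by simp_rw [eta_vadd])
      (w := scale (5 ^ (α % 2))) (C := 5 ^ α * (-1) ^ ((α + 1) / 2))
      (mul_ne_zero (pow_ne_zero _ (by norm_num)) (pow_ne_zero _ (by norm_num)))
      (fun τ => by
        ext i
        rw [Finset.sum_apply]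
        exact sum_node_eta α τ)
      (fun M hM => by
        ext i j
        have h1 := congrFun (hM I) i
        have h2 := eta_ne_zero' (scale (5 ^ (α % 2)) I).im_pos
        rw [Subsingleton.elim i 0, Subsingleton.elim j 0] at *
        simpa [mulVec, dotProduct, h2] using h1)
      hs0 (e := e) (U := fun j => δ j • 1) (V := ε • 1) (fun j => hone (hV j).norm_eq)
      (hone H.norm_eq) (fun j τ => by
        ext i
        simp only [(hV j).eta_smul, smul_mulVec, one_mulVec, Pi.smul_apply, smul_eq_mul]
        ring)
      (fun τ => by
        ext i
        simp only [H.eta_smul, smul_mulVec, one_mulVec, Pi.smul_apply, smul_eq_mul]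
        ring) j
    simpa using congrFun (congrFun h 0) 0
  exact ⟨e, fun j => by
    have := hV j
    rwa [hUV, hεδ] at this⟩

end

section

open ModularForm (eta)
open Matrix ModularGroup Filter Topology

/-! ### Behaviour at infinity -/

lemma tendsto_euler : Tendsto euler (𝓝 0) (𝓝 1) := by
  have h := tendsto_tprod_one_add_of_dominated_convergence (𝓕 := 𝓝 (0 : ℂ)) (g := 0)
    (f := fun (q : ℂ) (n : ℕ) => -q ^ (n + 1)) (bound := fun n => (1 / 2 : ℝ) ^ (n + 1))
  simp only [Pi.zero_apply, norm_neg, norm_pow, add_zero, tprod_one] at h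
  have heq : euler = fun q => ∏' n : ℕ, (1 + -q ^ (n + 1)) := by
    ext q
    exact tprod_congr fun n => sub_eq_add_neg _ _
  rw [heq]
  refine h
    (by simpa only [pow_succ'] using (summable_geometric_of_abs_lt_one (by norm_num)).mul_left _)
    (fun k => by simpa using ((continuous_pow (M := ℂ) (k + 1)).tendsto 0).neg) ?_
  filter_upwards [Metric.ball_mem_nhds (0 : ℂ) (by norm_num : (0 : ℝ) < 1 / 2)] with q hq k
  exact pow_le_pow_left₀ (norm_nonneg _) (mem_ball_zero_iff.mp hq).le _

/-- The filter of neighbourhoods of `i∞`. -/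
abbrev infinityFilter : Filter ℂ := comap Complex.im atTop

lemma tendsto_ee : Tendsto ee infinityFilter (𝓝 0) := by
  have h := (Function.Periodic.qParam_tendsto one_pos).mono_right nhdsWithin_le_nhds
  exact h.congr qParam_eq_ee

instance : NeBot infinityFilter := atTop_neBot.comap_of_surj Complex.im_surjective

lemma eventually_im_pos : ∀ᶠ z : ℂ in infinityFilter, 0 < z.im :=
  tendsto_comap.eventually (eventually_gt_atTop 0)

lemma tendsto_mul_infinity {n : ℕ} (hn : 0 < n) :
    Tendsto (fun z : ℂ => (n : ℂ) * z) infinityFilter infinityFilter := by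
  rw [tendsto_comap_iff]
  have h : Complex.im ∘ (fun z : ℂ => (n : ℂ) * z) = fun z => (n : ℝ) * z.im := by
    ext z
    simp
  rw [h]
  exact (tendsto_comap).const_mul_atTop (Nat.cast_pos.mpr hn)

lemma tendsto_euler_ee_pow {n : ℕ} (hn : n ≠ 0) :
    Tendsto (fun z => euler (ee z ^ n)) infinityFilter (𝓝 1) := by
  refine tendsto_euler.comp ?_
  have := tendsto_ee.pow n
  rwa [zero_pow hn] at this

lemma tendsto_thA : Tendsto thA infinityFilter (𝓝 1) := by
  have h := ((tendsto_euler_ee_pow two_ne_zero).pow 5).div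
    (((tendsto_euler_ee_pow one_ne_zero).pow 2).mul ((tendsto_euler_ee_pow four_ne_zero).pow 2))
    (by norm_num)
  norm_num at h
  refine h.congr' ?_
  filter_upwards [eventually_im_pos] with z hz
  have h1 := hasSum_sq (norm_ee_lt_one hz) (ee_ne_zero z)
  simp_rw [← ee_sq_mul] at h1
  exact h1.unique (hasSum_thA hz)

lemma tendsto_thB_div : Tendsto (fun z => thB z / ee (z / 4)) infinityFilter (𝓝 2) := by
  have h := (((tendsto_euler_ee_pow four_ne_zero).pow 2).const_mul 2).div
    (tendsto_euler_ee_pow two_ne_zero) one_ne_zero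
  norm_num at h
  refine h.congr' ?_
  filter_upwards [eventually_im_pos] with z hz
  have hee : ee (2 * z) = ee z ^ 2 := by exact_mod_cast ee_nsmul 2 z
  rw [(hasSum_thB hz).unique (hasSum_thB' hz), mul_div_cancel_left₀ _ (ee_ne_zero _), hee,
    ← pow_mul]
  rfl

lemma tFun_eq_ee {z : ℂ} : tFun z = ee z * (euler (ee z ^ 5) ^ 6 / euler (ee z) ^ 6) := by
  have h5 := eta_nat_mul 5 z
  push_cast at h5
  have h24 : ee z = ee (z / 24) ^ 24 := by
    rw [← ee_nsmul]
    congr 1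
    push_cast
    ring
  rw [tFun, h5, eta_eq z, mul_pow, mul_pow, h24, ← h24]
  have := ee_ne_zero (z / 24)
  field_simp
  rw [← h24]

lemma tendsto_tFun_div : Tendsto (fun z => tFun z / ee z) infinityFilter (𝓝 1) := by
  have h := ((tendsto_euler_ee_pow (n := 5) (by norm_num)).pow 6).div
    ((tendsto_euler_ee_pow one_ne_zero).pow 6) (by norm_num)
  norm_num at h
  refine h.congr fun z => ?_
  rw [tFun_eq_ee, mul_div_cancel_left₀ _ (ee_ne_zero _)]
  simp

lemma tendsto_tFun : Tendsto tFun infinityFilter (𝓝 0) := by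
  have h := tendsto_ee.mul tendsto_tFun_div
  rw [zero_mul] at h
  exact h.congr fun z => mul_div_cancel₀ _ (ee_ne_zero z)

lemma tFun_ne_zero {z : ℂ} (hz : 0 < z.im) : tFun z ≠ 0 :=
  div_ne_zero (pow_ne_zero _ (eta_ne_zero' (five_mul_im_pos hz)))
    (pow_ne_zero _ (eta_ne_zero' hz))

/-! ### Independence of products of theta values -/

lemma thB_add_five (z : ℂ) : thB (z + 5) = Complex.I * thB z := by
  rw [show z + 5 = z + 1 + 1 + 1 + 1 + 1 by ring, thB_add_one, thB_add_one, thB_add_one,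
    thB_add_one, thB_add_one]
  linear_combination Complex.I * thB z * Complex.I_pow_four

lemma thA_add_five (z : ℂ) : thA (z + 5) = thA z := by
  rw [show z + 5 = z + 1 + 1 + 1 + 1 + 1 by ring, thA_add_one, thA_add_one, thA_add_one,
    thA_add_one, thA_add_one]

lemma eq_zero_of_eigenvalues {X Y Z : ℂ} (h0 : X + Y + Z = 0) (h1 : -X + Complex.I * Y + Z = 0)
    (h2 : X - Y + Z = 0) : X = 0 ∧ Y = 0 ∧ Z = 0 := by
  have hY : Y = 0 := by linear_combination (h0 - h2) / 2
  subst hY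
  exact ⟨by linear_combination (h0 - h1) / 2, rfl, by linear_combination (h0 + h1) / 2⟩

/-- Under `z ↦ z + 1` the four products have eigenvalues `-1`, `i`, `i`, `1`. The two with
eigenvalue `i` are told apart at infinity by their leading exponents 1/4 and 5/4. -/
lemma theta_mul_theta_independent {a b c d : ℂ}
    (h : ∀ z : ℂ, 0 < z.im → a * (thB z * thB (5 * z)) + (b * (thB z * thA (5 * z)) +
      c * (thA z * thB (5 * z))) + d * (thA z * thA (5 * z)) = 0) :
    a = 0 ∧ b = 0 ∧ c = 0 ∧ d = 0 := by
  have him : ∀ {z : ℂ}, 0 < z.im → 0 < (z + 1).im := fun hz => by simpa using hz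
  have key : ∀ z : ℂ, 0 < z.im → a * (thB z * thB (5 * z)) = 0 ∧
      b * (thB z * thA (5 * z)) + c * (thA z * thB (5 * z)) = 0 ∧
      d * (thA z * thA (5 * z)) = 0 := fun z hz => by
    have h1 := h _ (him hz)
    have h2 := h _ (him (him hz))
    simp only [show ∀ z : ℂ, 5 * (z + 1) = 5 * z + 5 from fun z => by ring, thB_add_one,
      thA_add_one, thB_add_five, thA_add_five] at h1 h2
    refine eq_zero_of_eigenvalues (h z hz) ?_ ?_
    · linear_combination h1 - a * (thB z * thB (5 * z)) * Complex.I_sq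
    · linear_combination h2 - (a * (thB z * thB (5 * z)) * (Complex.I ^ 2 - 1) +
        b * (thB z * thA (5 * z)) + c * (thA z * thB (5 * z))) * Complex.I_sq
  have hI := I.im_pos
  have hI5 := five_mul_im_pos hI
  have hB : ∀ {z : ℂ}, 0 < z.im → thB z ≠ 0 := fun hz => by simpa [theta] using theta_ne_zero hz 0
  have hA : ∀ {z : ℂ}, 0 < z.im → thA z ≠ 0 := fun hz => by simpa [theta] using theta_ne_zero hz 1
  have hb : b = 0 := by
    have h5 := tendsto_mul_infinity (n := 5) (by norm_num)
    push_cast at h5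
    have hlim := ((tendsto_thB_div.mul (tendsto_thA.comp h5)).const_mul b).add
      (((tendsto_thA.mul (tendsto_thB_div.comp h5)).mul tendsto_ee).const_mul c)
    norm_num at hlim
    have h0 : Tendsto (fun _ : ℂ => (0 : ℂ)) infinityFilter (𝓝 (b * 2)) := by
      refine hlim.congr' ?_
      filter_upwards [eventually_im_pos] with z hz
      have h1 := (key z hz).2.1
      have h2 : ee (5 * z / 4) = ee (z / 4) * ee z := by
        rw [← ee_add]
        congr 1
        ring
      rw [h2]
      have := ee_ne_zero z
      have := ee_ne_zero (z / 4)
      generalize thA (5 * z) = u at *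
      generalize thB (5 * z) = v at *
      field_simp
      linear_combination h1
    have := tendsto_nhds_unique h0 tendsto_const_nhds
    simpa using this
  obtain ⟨h1, h2, h3⟩ := key _ hI
  rw [hb, zero_mul, zero_add] at h2
  exact ⟨(mul_eq_zero.mp h1).resolve_right (mul_ne_zero (hB hI) (hB hI5)), hb,
    (mul_eq_zero.mp h2).resolve_right (mul_ne_zero (hA hI) (hB hI5)),
    (mul_eq_zero.mp h3).resolve_right (mul_ne_zero (hA hI) (hA hI5))⟩

end

section

open ModularForm (eta)
open Matrix ModularGroup Filter Topology

/-! ### Transformation under `Γ₀(5)` -/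

lemma wedge_mulVec (U : Matrix (Fin 2) (Fin 2) ℂ) (v w : Fin 2 → ℂ) :
    wedge (U *ᵥ v) (U *ᵥ w) = U.det * wedge v w := by
  simp [wedge, mulVec, dotProduct, Fin.sum_univ_two, det_fin_two]
  ring

lemma wedge_smul_smul (c d : ℂ) (v w : Fin 2 → ℂ) : wedge (c • v) (d • w) = c * d * wedge v w := by
  simp [wedge]
  ring

lemma ext_wedge {v w : Fin 2 → ℂ} (h : ∀ u, wedge u v = wedge u w) : v = w := by
  have h0 := h ![1, 0]
  have h1 := h ![0, 1]
  simp [wedge] at h0 h1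
  ext i
  fin_cases i
  · exact h1
  · exact h0

namespace Transforms

variable {g : SL(2, ℤ)} {s : ℍ → ℂ} {φ ψ : ℍ → ℍ} {U V : Matrix (Fin 2) (Fin 2) ℂ} {ε δ : ℂ}

lemma det_ne_zero (H : Transforms g s φ ψ U ε) : U.det ≠ 0 := fun h0 => by
  have := congrArg Matrix.det H.unitary
  rw [det_mul, h0, mul_zero, det_one] at this
  exact zero_ne_one this

lemma eps_ne_zero (H : Transforms g s φ ψ U ε) : ε ≠ 0 := fun h0 => by
  simpa [h0] using H.norm_eq

end Transforms

lemma coe_scale_zero (τ : ℍ) : ((scale (5 ^ 0) τ : ℍ) : ℂ) = τ := by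
  rw [coe_scale]
  simp

lemma coe_scale_one (τ : ℍ) : ((scale (5 ^ 1) τ : ℍ) : ℂ) = 5 * τ := by
  rw [coe_scale]
  simp

/-! ### Comparison of the multipliers at `τ` and `5τ` -/

section gammaZero

variable {g : SL(2, ℤ)} {s : ℍ → ℂ} {U V : Matrix (Fin 2) (Fin 2) ℂ} {ε δ : ℂ}

/-- Transforming `wedge_theta` gives the claim for the vectors `theta z`, `theta (5z)`. Independence
of the four products of their components extends it to all vectors. -/
lemma wedge_mulVec_mulVec (hs : ∀ τ, s τ ≠ 0) (H : Transforms g s (scale (5 ^ 0)) (scale (5 ^ 0)) U ε)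
    (K : Transforms g s (scale (5 ^ 1)) (scale (5 ^ 1)) V δ) (v w : Fin 2 → ℂ) :
    wedge (U *ᵥ v) (V *ᵥ w) = ε * δ * wedge v w := by
  have key : ∀ z : ℂ, 0 < z.im → wedge (U *ᵥ theta z) (V *ᵥ theta (5 * z)) =
      ε * δ * wedge (theta z) (theta (5 * z)) := fun z hz => by
    lift z to ℍ using hz
    have h1 := wedge_theta (g • z).im_pos
    have e1 := H.eta_smul z
    have e2 := K.eta_smul z
    have t1 := H.theta_smul z
    have t2 := K.theta_smul z
    rw [coe_scale_zero, coe_scale_zero] at e1 t1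
    rw [coe_scale_one, coe_scale_one] at e2 t2
    rw [t1, t2, e1, e2, wedge_smul_smul] at h1
    have h2 : s z * s z ≠ 0 := mul_ne_zero (hs z) (hs z)
    apply mul_left_cancel₀ h2
    rw [h1, wedge_theta z.im_pos]
    ring
  obtain ⟨ha, hb, hc, hd⟩ := theta_mul_theta_independent (a := U 1 0 * V 0 0 - U 0 0 * V 1 0)
    (b := U 1 0 * V 0 1 - U 0 0 * V 1 1 + ε * δ) (c := U 1 1 * V 0 0 - U 0 1 * V 1 0 - ε * δ)
    (d := U 1 1 * V 0 1 - U 0 1 * V 1 1) fun z hz => by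
      have h := key z hz
      simp [wedge, mulVec, dotProduct, Fin.sum_univ_two, theta] at h
      linear_combination h
  simp [wedge, mulVec, dotProduct, Fin.sum_univ_two]
  linear_combination v 0 * w 0 * ha + v 0 * w 1 * hb + v 1 * w 0 * hc + v 1 * w 1 * hd

/-- The forms `wedge (U u) (V w)` and `wedge (U u) (U w)` are both multiples of `wedge u w`. As the
cross product is nondegenerate, `V` is a multiple of `U`. -/
lemma eq_smul_of_transforms (hs : ∀ τ, s τ ≠ 0)
    (H : Transforms g s (scale (5 ^ 0)) (scale (5 ^ 0)) U ε)
    (K : Transforms g s (scale (5 ^ 1)) (scale (5 ^ 1)) V δ) : V = (ε * δ / U.det) • U := by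
  have hU : U * star U = 1 := mul_eq_one_comm.mp H.unitary
  have hd := H.det_ne_zero
  have h : ∀ w, V *ᵥ w = ((ε * δ / U.det) • U) *ᵥ w := fun w => ext_wedge fun u => by
    have hu : u = U *ᵥ (star U *ᵥ u) := by rw [mulVec_mulVec, hU, one_mulVec]
    rw [hu, wedge_mulVec_mulVec hs H K, smul_mulVec]
    have := wedge_smul_smul 1 (ε * δ / U.det) (U *ᵥ (star U *ᵥ u)) (U *ᵥ w)
    rw [one_smul] at this
    rw [this, wedge_mulVec]
    field_simp
  exact Matrix.ext_of_mulVec_single fun i => h _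

lemma tFun_smul_of_transforms (H : Transforms g s (scale (5 ^ 0)) (scale (5 ^ 0)) U ε)
    (K : Transforms g s (scale (5 ^ 1)) (scale (5 ^ 1)) V δ) (hs : ∀ τ, s τ ≠ 0) (τ : ℍ) :
    tFun (g • τ : ℍ) = (δ / ε) ^ 6 * tFun τ := by
  have e1 := H.eta_smul τ
  have e2 := K.eta_smul τ
  rw [coe_scale_zero, coe_scale_zero] at e1
  rw [coe_scale_one, coe_scale_one] at e2
  have := hs τ
  have := H.eps_ne_zero
  have := eta_ne_zero' τ.im_pos
  rw [tFun, tFun, e1, e2]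
  field_simp

/-- Covariance of the gradient gives `U` times the scalar `ε⁶ / det U`, the eta quotient contributes
`δ / ε⁵`, and `(εδ / det U) • U` is exactly `V`. -/
lemma gradOdd_smul (hs : ∀ τ, s τ ≠ 0) (H : Transforms g s (scale (5 ^ 0)) (scale (5 ^ 0)) U ε)
    (K : Transforms g s (scale (5 ^ 1)) (scale (5 ^ 1)) V δ) (τ : ℍ) :
    gradOdd (g • τ : ℍ) = s τ • (V *ᵥ gradOdd τ) := by
  have e1 := H.eta_smul τ
  have e2 := K.eta_smul τ
  have t1 := H.theta_smul τ
  rw [coe_scale_zero, coe_scale_zero] at e1 t1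
  rw [coe_scale_one, coe_scale_one] at e2
  have hg : sexticGrad (U *ᵥ theta τ) = (ε ^ 6 / U.det) • (U *ᵥ sexticGrad (theta τ)) := by
    rw [div_eq_inv_mul, ← smul_smul, ← H.grad_mulVec, smul_smul, inv_mul_cancel₀ H.det_ne_zero,
      one_smul]
  rw [gradOdd, gradOdd, e1, e2, t1, sexticGrad_smul, hg, eq_smul_of_transforms hs H K,
    mulVec_smul, smul_mulVec]
  simp only [smul_smul]
  congr 1
  have := hs τ
  have := H.eps_ne_zero
  have := H.det_ne_zero
  have := eta_ne_zero' τ.im_pos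
  field_simp

lemma gradEven_smul (hs : ∀ τ, s τ ≠ 0) (H : Transforms g s (scale (5 ^ 0)) (scale (5 ^ 0)) U ε)
    (K : Transforms g s (scale (5 ^ 1)) (scale (5 ^ 1)) V δ) (τ : ℍ) :
    gradEven (g • τ : ℍ) = s τ • (U *ᵥ gradEven τ) := by
  have e1 := H.eta_smul τ
  have e2 := K.eta_smul τ
  have t2 := K.theta_smul τ
  rw [coe_scale_zero, coe_scale_zero] at e1
  rw [coe_scale_one, coe_scale_one] at e2 t2
  have hd := H.det_ne_zero
  have h1 := H.eps_ne_zero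
  have h2 := K.eps_ne_zero
  have hV := eq_smul_of_transforms hs H K
  have hUV : U = (U.det / (ε * δ)) • V := by
    rw [hV, smul_smul]
    rw [show U.det / (ε * δ) * (ε * δ / U.det) = 1 by field_simp, one_smul]
  have hdet : V.det = (ε * δ) ^ 2 / U.det := by
    rw [hV, det_smul, Fintype.card_fin]
    field_simp
  have hg : sexticGrad (V *ᵥ theta (5 * τ)) =
      (δ ^ 6 / V.det) • (V *ᵥ sexticGrad (theta (5 * τ))) := by
    rw [div_eq_inv_mul, ← smul_smul, ← K.grad_mulVec, smul_smul, inv_mul_cancel₀ K.det_ne_zero,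
      one_smul]
  rw [gradEven, gradEven, e1, e2, t2, sexticGrad_smul, hg, hdet]
  nth_rewrite 2 [hUV]
  simp only [smul_smul, smul_mulVec, mulVec_smul]
  congr 1
  have := hs τ
  have := eta_ne_zero' (five_mul_im_pos τ.im_pos)
  field_simp

/-- Comparing `wedge_gradOdd_sq` at `gτ` and `τ` gives `c (1 + 22t + 125t²) = 1 + 22μt + 125μ²t²`.
At infinity `t → 0` yields `c = 1`, and then the next coefficient yields `μ = 1`. In particular `t`
is invariant. -/
lemma sq_eq_one_of_transforms (hs : ∀ τ, s τ ≠ 0)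
    (H : Transforms g s (scale (5 ^ 0)) (scale (5 ^ 0)) U ε)
    (K : Transforms g s (scale (5 ^ 1)) (scale (5 ^ 1)) V δ) :
    (ε * δ) ^ 2 = U.det ^ 2 ∧ (δ / ε) ^ 6 = 1 := by
  have hd := H.det_ne_zero
  have h1 := H.eps_ne_zero
  have h2 := K.eps_ne_zero
  set μ := (δ / ε) ^ 6 with hμ
  set c := (ε * δ) ^ 2 / U.det ^ 2 with hc
  have hV := eq_smul_of_transforms hs H K
  have key : ∀ z : ℂ, 0 < z.im → c * (1 + 22 * tFun z + 125 * tFun z ^ 2) =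
      1 + 22 * (μ * tFun z) + 125 * (μ * tFun z) ^ 2 := fun z hz => by
    lift z to ℍ using hz
    have h := wedge_gradOdd_sq (g • z).im_pos
    have e1 := H.eta_smul z
    have e2 := K.eta_smul z
    have t2 := K.theta_smul z
    rw [coe_scale_zero, coe_scale_zero] at e1
    rw [coe_scale_one, coe_scale_one] at e2 t2
    rw [gradOdd_smul hs H K, t2, e1, e2, wedge_smul_smul, wedge_mulVec, mul_pow, mul_pow _ (wedge _ _),
      wedge_gradOdd_sq z.im_pos, tFun_smul_of_transforms H K hs, ← hμ, hV, det_smul,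
      Fintype.card_fin] at h
    have h3 := hs z
    have h4 := eta_ne_zero' z.im_pos
    have h5 := eta_ne_zero' (five_mul_im_pos z.im_pos)
    have h6 : (s z * s z) ^ 2 * (ε * δ) ^ 2 * (eta z * eta (5 * z)) ^ 2 * 100 ≠ 0 := by
      simp [h1, h2, h3, h4, h5]
    apply mul_left_cancel₀ h6
    calc _ = (s z * s z) ^ 2 * ((ε * δ / U.det) ^ 2 * U.det) ^ 2 * ((eta z * eta (5 * z)) ^ 2 *
          (100 * (1 + 22 * tFun z + 125 * tFun z ^ 2))) := by
          rw [hc]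
          field_simp
      _ = _ := by linear_combination h
  have hc1 : c = 1 := by
    have l1 := (((tendsto_tFun.const_mul 22).const_add 1).add
      ((tendsto_tFun.pow 2).const_mul 125)).const_mul c
    have l2 := (((tendsto_tFun.const_mul μ).const_mul 22).const_add 1).add
      (((tendsto_tFun.const_mul μ).pow 2).const_mul 125)
    norm_num at l1 l2
    refine tendsto_nhds_unique l1 (l2.congr' ?_)
    filter_upwards [eventually_im_pos] with z hz
    exact (key z hz).symm
  have hμ1 : 22 = 22 * μ := by
    have l1 : Tendsto (fun z => 22 + 125 * tFun z) infinityFilter (𝓝 (22 + 125 * 0)) :=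
      (tendsto_tFun.const_mul 125).const_add 22
    have l2 : Tendsto (fun z => 22 * μ + 125 * μ ^ 2 * tFun z) infinityFilter
      (𝓝 (22 * μ + 125 * μ ^ 2 * 0)) := (tendsto_tFun.const_mul _).const_add _
    rw [mul_zero, add_zero] at l1 l2
    refine tendsto_nhds_unique l1 (l2.congr' ?_)
    filter_upwards [eventually_im_pos] with z hz
    apply mul_left_cancel₀ (tFun_ne_zero hz)
    have := key z hz
    rw [hc1] at this
    linear_combination -this
  refine ⟨?_, ?_⟩
  · rw [hc, div_eq_one_iff_eq (pow_ne_zero _ hd)] at hc1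
    exact hc1
  · linear_combination -hμ1 / 22

end gammaZero

/-- The weighted sum of the values of `theta` at the points `(τ + 24 j) / 5^α`. -/
def thetaSum (α : ℕ) (τ : ℍ) : Fin 2 → ℂ :=
  ∑ j : ZMod (5 ^ α), (eta (scale (5 ^ (α % 2)) τ) / eta (node (5 ^ α) j.val τ)) ^ 2 •
    theta (node (5 ^ α) j.val τ)

/-- `gradEven` or `gradOdd`, according to the parity. -/
def grad (a : ℕ) (τ : ℍ) : Fin 2 → ℂ := if a = 0 then gradEven τ else gradOdd τ

/-- The transformation of all relevant vectors under an element of `Γ₀(5)`. -/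
structure VectorTransform (g : SL(2, ℤ)) (s : ℍ → ℂ) (U : ℕ → Matrix (Fin 2) (Fin 2) ℂ) (κ : ℂ) :
    Prop where
  ne_zero : ∀ τ, s τ ≠ 0
  kappa_ne_zero : κ ≠ 0
  theta_smul : ∀ a < 2, ∀ τ : ℍ, theta (scale (5 ^ a) (g • τ)) = s τ • (U a *ᵥ theta (scale (5 ^ a) τ))
  grad_smul : ∀ a < 2, ∀ τ : ℍ, grad a (g • τ) = s τ • (U a *ᵥ grad a τ)
  thetaSum_smul : ∀ α, ∀ τ : ℍ, thetaSum α (g • τ) = s τ • (U (α % 2) *ᵥ thetaSum α τ)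
  eta_smul : ∀ τ : ℍ, eta (g • τ : ℍ) * eta (5 * (g • τ : ℍ)) = κ * s τ ^ 2 * (eta τ * eta (5 * τ))
  det_sq : ∀ a < 2, (U a).det ^ 2 = κ ^ 2
  tFun_smul : ∀ τ : ℍ, tFun (g • τ : ℍ) = tFun τ
  eq_smul : ∃ c : ℂ, c ≠ 0 ∧ U 1 = c • U 0

theorem exists_vectorTransform {g : SL(2, ℤ)} (h5 : (5 : ℤ) ∣ g 1 0) :
    ∃ s U κ, VectorTransform g s U κ := by
  obtain ⟨s, -, -, hs, hs2, -⟩ := exists_multiplier g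
  have hs0 : ∀ τ, s τ ≠ 0 := fun τ h0 => autFactor_ne_zero g τ (by rw [← hs2, h0]; norm_num)
  have hsc : ∀ a < 2, ∃ U ε, Transforms g s (scale (5 ^ a)) (scale (5 ^ a)) U ε := fun a ha => by
    obtain ⟨γ, hγ⟩ := exists_scale_smul (5 ^ a) g (by
      refine dvd_trans ?_ h5
      push_cast
      simpa using pow_dvd_pow (5 : ℤ) (show a ≤ 1 by omega))
    exact exists_transforms hs hs2 (ψ' := node (5 ^ a) 0) (continuous_node _ _)
      (fun w => unnode_node _ _ _) (fun w => node_unnode _ _ _) hγ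
  obtain ⟨U, ε, H⟩ := hsc 0 (by norm_num)
  obtain ⟨V, δ, K⟩ := hsc 1 (by norm_num)
  have hV := eq_smul_of_transforms hs0 H K
  obtain ⟨hsq, hμ⟩ := sq_eq_one_of_transforms hs0 H K
  have hε := H.eps_ne_zero
  have hδ := K.eps_ne_zero
  have hd := H.det_ne_zero
  -- The points are permuted, and the common factor `ω s` cancels in the quotients of eta values, so
  -- the weights are permuted along with the theta vectors.
  have hsum : ∀ α W ω, Transforms g s (scale (5 ^ (α % 2))) (scale (5 ^ (α % 2))) W ω →
      ∀ τ, thetaSum α (g • τ) = s τ • (W *ᵥ thetaSum α τ) := fun α W ω J τ => by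
    obtain ⟨e, he⟩ := node_transforms α h5 hs hs2 J
    have hω := J.eps_ne_zero
    rw [thetaSum, thetaSum, ← Equiv.sum_comp e (fun j => (eta (scale (5 ^ (α % 2)) τ) /
      eta (node (5 ^ α) j.val τ)) ^ 2 • theta (node (5 ^ α) j.val τ)), mulVec_sum, Finset.smul_sum]
    refine Finset.sum_congr rfl fun j _ => ?_
    rw [(he j).theta_smul, (he j).eta_smul, J.eta_smul, mulVec_smul, smul_comm (s τ)]
    congr 2
    rw [mul_div_mul_left]
    exact mul_ne_zero hω (hs0 τ)
  refine ⟨s, fun a => if a = 0 then U else V, ε * δ, hs0, mul_ne_zero hε hδ, fun a ha => ?_,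
    fun a ha => ?_, fun α => ?_, fun τ => ?_, fun a ha => ?_, fun τ => ?_, ε * δ / U.det,
    div_ne_zero (mul_ne_zero hε hδ) hd, hV⟩
  · interval_cases a
    · exact H.theta_smul
    · exact K.theta_smul
  · interval_cases a
    · exact gradEven_smul hs0 H K
    · exact gradOdd_smul hs0 H K
  · have h1 := hsum α
    rcases Nat.mod_two_eq_zero_or_one α with h | h
    · rw [h] at h1 ⊢
      exact h1 U ε H
    · rw [h] at h1 ⊢
      exact h1 V δ K
  · have e1 := H.eta_smul τ
    have e2 := K.eta_smul τ
    rw [coe_scale_zero, coe_scale_zero] at e1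
    rw [coe_scale_one, coe_scale_one] at e2
    rw [e1, e2]
    ring
  · interval_cases a
    · exact hsq.symm
    · simp only [one_ne_zero, if_false]
      rw [hV, det_smul, Fintype.card_fin, mul_pow, ← pow_mul, div_pow, pow_mul _ 2 2, hsq]
      field_simp
  · rw [tFun_smul_of_transforms H K hs0, hμ, one_mul]

end

section

open ModularForm (eta)
open Matrix ModularGroup Filter Topology

/-! ### The matrix `gam` exchanges the components -/

/-- `theta ∘ g` is proportional to `M *ᵥ theta`. -/
def ThetaProp (g : SL(2, ℤ)) (M : Matrix (Fin 2) (Fin 2) ℂ) : Prop :=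
  ∀ τ : ℍ, ∃ c : ℂ, theta (g • τ : ℍ) = c • (M *ᵥ theta τ)

lemma ThetaProp.mul {g h : SL(2, ℤ)} {M N : Matrix (Fin 2) (Fin 2) ℂ} (hg : ThetaProp g M)
    (hh : ThetaProp h N) : ThetaProp (g * h) (M * N) := fun τ => by
  obtain ⟨c, hc⟩ := hg (h • τ)
  obtain ⟨d, hd⟩ := hh τ
  exact ⟨c * d, by rw [mul_smul, hc, hd, mulVec_smul, smul_smul, mulVec_mulVec]⟩

lemma thetaProp_S : ThetaProp S !![-1, 1; 1, 1] := fun τ =>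
  ⟨_, by rw [multiplier_S.theta_smul, smul_mulVec, smul_smul]⟩

lemma thB_add_int (n : ℤ) (z : ℂ) : thB (z + n) = Complex.I ^ n * thB z := by
  induction n generalizing z with
  | zero => simp
  | succ n ih =>
    push_cast at ih ⊢
    rw [← add_assoc, thB_add_one, ih, zpow_add_one₀ Complex.I_ne_zero]
    ring
  | pred n ih =>
    have h := thB_add_one (z + ((-n - 1 : ℤ) : ℂ))
    have h2 := ih z
    rw [zpow_sub_one₀ Complex.I_ne_zero, mul_comm _ Complex.I⁻¹, mul_assoc, ← h2,
      eq_inv_mul_iff_mul_eq₀ Complex.I_ne_zero, ← h]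
    congr 1
    push_cast
    ring

lemma thA_add_int (n : ℤ) (z : ℂ) : thA (z + n) = thA z := by
  induction n generalizing z with
  | zero => simp
  | succ n ih =>
    push_cast at ih ⊢
    rw [← add_assoc, thA_add_one, ih]
  | pred n ih =>
    have h := thA_add_one (z + ((-n - 1 : ℤ) : ℂ))
    rw [← h, ← ih z]
    congr 1
    push_cast
    ring

lemma thetaProp_T (n : ℤ) : ThetaProp (T ^ n) !![Complex.I ^ n, 0; 0, 1] := fun τ => ⟨1, by
  have h : ((T ^ n • τ : ℍ) : ℂ) = τ + n := by
    rw [coe_T_zpow_smul_eq]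
  rw [h, theta, thB_add_int, thA_add_int]
  ext i
  fin_cases i <;> simp [theta, mul_comm]⟩

lemma thetaProp_gam : ∃ c : ℂ, c ≠ 0 ∧ ∀ τ : ℍ,
    thB (gam • τ : ℍ) * thB τ = c * (thA (gam • τ : ℍ) * thA τ) := by
  -- The word in `S` and `T` lets the multiplier matrix be computed up to a scalar; it comes out
  -- antidiagonal.
  have hg : gam = T ^ (1 : ℤ) * S * T ^ (2 : ℤ) * S * T ^ (-6 : ℤ) * S * T ^ (-4 : ℤ) * S *
      T ^ (0 : ℤ) := by
    have h : ∀ n : ℤ, T ^ n = ⟨!![1, n; 0, 1], by simp⟩ := fun n => by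
      ext i j
      rw [coe_T_zpow]
    rw [h, h, h, h, h]
    decide
  have h := (((((((((thetaProp_T 1).mul thetaProp_S).mul (thetaProp_T 2)).mul thetaProp_S).mul
    (thetaProp_T (-6))).mul thetaProp_S).mul (thetaProp_T (-4))).mul thetaProp_S).mul
    (thetaProp_T 0))
  rw [← hg] at h
  refine ⟨-Complex.I, neg_ne_zero.mpr Complex.I_ne_zero, fun τ => ?_⟩
  obtain ⟨c, hc⟩ := h τ
  have h2 : Complex.I ^ (2 : ℤ) = -1 := by norm_cast; simp
  have h6 : Complex.I ^ (-6 : ℤ) = -1 := by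
    rw [_root_.zpow_neg, inv_eq_iff_eq_inv]
    norm_cast
    rw [show Complex.I ^ 6 = (Complex.I ^ 2) ^ 3 by ring, Complex.I_sq]
    norm_num
  have h4 : Complex.I ^ (-4 : ℤ) = 1 := by
    rw [_root_.zpow_neg, inv_eq_iff_eq_inv]
    norm_cast
    rw [Complex.I_pow_four, inv_one]
  rw [h2, h6, h4, zpow_zero, zpow_one] at hc
  generalize ((gam • τ : ℍ) : ℂ) = w at hc ⊢
  have h0 := congrFun hc 0
  have h1 := congrFun hc 1
  simp [theta] at h0 h1
  rw [h0, h1]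
  ring

/-- Inserting `U` into the relation of `thetaProp_gam` gives a quadratic form in `thB`, `thA` that
vanishes. Its three monomials have eigenvalues `-1`, `i`, `1` under `z ↦ z + 1`, so the diagonal
entries are zero. For `a = 1` use that `U 1` is proportional to `U 0`. -/
lemma VectorTransform.antidiagonal {s : ℍ → ℂ} {U : ℕ → Matrix (Fin 2) (Fin 2) ℂ} {κ : ℂ}
    (H : VectorTransform gam s U κ) {a : ℕ} (ha : a < 2) : U a 0 0 = 0 ∧ U a 1 1 = 0 := by
  have h0 : U 0 0 0 = 0 ∧ U 0 1 1 = 0 := by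
    obtain ⟨c, hc, h⟩ := thetaProp_gam
    have key : ∀ z : ℂ, 0 < z.im → U 0 0 0 * thB z ^ 2 + (U 0 0 1 - c * U 0 1 0) * (thB z * thA z) +
        -(c * U 0 1 1) * thA z ^ 2 = 0 := fun z hz => by
      lift z to ℍ using hz
      have h1 := h z
      have h2 := H.theta_smul 0 two_pos z
      rw [coe_scale_zero, coe_scale_zero] at h2
      generalize ((gam • z : ℍ) : ℂ) = w at h1 h2
      have e0 := congrFun h2 0
      have e1 := congrFun h2 1
      simp [theta] at e0 e1
      rw [e0, e1] at h1
      apply mul_left_cancel₀ (H.ne_zero z)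
      linear_combination h1
    have him : ∀ {z : ℂ}, 0 < z.im → 0 < (z + 1).im := fun hz => by simpa using hz
    have hI := I.im_pos
    have k1 := key _ (him hI)
    have k2 := key _ (him (him hI))
    simp only [thB_add_one, thA_add_one] at k1 k2
    obtain ⟨r1, -, r3⟩ := eq_zero_of_eigenvalues (key _ hI)
      (by linear_combination k1 - U 0 0 0 * thB I ^ 2 * Complex.I_sq)
      (by linear_combination k2 - (U 0 0 0 * thB I ^ 2 * (Complex.I ^ 2 - 1) +
        (U 0 0 1 - c * U 0 1 0) * (thB I * thA I)) * Complex.I_sq)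
    have hB : thB I ≠ 0 := by simpa [theta] using theta_ne_zero hI 0
    have hA : thA I ≠ 0 := by simpa [theta] using theta_ne_zero hI 1
    exact ⟨(mul_eq_zero.mp r1).resolve_right (pow_ne_zero 2 hB),
      (mul_eq_zero.mp (neg_eq_zero.mp ((mul_eq_zero.mp r3).resolve_right (pow_ne_zero 2 hA)))
        ).resolve_left hc⟩
  interval_cases a
  · exact h0
  · obtain ⟨c, -, hc⟩ := H.eq_smul
    simp [hc, h0]

lemma five_dvd_gam : (5 : ℤ) ∣ gam 1 0 := ⟨10, rfl⟩

/-- A pair of vectors that transform alike: the ratio of components gets exchanged by `gam`. -/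
lemma ratio_antidiagonal {U : Matrix (Fin 2) (Fin 2) ℂ} (h : U 0 0 = 0 ∧ U 1 1 = 0)
    (hd : U.det ≠ 0) {s : ℂ} (hs : s ≠ 0) {v w v' w' : Fin 2 → ℂ} (hv : v' = s • (U *ᵥ v))
    (hw : w' = s • (U *ᵥ w)) (β : Fin 2) : v' β / w' β = v (1 - β) / w (1 - β) := by
  rw [det_fin_two, h.1, zero_mul, zero_sub, neg_ne_zero] at hd
  have h01 := left_ne_zero_of_mul hd
  have h10 := right_ne_zero_of_mul hd
  rw [hv, hw]
  fin_cases β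
  · simp [h.1]
    rw [mul_div_mul_left _ _ hs, mul_div_mul_left _ _ h01]
  · simp [h.2]
    rw [mul_div_mul_left _ _ hs, mul_div_mul_left _ _ h10]

/-- The values of the module generators. -/
def pFun (β a : Fin 2) (z : ℂ) : ℂ := genPoly β a (tFun z) (xFun z) (yFun z)

/-- The quotient `W_β / Θ_β`, a multiple of `L_α^{(β)}`. -/
def thetaRatio (β : Fin 2) (α : ℕ) (τ : ℍ) : ℂ :=
  thetaSum α τ β / theta (scale (5 ^ (α % 2)) τ) β

/-- The coefficients of the affine relation between `pFun` and the ratio of `grad` and `theta`. -/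
lemma pFun_eq (β a : Fin 2) (τ : ℍ) : pFun β a τ =
    (if a = 0 then 1 + 64 * tFun τ + 625 * tFun τ ^ 2 else 6 * tFun τ / 5) -
      (if a = 0 then tFun τ else tFun τ / 5) *
        (grad a τ β / theta (scale (5 ^ (a : ℕ)) τ) β) := by
  fin_cases a
  · simp [pFun, grad, genPoly_even τ.im_pos]
    rw [coe_scale]
    simp
  · simp [pFun, grad, genPoly_odd τ.im_pos]
    rw [coe_scale]
    simp

theorem pFun_gam (β a : Fin 2) (τ : ℍ) : pFun β a (gam • τ : ℍ) = pFun (1 - β) a τ := by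
  obtain ⟨s, U, κ, H⟩ := exists_vectorTransform five_dvd_gam
  have ha : (a : ℕ) < 2 := a.2
  have hd : (U a).det ≠ 0 := fun h0 => H.kappa_ne_zero (by
    have := H.det_sq a ha
    rw [h0] at this
    simpa using this.symm)
  rw [pFun_eq, pFun_eq, H.tFun_smul, ratio_antidiagonal (H.antidiagonal ha) hd (H.ne_zero τ)
    (H.grad_smul a ha τ) (H.theta_smul a ha τ)]

theorem thetaRatio_gam (β : Fin 2) (α : ℕ) (τ : ℍ) :
    thetaRatio β α (gam • τ) = thetaRatio (1 - β) α τ := by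
  obtain ⟨s, U, κ, H⟩ := exists_vectorTransform five_dvd_gam
  have ha : α % 2 < 2 := Nat.mod_lt _ two_pos
  have hd : (U (α % 2)).det ≠ 0 := fun h0 => H.kappa_ne_zero (by
    have := H.det_sq _ ha
    rw [h0] at this
    simpa using this.symm)
  exact ratio_antidiagonal (H.antidiagonal ha) hd (H.ne_zero τ)
    (H.thetaSum_smul α τ) (H.theta_smul _ ha τ) β

/-! ### The two coefficient functions -/

/-- The coefficient of `theta` in the expansion of `thetaSum`. -/
def coeffTheta (α : ℕ) (τ : ℍ) : ℂ :=
  wedge (grad (α % 2) τ) (thetaSum α τ) *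
    wedge (grad (α % 2) τ) (theta (scale (5 ^ (α % 2)) τ)) / (eta τ * eta (5 * τ)) ^ 2

/-- The coefficient of `grad` in the expansion of `thetaSum`. -/
def coeffGrad (α : ℕ) (τ : ℍ) : ℂ :=
  wedge (thetaSum α τ) (theta (scale (5 ^ (α % 2)) τ)) *
    wedge (grad (α % 2) τ) (theta (scale (5 ^ (α % 2)) τ)) / (eta τ * eta (5 * τ)) ^ 2

/-- One cross product picks up `s² det U`, and `det U` is known only up to sign. A product of two
cross products picks up `s⁴ κ²`, which matches the square of the eta product. -/
lemma wedge_mul_wedge_invariant {s : ℂ} {U : Matrix (Fin 2) (Fin 2) ℂ} {κ e e' : ℂ} (hs : s ≠ 0)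
    (hκ : κ ≠ 0) (hU : U.det ^ 2 = κ ^ 2) {u v w u' v' w' r r' : Fin 2 → ℂ}
    (hu : u' = s • (U *ᵥ u)) (hv : v' = s • (U *ᵥ v)) (hw : w' = s • (U *ᵥ w))
    (hr : r' = s • (U *ᵥ r)) (he : e' = κ * s ^ 2 * e) :
    wedge u' v' * wedge w' r' / e' ^ 2 = wedge u v * wedge w r / e ^ 2 := by
  rw [hu, hv, hw, hr, he, wedge_smul_smul, wedge_smul_smul, wedge_mulVec, wedge_mulVec]
  rw [show s * s * (U.det * wedge u v) * (s * s * (U.det * wedge w r)) =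
    (s ^ 4 * U.det ^ 2) * (wedge u v * wedge w r) by ring, hU,
    show (κ * s ^ 2 * e) ^ 2 = (s ^ 4 * κ ^ 2) * e ^ 2 by ring, mul_div_mul_left]
  exact mul_ne_zero (pow_ne_zero _ hs) (pow_ne_zero _ hκ)

theorem coeff_smul (α : ℕ) {g : SL(2, ℤ)} (h5 : (5 : ℤ) ∣ g 1 0) (τ : ℍ) :
    coeffTheta α (g • τ) = coeffTheta α τ ∧ coeffGrad α (g • τ) = coeffGrad α τ := by
  obtain ⟨s, U, κ, H⟩ := exists_vectorTransform h5
  have ha : α % 2 < 2 := Nat.mod_lt _ two_pos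
  exact ⟨wedge_mul_wedge_invariant (H.ne_zero τ) H.kappa_ne_zero (H.det_sq _ ha)
    (H.grad_smul _ ha τ) (H.thetaSum_smul α τ) (H.grad_smul _ ha τ) (H.theta_smul _ ha τ)
    (H.eta_smul τ), wedge_mul_wedge_invariant (H.ne_zero τ) H.kappa_ne_zero (H.det_sq _ ha)
    (H.thetaSum_smul α τ) (H.theta_smul _ ha τ) (H.grad_smul _ ha τ) (H.theta_smul _ ha τ)
    (H.eta_smul τ)⟩

/-- The factor between the discriminants in the even and the odd case. -/
def discFactor (a : ℕ) (t : ℂ) : ℂ := if a = 0 then 4 / t ^ 2 else 100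

lemma wedge_grad_sq {a : ℕ} (ha : a < 2) (τ : ℍ) :
    wedge (grad a τ) (theta (scale (5 ^ a) τ)) ^ 2 = (eta τ * eta (5 * τ)) ^ 2 *
      (discFactor a (tFun τ) * (1 + 22 * tFun τ + 125 * tFun τ ^ 2)) := by
  interval_cases a
  · have h := wedge_gradEven_sq τ.im_pos
    have ht := tFun_ne_zero τ.im_pos
    rw [coe_scale_zero, grad, if_pos rfl, discFactor, if_pos rfl]
    field_simp
    linear_combination h
  · have h := wedge_gradOdd_sq τ.im_pos
    rw [coe_scale_one, grad, if_neg one_ne_zero, discFactor, if_neg one_ne_zero, h]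

theorem disc_mul_thetaRatio (α : ℕ) (β : Fin 2) (τ : ℍ) :
    discFactor (α % 2) (tFun τ) * (1 + 22 * tFun τ + 125 * tFun τ ^ 2) * thetaRatio β α τ =
      coeffTheta α τ + coeffGrad α τ *
        (grad (α % 2) τ β / theta (scale (5 ^ (α % 2)) τ) β) := by
  have h := wedge_grad_sq (Nat.mod_lt α two_pos) τ
  have h1 := eta_ne_zero' τ.im_pos
  have h5 := eta_ne_zero' (five_mul_im_pos τ.im_pos)
  have hθ := theta_ne_zero (scale (5 ^ (α % 2)) τ).im_pos β
  rw [coeffTheta, coeffGrad, thetaRatio]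
  generalize grad (α % 2) τ = P at *
  generalize theta (scale (5 ^ (α % 2)) τ) = Θ at *
  generalize thetaSum α τ = W at *
  have he : (eta τ * eta (5 * τ)) ^ 2 ≠ 0 := pow_ne_zero _ (mul_ne_zero h1 h5)
  generalize (eta τ * eta (5 * τ)) ^ 2 = e at *
  generalize discFactor (α % 2) (tFun τ) * (1 + 22 * tFun τ + 125 * tFun τ ^ 2) = D at *
  field_simp
  -- Cramer's rule in the plane: `wedge P Θ • W = wedge P W • Θ + wedge W Θ • P`.
  have h2 : e * D * W β = wedge P Θ * (wedge P W * Θ β + wedge W Θ * P β) := by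
    rw [← h, sq, mul_assoc]
    congr 1
    fin_cases β <;> simp [wedge] <;> ring
  linear_combination h2

end

section

open ModularForm (eta)
open Matrix ModularGroup Filter Topology

/-! ### Holomorphic functions of moderate growth -/

/-- The size of a point of the upper half-plane with respect to all cusps. -/
def cuspSize (τ : ℍ) : ℝ := τ.im + 1 / τ.im

lemma two_le_cuspSize (τ : ℍ) : 2 ≤ cuspSize τ := by
  have h := τ.im_pos
  rw [cuspSize, ← sub_nonneg]
  have : τ.im + 1 / τ.im - 2 = (τ.im - 1) ^ 2 / τ.im := by
    field_simp
    ring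
  rw [this]
  positivity

lemma im_le_cuspSize (τ : ℍ) : τ.im ≤ cuspSize τ := by
  have h := τ.im_pos
  rw [cuspSize]
  have : 0 ≤ 1 / τ.im := by positivity
  linarith

lemma inv_im_le_cuspSize (τ : ℍ) : 1 / τ.im ≤ cuspSize τ := by
  have h := τ.im_pos
  rw [cuspSize]
  linarith

/-- The algebra of holomorphic functions of moderate growth. -/
def tame : Subalgebra ℂ (ℍ → ℂ) where
  carrier := {f | f ∈ Hol ∧ ∃ C : ℝ, 0 ≤ C ∧ ∀ τ, ‖f τ‖ ≤ Real.exp (C * cuspSize τ)}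
  mul_mem' := by
    rintro f g ⟨hf, C, hC, hfC⟩ ⟨hg, D, hD, hgD⟩
    refine ⟨mul_mem hf hg, C + D, add_nonneg hC hD, fun τ => ?_⟩
    rw [Pi.mul_apply, norm_mul, add_mul, Real.exp_add]
    exact mul_le_mul (hfC τ) (hgD τ) (norm_nonneg _) (Real.exp_pos _).le
  add_mem' := by
    rintro f g ⟨hf, C, hC, hfC⟩ ⟨hg, D, hD, hgD⟩
    refine ⟨add_mem hf hg, C + D + 1, by positivity, fun τ => ?_⟩
    have h2 := two_le_cuspSize τ
    have h3 : (2 : ℝ) ≤ Real.exp (cuspSize τ) := by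
      have := Real.add_one_le_exp (cuspSize τ)
      linarith
    have hC1 : Real.exp (C * cuspSize τ) ≤ Real.exp ((C + D) * cuspSize τ) := by gcongr; linarith
    have hD1 : Real.exp (D * cuspSize τ) ≤ Real.exp ((C + D) * cuspSize τ) := by gcongr; linarith
    calc ‖(f + g) τ‖ ≤ ‖f τ‖ + ‖g τ‖ := norm_add_le _ _
      _ ≤ Real.exp ((C + D) * cuspSize τ) * 2 := by linarith [hfC τ, hgD τ]
      _ ≤ Real.exp ((C + D) * cuspSize τ) * Real.exp (cuspSize τ) := by gcongr
      _ = Real.exp ((C + D + 1) * cuspSize τ) := by rw [← Real.exp_add]; ring_nf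
  algebraMap_mem' c := by
    refine ⟨Hol.algebraMap_mem c, ‖c‖, norm_nonneg _, fun τ => ?_⟩
    have h2 := two_le_cuspSize τ
    calc ‖c‖ ≤ ‖c‖ * cuspSize τ + 1 := by nlinarith [norm_nonneg c]
      _ ≤ _ := Real.add_one_le_exp _

lemma comp_affine_mem_Hol {φ : ℍ → ℍ} {a b : ℂ} (hφ : ∀ τ, (φ τ : ℂ) = a * τ + b) {f : ℍ → ℂ}
    (hf : f ∈ Hol) : f ∘ φ ∈ Hol := by
  have hf' : DifferentiableOn ℂ (f ∘ ofComplex) {z | 0 < z.im} := mdifferentiable_iff.mp hf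
  refine mdifferentiable_iff.mpr fun z hz => ?_
  have hz' : 0 < (a * z + b).im := by
    have := (φ ⟨z, hz⟩).im_pos
    rwa [← coe_im, hφ] at this
  have h1 := (hf'.differentiableAt (isOpen_upperHalfPlaneSet.mem_nhds hz')).comp z
    (f := fun w : ℂ => a * w + b) (by fun_prop)
  refine (h1.congr_of_eventuallyEq ?_).differentiableWithinAt
  filter_upwards [isOpen_upperHalfPlaneSet.mem_nhds hz] with w hw
  have : (a * w + b) = (φ (ofComplex w) : ℂ) := by
    rw [hφ, ofComplex_apply_of_im_pos hw]
  simp only [Function.comp_apply]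
  rw [this, ofComplex_apply]

lemma inv_mem_Hol {f : ℍ → ℂ} (hf : f ∈ Hol) (h0 : ∀ τ, f τ ≠ 0) : (fun τ => (f τ)⁻¹) ∈ Hol := by
  have hf' : DifferentiableOn ℂ (f ∘ ofComplex) {z | 0 < z.im} := mdifferentiable_iff.mp hf
  exact mdifferentiable_iff.mpr (hf'.inv fun z _ => h0 _)

lemma comp_affine_mem_tame {φ : ℍ → ℍ} {a b : ℂ} (hφ : ∀ τ, (φ τ : ℂ) = a * τ + b) {K : ℝ}
    (hK : 0 ≤ K) (hφ' : ∀ τ, cuspSize (φ τ) ≤ K * cuspSize τ) {f : ℍ → ℂ}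
    (hf : f ∈ tame) : f ∘ φ ∈ tame := by
  obtain ⟨hf, C, hC, h⟩ := hf
  refine ⟨comp_affine_mem_Hol hφ hf, C * K, by positivity, fun τ => (h (φ τ)).trans ?_⟩
  rw [mul_assoc]
  gcongr
  exact hφ' τ

lemma scale_mem_tame (N : ℕ) [NeZero N] {f : ℍ → ℂ} (hf : f ∈ tame) : f ∘ scale N ∈ tame := by
  have hN : (1 : ℝ) ≤ N := by exact_mod_cast NeZero.one_le
  refine comp_affine_mem_tame (a := N) (b := 0) (fun τ => by rw [coe_scale, add_zero])
    (K := N) (by positivity) (fun τ => ?_) hf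
  have him : (scale N τ).im = N * τ.im := by
    rw [← coe_im, coe_scale]
    simp
  have h := τ.im_pos
  rw [cuspSize, cuspSize, him, mul_add]
  gcongr
  rw [mul_one_div]
  gcongr
  nlinarith

lemma node_mem_tame (N : ℕ) [NeZero N] (j : ℤ) {f : ℍ → ℂ} (hf : f ∈ tame) :
    f ∘ node N j ∈ tame := by
  have hN : (1 : ℝ) ≤ N := by exact_mod_cast NeZero.one_le
  refine comp_affine_mem_tame (a := 1 / N) (b := 24 * j / N) (fun τ => by rw [coe_node]; ring)
    (K := N) (by positivity) (fun τ => ?_) hf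
  have him : (node N j τ).im = τ.im / N := by
    rw [← coe_im, coe_node]
    simp
  have h := τ.im_pos
  rw [cuspSize, cuspSize, him, mul_add, mul_one_div]
  rw [one_div_div]
  gcongr
  rw [div_le_iff₀ (by positivity)]
  nlinarith [mul_le_mul hN hN zero_le_one (by positivity)]

/-! ### The eta function has moderate growth -/

/-- `|cτ + d|²` is at least `1` when `c = 0` and at least `y²` when `c ≠ 0`. -/
lemma norm_autFactor_ge (g : SL(2, ℤ)) (τ : ℍ) : (g • τ).im ≤ cuspSize τ := by
  have h := τ.im_pos
  rw [im_smul_eq, ← Complex.normSq_eq_norm_sq]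
  have hn : Complex.normSq (autFactor g τ) = (g 1 0 * τ.re + g 1 1) ^ 2 + (g 1 0 * τ.im) ^ 2 := by
    rw [autFactor, Complex.normSq_apply]
    simp
    ring
  by_cases hc : g 1 0 = 0
  · have hd : g 1 1 ≠ 0 := fun hd => by
      have := g.det_coe
      rw [det_fin_two, hc, hd] at this
      simp at this
    have h1 : (1 : ℝ) ≤ (g 1 1 : ℝ) ^ 2 := by
      exact_mod_cast (one_le_sq_iff_one_le_abs _).mpr (Int.one_le_abs hd)
    refine le_trans ?_ (im_le_cuspSize τ)
    rw [hn, hc]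
    simp only [Int.cast_zero, zero_mul, zero_add, zero_pow two_ne_zero, add_zero]
    exact div_le_self h.le h1
  · have h1 : (1 : ℝ) ≤ (g 1 0 : ℝ) ^ 2 := by
      exact_mod_cast (one_le_sq_iff_one_le_abs _).mpr (Int.one_le_abs hc)
    refine le_trans ?_ (inv_im_le_cuspSize τ)
    rw [hn, div_le_div_iff₀ (by nlinarith [sq_nonneg (g 1 0 * τ.re + g 1 1 : ℝ), mul_pos h h]) h]
    nlinarith [sq_nonneg (g 1 0 * τ.re + g 1 1 : ℝ), mul_pos h h]

/-- Every orbit meets `Im ≥ 1/2`, and moving there raises the imaginary part to at most `cuspSize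
τ`. A bound near one cusp thus controls all cusps. -/
lemma le_exp_of_invariant {Φ : ℍ → ℝ} (hΦ : ∀ (g : SL(2, ℤ)) τ, Φ (g • τ) = Φ τ) {K : ℝ}
    (hK : 0 ≤ K) (h : ∀ w : ℍ, 1 / 2 ≤ w.im → Φ w ≤ Real.exp (K * w.im)) (τ : ℍ) :
    Φ τ ≤ Real.exp (K * cuspSize τ) := by
  obtain ⟨γ, hγ⟩ := exists_one_half_le_im_smul τ
  rw [← hΦ γ τ]
  refine (h _ hγ).trans ?_
  gcongr
  exact norm_autFactor_ge γ τ

lemma norm_eta_pow_mul_im (g : SL(2, ℤ)) (τ : ℍ) :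
    ‖eta (g • τ : ℍ)‖ ^ 4 * (g • τ).im = ‖eta τ‖ ^ 4 * τ.im := by
  obtain ⟨s, U, ε, -, hs2, H⟩ := exists_multiplier g
  have hs : ‖s τ‖ ^ 2 = ‖autFactor g τ‖ := by rw [← hs2, norm_pow]
  have h0 : ‖autFactor g τ‖ ≠ 0 := norm_ne_zero_iff.mpr (autFactor_ne_zero g τ)
  rw [H.eta_smul, norm_mul, norm_mul, H.norm_eq, im_smul_eq, one_mul, mul_pow,
    show ‖s τ‖ ^ 4 = (‖s τ‖ ^ 2) ^ 2 by ring, hs]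
  field_simp

lemma exists_norm_eta_le : ∃ C : ℝ, 0 ≤ C ∧ ∀ w : ℍ, 1 / 2 ≤ w.im → ‖eta w‖ ≤ C := by
  have hz : 0 < (Complex.I / 2).im := by simp
  have hs := (hasSum_eta hz).summable.norm
  refine ⟨∑' n : ℤ, ‖(-1) ^ n * ee (((6 * n - 1) ^ 2 : ℤ) * (Complex.I / 2) / 24)‖,
    tsum_nonneg fun _ => norm_nonneg _, fun w hw => ?_⟩
  rw [← (hasSum_eta w.im_pos).tsum_eq]
  refine (norm_tsum_le_tsum_norm (hasSum_eta w.im_pos).summable.norm).trans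
    ((hasSum_eta w.im_pos).summable.norm.tsum_le_tsum (fun n => ?_) hs)
  rw [norm_mul, norm_mul, norm_ee, norm_ee]
  gcongr ?_ * Real.exp ?_
  have e1 : ∀ z : ℂ, (((6 * n - 1) ^ 2 : ℤ) * z / 24 : ℂ).im = (6 * n - 1 : ℝ) ^ 2 * z.im / 24 := by
    intro z
    have : (((6 * n - 1) ^ 2 : ℤ) * z / 24 : ℂ) = (((6 * n - 1 : ℝ) ^ 2 / 24 : ℝ) : ℂ) * z := by
      push_cast
      ring
    rw [this, Complex.im_ofReal_mul]
    ring
  rw [e1, e1]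
  have hI : (Complex.I / 2).im = 1 / 2 := by simp
  rw [hI]
  have := Real.pi_pos
  have h2 : (6 * n - 1 : ℝ) ^ 2 * (1 / 2) / 24 ≤ (6 * n - 1 : ℝ) ^ 2 * (w : ℂ).im / 24 := by
    gcongr
    exact hw
  nlinarith

lemma exists_norm_eta_inv_le : ∃ C : ℝ, 0 ≤ C ∧ ∀ w : ℍ, 1 / 2 ≤ w.im →
    ‖(eta w)⁻¹‖ ≤ C * Real.exp w.im := by
  -- `r` is `|q|` at height 1/2. The series for `1 / euler q` counts pairs of charge zero, so its
  -- coefficients are nonnegative and its value at `r` bounds it above that height.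
  set r : ℝ := Real.exp (-Real.pi) with hr
  have hpi := Real.pi_pos
  have hr1 : ‖(r : ℂ)‖ < 1 := by
    rw [Complex.norm_real, hr, Real.norm_of_nonneg (Real.exp_pos _).le, Real.exp_lt_one_iff]
    linarith
  have hs := (summable_norm_charge hr1 one_ne_zero).subtype (charge ⁻¹' {0})
  refine ⟨∑' P : charge ⁻¹' {0}, ‖(1 : ℂ) ^ charge (P : _ × _) * (r : ℂ) ^ pairWeight P‖,
    tsum_nonneg fun _ => norm_nonneg _, fun w hw => ?_⟩
  have hq1 := norm_ee_lt_one w.im_pos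
  have hqr : ‖ee w‖ ≤ ‖(r : ℂ)‖ := by
    rw [Complex.norm_real, hr, Real.norm_of_nonneg (Real.exp_pos _).le, norm_ee, coe_im]
    gcongr
    nlinarith
  rw [eta_eq, mul_inv, ← chargeSum_zero hq1 (ee_ne_zero _), norm_mul, mul_comm]
  have hsw := (summable_norm_charge hq1 one_ne_zero).subtype (charge ⁻¹' {0})
  gcongr
  · rw [chargeSum]
    simp only [_root_.one_zpow, one_mul] at hs hsw ⊢
    refine (norm_tsum_le_tsum_norm hsw).trans (hsw.tsum_le_tsum (fun P => ?_) hs)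
    simp only [norm_pow]
    gcongr
  · rw [norm_inv, norm_ee, ← Real.exp_neg]
    gcongr
    have : ((w : ℂ) / 24).im = w.im / 24 := by simp
    rw [this]
    have := Real.pi_lt_four
    have := w.im_pos
    nlinarith

lemma le_exp_of_half_le {C y : ℝ} (hC : 0 ≤ C) (hy : 1 / 2 ≤ y) : C ≤ Real.exp (2 * C * y) := by
  have := Real.add_one_le_exp (2 * C * y)
  nlinarith

lemma norm_le_exp_of_pow_four_le {x : ℂ} {M : ℝ} (h : ‖x‖ ^ 4 ≤ Real.exp M) :
    ‖x‖ ≤ Real.exp (M / 4) := by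
  rw [show M = ((4 : ℕ) : ℝ) * (M / 4) by push_cast; ring, Real.exp_nat_mul] at h
  exact (pow_le_pow_iff_left₀ (norm_nonneg _) (Real.exp_pos _).le four_ne_zero).mp h

lemma eta_mem_tame : (fun τ : ℍ => eta τ) ∈ tame := by
  refine ⟨by simpa using eta_mem 1 one_pos, ?_⟩
  obtain ⟨C, hC, h⟩ := exists_norm_eta_le
  have key := le_exp_of_invariant (Φ := fun τ => ‖eta τ‖ ^ 4 * τ.im) norm_eta_pow_mul_im
    (K := 2 * C ^ 4 + 1) (by positivity) fun w hw => by
      rw [add_mul, Real.exp_add, one_mul]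
      have h1 : ‖eta w‖ ^ 4 ≤ C ^ 4 := by gcongr; exact h w hw
      have h2 := Real.add_one_le_exp w.im
      gcongr
      · exact h1.trans (le_exp_of_half_le (by positivity) hw)
      · linarith
  refine ⟨(2 * C ^ 4 + 2) / 4, by positivity, fun τ => ?_⟩
  have hτ := τ.im_pos
  rw [div_mul_eq_mul_div]
  refine norm_le_exp_of_pow_four_le ?_
  have h1 := key τ
  rw [← le_div_iff₀ hτ] at h1
  refine h1.trans ?_
  rw [show (2 * C ^ 4 + 2) * cuspSize τ = (2 * C ^ 4 + 1) * cuspSize τ + cuspSize τ by ring,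
    Real.exp_add, div_eq_mul_one_div]
  gcongr
  have := Real.add_one_le_exp (cuspSize τ)
  linarith [inv_im_le_cuspSize τ]

lemma eta_inv_mem_tame : (fun τ : ℍ => (eta τ)⁻¹) ∈ tame := by
  refine ⟨inv_mem_Hol eta_mem_tame.1 fun τ => eta_ne_zero' τ.im_pos, ?_⟩
  obtain ⟨C, hC, h⟩ := exists_norm_eta_inv_le
  have key := le_exp_of_invariant (Φ := fun τ => (‖eta τ‖ ^ 4 * τ.im)⁻¹)
    (fun g τ => by rw [norm_eta_pow_mul_im])
    (K := 2 * (C ^ 4 * 2) + 4) (by positivity) fun w hw => by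
      have hw0 := w.im_pos
      rw [add_mul, Real.exp_add, mul_inv, ← inv_pow, ← norm_inv]
      have h1 : ‖(eta w)⁻¹‖ ^ 4 ≤ C ^ 4 * Real.exp (4 * w.im) := by
        calc ‖(eta w)⁻¹‖ ^ 4 ≤ (C * Real.exp w.im) ^ 4 := by gcongr; exact h w hw
          _ = _ := by
            rw [mul_pow, ← Real.exp_nat_mul]
            push_cast
            rfl
      have h2 : w.im⁻¹ ≤ 2 := by
        rw [inv_le_comm₀ hw0 two_pos]
        linarith
      calc ‖(eta w)⁻¹‖ ^ 4 * w.im⁻¹ ≤ C ^ 4 * Real.exp (4 * w.im) * 2 := by gcongr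
        _ = C ^ 4 * 2 * Real.exp (4 * w.im) := by ring
        _ ≤ _ := by
          gcongr
          exact le_exp_of_half_le (by positivity) hw
  refine ⟨(2 * (C ^ 4 * 2) + 5) / 4, by positivity, fun τ => ?_⟩
  have hτ := τ.im_pos
  rw [div_mul_eq_mul_div]
  refine norm_le_exp_of_pow_four_le ?_
  have h1 := key τ
  rw [mul_inv, ← inv_pow, ← norm_inv, ← div_eq_mul_inv, div_le_iff₀ hτ] at h1
  refine h1.trans ?_
  rw [show (2 * (C ^ 4 * 2) + 5) * cuspSize τ = (2 * (C ^ 4 * 2) + 4) * cuspSize τ + cuspSize τ by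
    ring, Real.exp_add]
  gcongr
  have := Real.add_one_le_exp (cuspSize τ)
  linarith [im_le_cuspSize τ]

end

section

open ModularForm (eta)
open Matrix ModularGroup Filter Topology
open scoped ModularForm

/-! ### Functions that are invariant under `Γ₀(5)` -/

/-- Invariance under `Γ₀(5)`. -/
def Invariant (f : ℍ → ℂ) : Prop := ∀ g : SL(2, ℤ), (5 : ℤ) ∣ g 1 0 → ∀ τ, f (g • τ) = f τ

/-- Every element of `SL(2, ℤ)` lies in `Γ₀(5)` or in `Γ₀(5) S Tʲ` for some `j`. -/
lemma exists_eq_smul_S {f : ℍ → ℂ} (hf : Invariant f) (g : SL(2, ℤ)) :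
    (∀ τ, f (g • τ) = f τ) ∨ ∃ j : ℤ, ∀ τ, f (g • τ) = f (S • T ^ j • τ) := by
  by_cases hc : (5 : ℤ) ∣ g 1 0
  · exact Or.inl (hf g hc)
  · right
    have h5 : Prime (5 : ℤ) := by exact_mod_cast Nat.prime_iff_prime_int.mp Nat.prime_five
    have hcop : IsCoprime (g 1 0) 5 := (h5.coprime_iff_not_dvd.mpr hc).symm
    obtain ⟨u, v, huv⟩ := hcop
    -- As `u` inverts `c` modulo 5, the matrix `g T^(-du) S⁻¹` has lower left entry `-d(1 - cu)`,
    -- which is divisible by 5.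
    refine ⟨g 1 1 * u, fun τ => ?_⟩
    have h : g = (g * (T ^ (g 1 1 * u))⁻¹ * S⁻¹) * (S * T ^ (g 1 1 * u)) := by group
    rw [← mul_smul S]
    conv_lhs => rw [h, mul_smul]
    refine hf _ ?_ _
    have hT : ((T ^ (g 1 1 * u))⁻¹ : SL(2, ℤ)) = ⟨!![1, -(g 1 1 * u); 0, 1], by simp⟩ := by
      rw [← _root_.zpow_neg]
      ext i j
      rw [coe_T_zpow]
    have hS : (S⁻¹ : SL(2, ℤ)) = ⟨!![0, 1; -1, 0], by simp⟩ :=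
      inv_eq_of_mul_eq_one_right (by decide)
    rw [hT, hS]
    have h3 : (g * ⟨!![1, -(g 1 1 * u); 0, 1], by simp⟩ * ⟨!![0, 1; -1, 0], by simp⟩ : SL(2, ℤ)) 1 0 =
        -(g 1 0 * -(g 1 1 * u) + g 1 1) := by
      change ((g : Matrix (Fin 2) (Fin 2) ℤ) * !![1, -(g 1 1 * u); 0, 1] * !![0, 1; -1, 0] :
        Matrix (Fin 2) (Fin 2) ℤ) 1 0 = _
      simp [Matrix.mul_apply, Fin.sum_univ_two]
    rw [h3]
    exact ⟨-(g 1 1 * v), by linear_combination g 1 1 * huv⟩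

lemma im_T_zpow_smul (j : ℤ) (τ : ℍ) : (T ^ j • τ).im = τ.im := by
  rw [← coe_im, coe_T_zpow_smul_eq]
  simp

/-- There are two cusps, at infinity and at 0. Bounded at both, `f` is a modular form of weight zero
and hence constant. -/
theorem eq_const_of_invariant {f : ℍ → ℂ} (hf : f ∈ Hol) (hinv : Invariant f)
    (h1 : IsBoundedAtImInfty f) (h2 : IsBoundedAtImInfty fun τ => f (S • τ)) :
    ∃ c, ∀ τ, f τ = c := by
  have hbdd : ∀ g : SL(2, ℤ), IsBoundedAtImInfty fun τ => f (g • τ) := fun g => by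
    rcases exists_eq_smul_S hinv g with h | ⟨j, h⟩
    · simpa only [h] using h1
    · simp only [h]
      rw [isBoundedAtImInfty_iff] at h2 ⊢
      obtain ⟨M, A, hA⟩ := h2
      exact ⟨M, A, fun z hz => hA _ (by rwa [im_T_zpow_smul])⟩
  have hslash : ∀ g : SL(2, ℤ), f ∣[(0 : ℤ)] g = fun τ => f (g • τ) := fun g => by
    ext τ
    rw [ModularForm.SL_slash_apply]
    simp
  let Γ : Subgroup (GL (Fin 2) ℝ) := (CongruenceSubgroup.Gamma0 5 : Subgroup SL(2, ℤ))
  let F : ModularForm Γ 0 :=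
    { toFun := f
      slash_action_eq' := by
        rintro _ ⟨g, hg, rfl⟩
        refine (hslash g).trans (funext fun τ => hinv g ?_ τ)
        rw [SetLike.mem_coe, CongruenceSubgroup.Gamma0_mem] at hg
        exact (ZMod.intCast_zmod_eq_zero_iff_dvd _ 5).mp hg
      holo' := hf
      bdd_at_cusps' := fun {c} hc => by
        rw [Subgroup.IsArithmetic.isCusp_iff_isCusp_SL2Z, isCusp_SL2Z_iff'] at hc
        obtain ⟨g, rfl⟩ := hc
        rw [OnePoint.isBoundedAt_iff rfl]
        exact (hslash g).symm ▸ hbdd g }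
  obtain ⟨c, hc⟩ := ModularForm.eq_const_of_weight_zero F
  exact ⟨c, fun τ => congrFun hc τ⟩

/-! ### The Hauptmodul -/

lemma t_mem_tame : (fun τ : ℍ => tFun τ) ∈ tame := by
  have h5 := scale_mem_tame 5 eta_mem_tame
  have h : (fun τ : ℍ => tFun τ) =
      ((fun τ : ℍ => eta τ) ∘ scale 5) ^ 6 * (fun τ : ℍ => (eta τ)⁻¹) ^ 6 := by
    ext τ
    simp [tFun, coe_scale, div_eq_mul_inv]
  rw [h]
  exact mul_mem (pow_mem h5 6) (pow_mem eta_inv_mem_tame 6)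

lemma t_invariant : Invariant fun τ => tFun τ := fun g hg τ => by
  obtain ⟨s, U, κ, H⟩ := exists_vectorTransform hg
  exact H.tFun_smul τ

/-- At the cusp 0 the function `t` has a simple pole in the local parameter `q^(1/5)`, with leading
coefficient 1/125. -/
lemma tFun_inv {z : ℂ} (hz : 0 < z.im) : tFun (-1 / z) * ee (z / 5) =
    1 / 125 * (euler (ee (z / 5)) ^ 6 / euler (ee z) ^ 6) := by
  have hz0 : z ≠ 0 := by rintro rfl; simp at hz
  have hz5 : 0 < (z / 5).im := by simpa using div_pos hz (show (0 : ℝ) < 5 by norm_num)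
  have h1 := eta_inv hz
  have h5 := eta_inv hz5
  have hs1 := csqrt_sq z
  have hs5 := csqrt_sq (z / 5)
  have hI := csqrt_ne_zero Complex.I_ne_zero
  have hn := csqrt_ne_zero hz0
  have e1 := eta_ne_zero' hz
  rw [tFun, show 5 * (-1 / z) = -1 / (z / 5) by field_simp, h1, h5]
  have key : ((Complex.sqrt Complex.I)⁻¹ * (Complex.sqrt (z / 5) * eta (z / 5))) ^ 6 /
      ((Complex.sqrt Complex.I)⁻¹ * (Complex.sqrt z * eta z)) ^ 6 =
      (1 / 125) * (eta (z / 5) ^ 6 / eta z ^ 6) := by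
    have h6 : Complex.sqrt (z / 5) ^ 6 = (1 / 125) * Complex.sqrt z ^ 6 := by
      rw [show Complex.sqrt (z / 5) ^ 6 = (Complex.sqrt (z / 5) ^ 2) ^ 3 by ring,
        show Complex.sqrt z ^ 6 = (Complex.sqrt z ^ 2) ^ 3 by ring, hs1, hs5]
      ring
    rw [mul_pow, mul_pow, mul_pow, mul_pow, h6]
    field_simp
  rw [key, eta_eq, eta_eq z, mul_assoc]
  congr 1
  have hq : ee (z / 24) ^ 6 = ee (z / 5 / 24) ^ 6 * ee (z / 5) := by
    rw [← ee_nsmul, ← ee_nsmul, ← ee_add]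
    congr 1
    push_cast
    ring
  rw [mul_pow, mul_pow, hq]
  have n1 := ee_ne_zero (z / 5 / 24)
  have n2 := ee_ne_zero (z / 5)
  have n3 := euler_ne_zero (norm_ee_lt_one hz)
  generalize ee (z / 5 / 24) = a at *
  field_simp

lemma tendsto_tFun_inv :
    Tendsto (fun z => tFun (-1 / z) * ee (z / 5)) infinityFilter (𝓝 (1 / 125)) := by
  have h5 : Tendsto (fun z : ℂ => ee (z / 5)) infinityFilter (𝓝 0) := by
    refine tendsto_ee.comp ?_
    rw [tendsto_comap_iff]
    have h : Complex.im ∘ (fun z : ℂ => z / 5) = fun z => z.im / 5 := by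
      ext z
      simp
    rw [h]
    exact tendsto_comap.atTop_div_const (by norm_num)
  have h := (((tendsto_euler.comp h5).pow 6).div
    ((tendsto_euler.comp tendsto_ee).pow 6) (by norm_num)).const_mul (1 / 125)
  norm_num at h
  refine h.congr' ?_
  filter_upwards [eventually_im_pos] with z hz
  rw [tFun_inv hz]

lemma tendsto_atImInfty_of_tendsto {f : ℂ → ℂ} {l : Filter ℂ} (h : Tendsto f infinityFilter l) :
    Tendsto (fun τ : ℍ => f τ) atImInfty l :=
  h.comp tendsto_coe_atImInfty

/-- The local parameter at the cusp `0`. -/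
def qFive (τ : ℍ) : ℂ := ee (τ / 5)

lemma qFive_mem_Hol : qFive ∈ Hol := by
  refine mdifferentiable_iff.mpr fun z hz => ?_
  have h1 : DifferentiableAt ℂ (fun w : ℂ => ee (w / 5)) z := by
    unfold ee
    fun_prop
  refine (h1.congr_of_eventuallyEq ?_).differentiableWithinAt
  filter_upwards [isOpen_upperHalfPlaneSet.mem_nhds hz] with w hw
  simp [qFive, ofComplex_apply_of_im_pos hw]

lemma qFive_vadd (τ : ℍ) : qFive ((5 : ℝ) +ᵥ τ) = qFive τ := by
  rw [qFive, qFive, coe_vadd]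
  push_cast
  rw [add_div, ee_add]
  have := ee_int 1
  norm_num at this ⊢
  rw [this, one_mul]

lemma norm_qFive (τ : ℍ) : ‖qFive τ‖ = Real.exp (-2 * Real.pi * τ.im / 5) := by
  rw [qFive, norm_ee]
  congr 1
  simp
  ring

lemma coe_S_smul (τ : ℍ) : ((S • τ : ℍ) : ℂ) = -1 / τ := by
  rw [modular_S_smul]
  simp [neg_div, inv_neg]

lemma Invariant.periodic {f : ℍ → ℂ} (hf : Invariant f) (τ : ℍ) :
    f (S • ((5 : ℝ) +ᵥ τ)) = f (S • τ) := by
  let g : SL(2, ℤ) := ⟨!![1, 0; -5, 1], by simp⟩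
  have hg : S * T ^ (5 : ℤ) = g * S := by
    have : T ^ (5 : ℤ) = ⟨!![1, 5; 0, 1], by simp⟩ := by
      ext i j
      rw [coe_T_zpow]
    rw [this]
    decide
  have h5 : (5 : ℝ) +ᵥ τ = T ^ (5 : ℤ) • τ := by
    ext
    rw [coe_T_zpow_smul_eq, coe_vadd]
    push_cast
    ring
  rw [h5, ← mul_smul, hg, mul_smul]
  exact hf g ⟨-1, rfl⟩ _

/-- A bounded periodic holomorphic function has a limit at infinity, which it approaches
exponentially fast. -/
lemma exists_limit_of_periodic {h : ℍ → ℂ} (hh : h ∈ Hol) (hp : ∀ τ, h ((5 : ℝ) +ᵥ τ) = h τ)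
    (hb : IsBoundedAtImInfty h) :
    ∃ c, Tendsto h atImInfty (𝓝 c) ∧ (fun τ => h τ - c) =O[atImInfty] qFive := by
  have h5 : (0 : ℝ) < 5 := by norm_num
  have hper : Function.Periodic (h ∘ ofComplex) ((5 : ℝ) : ℂ) := fun z => by
    by_cases hz : 0 < z.im
    · have hz' : 0 < (z + (5 : ℝ)).im := by simpa using hz
      simp only [Function.comp_apply]
      rw [ofComplex_apply_of_im_pos hz, ofComplex_apply_of_im_pos hz', ← hp ⟨z, hz⟩]
      congr 1
      ext
      rw [coe_vadd]
      exact add_comm _ _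
    · have hz' : ¬ 0 < (z + (5 : ℝ)).im := by simpa using hz
      simp only [Function.comp_apply]
      rw [ofComplex_apply_of_im_nonpos (not_lt.mp hz), ofComplex_apply_of_im_nonpos (not_lt.mp hz')]
  have hbd : BoundedAtFilter infinityFilter (h ∘ ofComplex) := by
    have := hb.comp_tendsto tendsto_comap_im_ofComplex
    exact this
  have hol : ∀ᶠ z in infinityFilter, DifferentiableAt ℂ (h ∘ ofComplex) z := by
    filter_upwards [eventually_im_pos] with z hz
    exact (UpperHalfPlane.mdifferentiable_iff.mp hh).differentiableAt (isOpen_upperHalfPlaneSet.mem_nhds hz)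
  have hcoe : ∀ τ : ℍ, (h ∘ ofComplex) τ = h τ := fun τ => by simp
  refine ⟨Function.Periodic.cuspFunction 5 (h ∘ ofComplex) 0, ?_, ?_⟩
  · have := tendsto_atImInfty_of_tendsto (Function.Periodic.tendsto_at_I_inf h5 hper hol hbd)
    exact this.congr hcoe
  · have := (Function.Periodic.exp_decay_sub_of_bounded_at_inf h5 hper hol hbd).comp_tendsto
      tendsto_coe_atImInfty
    refine (this.congr_left fun τ => ?_).trans (Asymptotics.isBigO_of_le _ fun τ => ?_)
    · simp
    · rw [norm_qFive]
      simp

lemma S_smul_mem_Hol {f : ℍ → ℂ} (hf : f ∈ Hol) : (fun τ => f (S • τ)) ∈ Hol := comp_mem S hf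

/-- Functions with a pole of bounded order at the cusp `0` only are polynomials in `t`. -/
theorem exists_polynomial_of_bounded (n : ℕ) : ∀ {f : ℍ → ℂ}, f ∈ Hol → Invariant f →
    IsBoundedAtImInfty f → (IsBoundedAtImInfty fun τ => f (S • τ) * qFive τ ^ n) →
    ∃ P : Polynomial ℂ, ∀ τ : ℍ, f τ = P.eval (tFun τ) := by
  induction n with
  | zero =>
    intro f hf hinv h1 h2
    obtain ⟨c, hc⟩ := eq_const_of_invariant hf hinv h1 (by simpa using h2)
    exact ⟨Polynomial.C c, fun τ => by rw [hc, Polynomial.eval_C]⟩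
  | succ n ih =>
    intro f hf hinv h1 h2
    have hfS := mul_mem (S_smul_mem_Hol hf) (pow_mem qFive_mem_Hol (n + 1))
    obtain ⟨c, hc, -⟩ := exists_limit_of_periodic hfS
      (fun τ => by simp only [Pi.mul_apply, Pi.pow_apply, hinv.periodic, qFive_vadd]) h2
    have ht := tendsto_atImInfty_of_tendsto tendsto_tFun
    have htS : Tendsto (fun τ : ℍ => tFun (S • τ : ℍ) * qFive τ) atImInfty (𝓝 (1 / 125)) := by
      refine (tendsto_atImInfty_of_tendsto tendsto_tFun_inv).congr fun τ => ?_
      rw [coe_S_smul, qFive]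
    -- Chosen so that subtracting `d t^(n+1)` cancels the leading term at the cusp 0; the 125
    -- offsets the leading coefficient 1/125 of `t`.
    set d : ℂ := c * 125 ^ (n + 1) with hd
    set f' : ℍ → ℂ := f - d • (fun τ : ℍ => tFun τ) ^ (n + 1) with hf'
    have hf'Hol : f' ∈ Hol := sub_mem hf (Subalgebra.smul_mem _ (pow_mem t_mem_tame.1 _) _)
    have hinv' : Invariant f' := fun g hg τ => by
      simp only [hf', Pi.sub_apply, Pi.smul_apply, Pi.pow_apply, hinv g hg τ, t_invariant g hg τ]
    have hlim : Tendsto (fun τ => f' (S • τ) * qFive τ ^ (n + 1)) atImInfty (𝓝 0) := by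
      have h := hc.sub ((htS.pow (n + 1)).const_mul d)
      have h0 : c - d * (1 / 125) ^ (n + 1) = 0 := by
        rw [hd, one_div, inv_pow]
        field_simp
        simp
      rw [h0] at h
      refine h.congr fun τ => ?_
      simp only [hf', Pi.mul_apply, Pi.sub_apply, Pi.smul_apply, Pi.pow_apply, smul_eq_mul]
      ring
    obtain ⟨P, hP⟩ := ih hf'Hol hinv' (by
        have : IsBoundedAtImInfty fun τ : ℍ => d * tFun τ ^ (n + 1) :=
          ((ht.pow (n + 1)).const_mul d).isBigO_one ℝ
        have h3 := h1.sub this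
        exact h3) (by
        -- A limit equal to zero is approached at the rate of `qFive`, so one power of it can be
        -- cancelled and the pole order drops by one.
        obtain ⟨c', hc', hO⟩ := exists_limit_of_periodic
          (mul_mem (S_smul_mem_Hol hf'Hol) (pow_mem qFive_mem_Hol (n + 1)))
          (fun τ => by simp only [Pi.mul_apply, Pi.pow_apply, hinv'.periodic, qFive_vadd])
          (hlim.isBigO_one ℝ)
        have hc0 : c' = 0 := tendsto_nhds_unique hc' hlim
        rw [hc0] at hO
        obtain ⟨M, hM⟩ := hO.bound
        refine Asymptotics.IsBigO.of_bound M ?_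
        filter_upwards [hM] with τ hτ
        have hq : 0 < ‖qFive τ‖ := norm_pos_iff.mpr (ee_ne_zero _)
        simp only [Pi.mul_apply, Pi.pow_apply, sub_zero] at hτ
        rw [pow_succ, ← mul_assoc, norm_mul] at hτ
        simpa using le_of_mul_le_mul_right hτ hq)
    refine ⟨P + Polynomial.C d * Polynomial.X ^ (n + 1), fun τ => ?_⟩
    rw [Polynomial.eval_add, ← hP]
    simp [hf']

/-- An invariant function of moderate growth is a Laurent polynomial in `t`. -/
theorem exists_polynomial_of_tame {f : ℍ → ℂ} (hf : f ∈ tame) (hinv : Invariant f) :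
    ∃ (m : ℕ) (P : Polynomial ℂ), ∀ τ : ℍ, f τ * tFun τ ^ m = P.eval (tFun τ) := by
  have hpi := Real.pi_gt_three
  obtain ⟨m, hm⟩ : ∃ m : ℕ, IsBoundedAtImInfty fun τ : ℍ => f τ * tFun τ ^ m := by
    obtain ⟨C, hC, hfC⟩ := hf.2
    obtain ⟨m, hm⟩ := exists_nat_ge (2 * C)
    refine ⟨m, Asymptotics.IsBigO.of_bound 1 ?_⟩
    have h2 := tendsto_atImInfty_of_tendsto tendsto_tFun_div
    have h3 : ∀ᶠ τ : ℍ in atImInfty, ‖tFun τ / ee τ‖ < 2 :=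
      h2.norm.eventually (gt_mem_nhds (by norm_num))
    have h4 : ∀ᶠ τ : ℍ in atImInfty, 1 ≤ τ.im :=
      (atImInfty_mem _).mpr ⟨1, fun z hz => hz⟩
    filter_upwards [h3, h4] with τ h3 h4
    have ht : ‖tFun τ‖ ≤ Real.exp (-τ.im) := by
      rw [norm_div, div_lt_iff₀ (norm_pos_iff.mpr (ee_ne_zero _)), norm_ee, coe_im] at h3
      have e2 : (2 : ℝ) ≤ Real.exp τ.im := by linarith [Real.add_one_le_exp τ.im]
      calc ‖tFun τ‖ ≤ Real.exp τ.im * Real.exp (-2 * Real.pi * τ.im) := by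
            refine h3.le.trans ?_
            gcongr
        _ = Real.exp (τ.im + -2 * Real.pi * τ.im) := (Real.exp_add _ _).symm
        _ ≤ _ := by
          gcongr
          nlinarith
    have hcs : cuspSize τ ≤ 2 * τ.im := by
      have : 1 / τ.im ≤ 1 := by
        rw [div_le_one τ.im_pos]
        exact h4
      rw [cuspSize]
      linarith
    rw [norm_mul, norm_pow]
    calc ‖f τ‖ * ‖tFun τ‖ ^ m ≤ Real.exp (C * cuspSize τ) * Real.exp (-τ.im) ^ m := by
          gcongr
          exact hfC τ
      _ = Real.exp (C * cuspSize τ + m * -τ.im) := by rw [← Real.exp_nat_mul, ← Real.exp_add]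
      _ ≤ 1 * ‖(1 : ℍ → ℝ) τ‖ := by
          simp only [Pi.one_apply, norm_one, mul_one]
          rw [Real.exp_le_one_iff]
          nlinarith [τ.im_pos]
  set f' : ℍ → ℂ := f * (fun τ : ℍ => tFun τ) ^ m with hf'
  have hf't : f' ∈ tame := mul_mem hf (pow_mem t_mem_tame m)
  have hinv' : Invariant f' := fun g hg τ => by
    simp only [hf', Pi.mul_apply, Pi.pow_apply, hinv g hg τ, t_invariant g hg τ]
  obtain ⟨C, hC, hfC⟩ := hf't.2
  obtain ⟨n, hn⟩ := exists_nat_ge (27 * C)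
  have hbd : IsBoundedAtImInfty fun τ => f' (S • τ) * qFive τ ^ n := by
    refine isBoundedAtImInfty_iff.mpr ⟨1, 1, fun τ hτ => ?_⟩
    have hk : ∀ (k : ℕ) (w : ℍ), f' (S • ((5 * k : ℝ) +ᵥ w)) = f' (S • w) := fun k w => by
      induction k with
      | zero => simp
      | succ k ih =>
        rw [show (5 * ((k + 1 : ℕ) : ℝ)) = 5 + 5 * k by push_cast; ring, ← vadd_vadd,
          hinv'.periodic, ih]
    -- Periodicity brings the real part into `|Re| ≤ 5`. Only then is `Im (S • w)` bounded below in
    -- terms of `Im w`, which gives `cuspSize (S • w) ≤ 27 Im w`.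
    have hsh : ∃ w : ℍ, w.im = τ.im ∧ |w.re| ≤ 5 ∧ f' (S • w) = f' (S • τ) := by
      have h1 := Int.floor_le (τ.re / 5)
      have h2 := Int.lt_floor_add_one (τ.re / 5)
      set k := ⌊τ.re / 5⌋ with hkdef
      refine ⟨(-(5 * k) : ℝ) +ᵥ τ, by simp, ?_, ?_⟩
      · rw [vadd_re, abs_le]
        constructor <;> linarith
      · rcases Int.eq_nat_or_neg k with ⟨l, hl | hl⟩
        · rw [← hk l, vadd_vadd, hl]
          simp
        · rw [hl, ← hk l τ]
          simp
    obtain ⟨w, hw, hre, hfw⟩ := hsh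
    have hw1 : 1 ≤ w.im := hw ▸ hτ
    have hcs : cuspSize (S • w) ≤ 27 * w.im := by
      have him : (S • w).im = w.im / (w.re ^ 2 + w.im ^ 2) := by
        rw [im_smul_eq, ← Complex.normSq_eq_norm_sq, autFactor, Complex.normSq_apply]
        simp [S]
        ring
      have hpos : 0 < w.re ^ 2 + w.im ^ 2 := by positivity
      have hre2 : w.re ^ 2 ≤ 25 := by nlinarith [abs_le.mp hre]
      rw [cuspSize, him, one_div_div]
      have e1 : w.im / (w.re ^ 2 + w.im ^ 2) ≤ 1 := by
        rw [div_le_one hpos]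
        nlinarith [sq_nonneg w.re]
      have e2 : (w.re ^ 2 + w.im ^ 2) / w.im ≤ 26 * w.im := by
        rw [div_le_iff₀ w.im_pos]
        nlinarith
      linarith
    rw [norm_mul, norm_pow, norm_qFive, ← hfw, ← hw]
    calc ‖f' (S • w)‖ * Real.exp (-2 * Real.pi * w.im / 5) ^ n
        ≤ Real.exp (C * cuspSize (S • w)) * Real.exp (-2 * Real.pi * w.im / 5) ^ n := by
          gcongr
          exact hfC _
      _ = Real.exp (C * cuspSize (S • w) + n * (-2 * Real.pi * w.im / 5)) := by
          rw [← Real.exp_nat_mul, ← Real.exp_add]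
      _ ≤ 1 := by
          rw [Real.exp_le_one_iff]
          have e1 : C * cuspSize (S • w) ≤ n * w.im := by
            calc C * cuspSize (S • w) ≤ C * (27 * w.im) := by gcongr
              _ = 27 * C * w.im := by ring
              _ ≤ n * w.im := by
                gcongr
          have e2 : (n : ℝ) * w.im ≤ n * (2 * Real.pi * w.im / 5) := by
            gcongr
            nlinarith
          have e3 : (n : ℝ) * (-2 * Real.pi * w.im / 5) = -(n * (2 * Real.pi * w.im / 5)) := by ring
          linarith
  obtain ⟨P, hP⟩ := exists_polynomial_of_bounded n hf't.1 hinv' hm hbd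
  exact ⟨m, P, fun τ => hP τ⟩

end

section

open ModularForm (eta)
open Matrix ModularGroup Filter Topology

/-! ### The coefficient functions are Laurent polynomials in `t` -/

/-- Vector-valued holomorphic functions of moderate growth. -/
def VecTame (v : ℍ → Fin 2 → ℂ) : Prop := ∀ β, (fun τ => v τ β) ∈ tame

lemma eta_scale_mem_tame (N : ℕ) [NeZero N] : (fun τ : ℍ => eta (N * τ)) ∈ tame := by
  have h := scale_mem_tame N eta_mem_tame
  have : (fun τ : ℍ => eta (N * τ)) = (fun τ : ℍ => eta τ) ∘ scale N := by
    ext τ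
    simp [coe_scale]
  rwa [this]

lemma eta_scale_inv_mem_tame (N : ℕ) [NeZero N] : (fun τ : ℍ => (eta (N * τ))⁻¹) ∈ tame := by
  have h := scale_mem_tame N eta_inv_mem_tame
  have : (fun τ : ℍ => (eta (N * τ))⁻¹) = (fun τ : ℍ => (eta τ)⁻¹) ∘ scale N := by
    ext τ
    simp [coe_scale]
  rwa [this]

lemma vecTame_theta : VecTame fun τ => theta τ := fun β => by
  fin_cases β
  · have h : (fun τ : ℍ => theta τ 0) =
        (2 : ℂ) • ((fun τ : ℍ => eta ((4 : ℕ) * τ)) ^ 2 * fun τ : ℍ => (eta ((2 : ℕ) * τ))⁻¹) := by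
      ext τ
      simp [theta, thB_eq τ.im_pos]
      ring
    change (fun τ : ℍ => theta τ 0) ∈ tame
    rw [h]
    exact Subalgebra.smul_mem _ (mul_mem (pow_mem (eta_scale_mem_tame 4) 2)
      (eta_scale_inv_mem_tame 2)) _
  · have h : (fun τ : ℍ => theta τ 1) = (fun τ : ℍ => eta ((2 : ℕ) * τ)) ^ 5 *
        ((fun τ : ℍ => (eta τ)⁻¹) ^ 2 * (fun τ : ℍ => (eta ((4 : ℕ) * τ))⁻¹) ^ 2) := by
      ext τ
      simp [theta, thA_eq τ.im_pos]
      ring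
    change (fun τ : ℍ => theta τ 1) ∈ tame
    rw [h]
    exact mul_mem (pow_mem (eta_scale_mem_tame 2) 5) (mul_mem (pow_mem eta_inv_mem_tame 2)
      (pow_mem (eta_scale_inv_mem_tame 4) 2))

lemma VecTame.scale {v : ℍ → Fin 2 → ℂ} (hv : VecTame v) (N : ℕ) [NeZero N] :
    VecTame fun τ => v (scale N τ) := fun β => scale_mem_tame N (hv β)

lemma VecTame.smul {f : ℍ → ℂ} {v : ℍ → Fin 2 → ℂ} (hf : f ∈ tame) (hv : VecTame v) :
    VecTame fun τ => f τ • v τ := fun β => mul_mem hf (hv β)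

lemma VecTame.sexticGrad {v : ℍ → Fin 2 → ℂ} (hv : VecTame v) :
    VecTame fun τ => sexticGrad (v τ) := fun β => by
  have h0 := hv 0
  have h1 := hv 1
  fin_cases β
  · exact sub_mem (pow_mem h0 5)
      (mul_mem (mul_mem (Subalgebra.algebraMap_mem tame 5) (pow_mem h1 4)) h0)
  · exact sub_mem (pow_mem h1 5)
      (mul_mem (mul_mem (Subalgebra.algebraMap_mem tame 5) h1) (pow_mem h0 4))

lemma VecTame.wedge {v w : ℍ → Fin 2 → ℂ} (hv : VecTame v) (hw : VecTame w) :
    (fun τ => wedge (v τ) (w τ)) ∈ tame :=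
  sub_mem (mul_mem (hv 1) (hw 0)) (mul_mem (hv 0) (hw 1))

lemma vecTame_theta_scale (N : ℕ) [NeZero N] : VecTame fun τ => theta (scale N τ) :=
  vecTame_theta.scale N

lemma vecTame_grad (a : ℕ) : VecTame fun τ => grad a τ := by
  have e5 := eta_scale_mem_tame 5
  have e5' := eta_scale_inv_mem_tame 5
  push_cast at e5 e5'
  by_cases ha : a = 0
  · have h := VecTame.smul (mul_mem eta_mem_tame (pow_mem e5' 5)) (vecTame_theta_scale 5).sexticGrad
    intro β
    convert h β using 2 with τ
    simp [grad, ha, gradEven, coe_scale, div_eq_mul_inv]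
  · have h := VecTame.smul (mul_mem e5 (pow_mem eta_inv_mem_tame 5)) vecTame_theta.sexticGrad
    intro β
    convert h β using 2 with τ
    simp [grad, ha, gradOdd, div_eq_mul_inv]

lemma vecTame_thetaSum (α : ℕ) : VecTame (thetaSum α) := fun β => by
  have h : (fun τ => thetaSum α τ β) = ∑ j : ZMod (5 ^ α),
      (((fun τ : ℍ => eta τ) ∘ scale (5 ^ (α % 2))) *
        ((fun τ : ℍ => (eta τ)⁻¹) ∘ node (5 ^ α) j.val)) ^ 2 *
        ((fun τ : ℍ => theta τ β) ∘ node (5 ^ α) j.val) := by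
    ext τ
    simp [thetaSum, Finset.sum_apply, div_eq_mul_inv]
  rw [h]
  exact sum_mem fun j _ => mul_mem (pow_mem (mul_mem (scale_mem_tame _ eta_mem_tame)
    (node_mem_tame _ _ eta_inv_mem_tame)) 2) (node_mem_tame _ _ (vecTame_theta β))

lemma div_eta_mem_tame {f : ℍ → ℂ} (hf : f ∈ tame) :
    (fun τ : ℍ => f τ / (eta τ * eta (5 * τ)) ^ 2) ∈ tame := by
  have e5' := eta_scale_inv_mem_tame 5
  push_cast at e5'
  have h : (fun τ : ℍ => f τ / (eta τ * eta (5 * τ)) ^ 2) =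
      f * ((fun τ : ℍ => (eta τ)⁻¹) * fun τ : ℍ => (eta (5 * τ))⁻¹) ^ 2 := by
    ext τ
    change _ = f τ * ((eta τ)⁻¹ * (eta (5 * τ))⁻¹) ^ 2
    rw [← mul_inv, inv_pow, div_eq_mul_inv]
  rw [h]
  exact mul_mem hf (pow_mem (mul_mem eta_inv_mem_tame e5') 2)

lemma coeffTheta_mem_tame (α : ℕ) : coeffTheta α ∈ tame :=
  div_eta_mem_tame (mul_mem ((vecTame_grad _).wedge (vecTame_thetaSum α))
    ((vecTame_grad _).wedge (vecTame_theta_scale _)))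

lemma coeffGrad_mem_tame (α : ℕ) : coeffGrad α ∈ tame :=
  div_eta_mem_tame (mul_mem ((vecTame_thetaSum α).wedge (vecTame_theta_scale _))
    ((vecTame_grad _).wedge (vecTame_theta_scale _)))

open Polynomial in
/-- `L_α^{(β)}` is an affine function of the module generator over the rational functions in `t`,
with coefficients that do not depend on `β`. -/
theorem exists_polynomials (α : ℕ) {a : Fin 2} (ha : (a : ℕ) = α % 2) :
    ∃ D F G : ℂ[X], D ≠ 0 ∧ ∀ (β : Fin 2) (τ : ℍ), D.eval (tFun τ) * thetaRatio β α τ =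
      F.eval (tFun τ) + G.eval (tFun τ) * pFun β a τ := by
  obtain ⟨m, P, hP⟩ := exists_polynomial_of_tame (coeffTheta_mem_tame α)
    fun g hg τ => (coeff_smul α hg τ).1
  obtain ⟨n, Q, hQ⟩ := exists_polynomial_of_tame (coeffGrad_mem_tame α)
    fun g hg τ => (coeff_smul α hg τ).2
  have hdisc : (1 + 22 * X + 125 * X ^ 2 : ℂ[X]) ≠ 0 := fun h => by
    have := congrArg (Polynomial.eval 0) h
    simp at this
  have h4 : (4 : ℂ[X]) ≠ 0 := by norm_num
  have h100 : (100 : ℂ[X]) ≠ 0 := by norm_num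
  have hX : (X : ℂ[X]) ^ (m + n + 1) ≠ 0 := pow_ne_zero _ X_ne_zero
  obtain rfl | rfl : a = 0 ∨ a = 1 := by omega
  -- With `r` the quotient of `grad` and `theta`, the affine relation reads `t r = 1 + 64t + 625t² -
  -- p` here and `t r = 6t - 5p` for `a = 1`. The powers of `X` clear the poles of both coefficient
  -- functions, and `X²` clears the discriminant factor `4/t²`.
  · refine ⟨4 * (1 + 22 * X + 125 * X ^ 2) * X ^ (m + n + 1),
      X ^ 2 * (P * X ^ (n + 1) + Q * X ^ m * (1 + 64 * X + 625 * X ^ 2)), -(X ^ 2 * Q * X ^ m),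
      mul_ne_zero (mul_ne_zero h4 hdisc) hX, fun β τ => ?_⟩
    have h := disc_mul_thetaRatio α β τ
    have hp := pFun_eq β 0 τ
    rw [← ha] at h
    have ht := tFun_ne_zero τ.im_pos
    simp only [eval_mul, eval_add, eval_pow, eval_X, eval_neg, eval_one, eval_ofNat, ← hP, ← hQ]
    simp only [Fin.val_zero, discFactor, if_true] at h hp
    rw [hp]
    generalize grad 0 τ β / theta (scale (5 ^ 0) τ) β = r at *
    generalize tFun τ = t at *
    have h' : 4 * (1 + 22 * t + 125 * t ^ 2) * thetaRatio β α τ =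
        t ^ 2 * (coeffTheta α τ + coeffGrad α τ * r) := by
      rw [← h]
      field_simp
    linear_combination t ^ (m + n + 1) * h'
  · refine ⟨100 * (1 + 22 * X + 125 * X ^ 2) * X ^ (m + n + 1),
      P * X ^ (n + 1) + Q * X ^ m * (6 * X), -(5 * Q * X ^ m),
      mul_ne_zero (mul_ne_zero h100 hdisc) hX, fun β τ => ?_⟩
    have h := disc_mul_thetaRatio α β τ
    have hp := pFun_eq β 1 τ
    rw [← ha] at h
    have ht := tFun_ne_zero τ.im_pos
    simp only [eval_mul, eval_add, eval_pow, eval_X, eval_neg, eval_one, eval_ofNat, ← hP, ← hQ]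
    simp only [Fin.val_one, discFactor, one_ne_zero, if_false] at h hp
    rw [hp]
    generalize grad 1 τ β / theta (scale (5 ^ 1) τ) β = r at *
    generalize tFun τ = t at *
    linear_combination t ^ (m + n + 1) * h

end

section

open ModularForm (eta)
open Matrix ModularGroup Filter Topology

/-! ### The generating functions -/

/-- The entries of a given colour. -/
def colour (c : Fin 2) : ℕ ↪ ℕ × Fin 2 := ⟨fun n => (n, c), fun _ _ h => by simpa using h⟩

lemma colour_apply (c : Fin 2) (n : ℕ) : colour c n = (n, c) := rfl

/-- Splitting the entries of a row by colour. -/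
def rowEquiv : Row 2 ≃ Finset ℕ × Finset ℕ where
  toFun S := (S.preimage (colour 0) (colour 0).injective.injOn,
    S.preimage (colour 1) (colour 1).injective.injOn)
  invFun P := P.1.map (colour 0) ∪ P.2.map (colour 1)
  left_inv S := by
    ext ⟨n, c⟩
    fin_cases c <;> simp [colour_apply]
  right_inv P := by
    refine Prod.ext (Finset.ext fun n => ?_) (Finset.ext fun n => ?_) <;>
    · rw [Finset.mem_preimage]
      simp [colour_apply]

lemma sum_rowEquiv_symm (P : Finset ℕ × Finset ℕ) (f : ℕ → ℕ) :
    ∑ a ∈ rowEquiv.symm P, f (a : ℕ × Fin 2).1 = ∑ a ∈ P.1, f a + ∑ a ∈ P.2, f a := by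
  have hdisj : Disjoint (P.1.map (colour 0)) (P.2.map (colour 1)) := by
    rw [Finset.disjoint_left]
    simp [colour_apply]
  change ∑ a ∈ _ ∪ _, f (a : ℕ × Fin 2).1 = _
  rw [Finset.sum_union hdisj, Finset.sum_map, Finset.sum_map]
  rfl

/-- Splitting an array by colour. -/
def arrayEquiv : Row 2 × Row 2 ≃ (Finset ℕ × Finset ℕ) × (Finset ℕ × Finset ℕ) :=
  (rowEquiv.prodCongr rowEquiv).trans (Equiv.prodProdProdComm _ _ _ _)

lemma weight_arrayEquiv_symm (P : (Finset ℕ × Finset ℕ) × (Finset ℕ × Finset ℕ)) :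
    weight (arrayEquiv.symm P) = pairWeight P.1 + pairWeight P.2 := by
  have h1 := sum_rowEquiv_symm (P.1.1, P.2.1) fun _ => 1
  have h2 := sum_rowEquiv_symm (P.1.1, P.2.1) id
  have h3 := sum_rowEquiv_symm (P.1.2, P.2.2) id
  simp only [Finset.sum_const, smul_eq_mul, mul_one, id] at h1 h2 h3
  change (rowEquiv.symm (P.1.1, P.2.1)).card + ∑ a ∈ rowEquiv.symm (P.1.1, P.2.1), a.1 +
    ∑ a ∈ rowEquiv.symm (P.1.2, P.2.2), a.1 = _
  rw [h1, h2, h3, pairWeight, pairWeight]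
  ring

lemma charge_arrayEquiv_symm (P : (Finset ℕ × Finset ℕ) × (Finset ℕ × Finset ℕ)) :
    ((arrayEquiv.symm P).1.card : ℤ) - (arrayEquiv.symm P).2.card = charge P.1 + charge P.2 := by
  have h1 := sum_rowEquiv_symm (P.1.1, P.2.1) fun _ => 1
  have h3 := sum_rowEquiv_symm (P.1.2, P.2.2) fun _ => 1
  simp only [Finset.sum_const, smul_eq_mul, mul_one] at h1 h3
  change ((rowEquiv.symm (P.1.1, P.2.1)).card : ℤ) - ((rowEquiv.symm (P.1.2, P.2.2)).card : ℤ) = _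
  rw [h1, h3, charge, charge]
  push_cast
  ring

/-- The pairs of pairs of finite sets with total charge `d`. -/
abbrev totalCharge (d : ℤ) : Set ((Finset ℕ × Finset ℕ) × (Finset ℕ × Finset ℕ)) :=
  {P | charge P.1 + charge P.2 = d}

lemma summable_totalCharge {q : ℂ} (hq : ‖q‖ < 1) (d : ℤ) :
    Summable fun P : totalCharge d => q ^ (pairWeight P.1.1 + pairWeight P.1.2) := by
  have hs := summable_norm_charge hq one_ne_zero
  simp only [_root_.one_zpow, one_mul] at hs
  refine ((summable_mul_of_summable_norm hs hs).subtype (totalCharge d)).congr fun P => ?_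
  simp [pow_add]

lemma hasSum_totalCharge {q : ℂ} (hq : ‖q‖ < 1) (d : ℤ) :
    HasSum (fun k : ℤ => chargeSum q k * chargeSum q (d - k))
      (∑' P : totalCharge d, q ^ (pairWeight P.1.1 + pairWeight P.1.2)) := by
  have hs := summable_norm_charge hq one_ne_zero
  simp only [_root_.one_zpow, one_mul] at hs
  have h := (summable_totalCharge hq d).hasSum.tsum_fiberwise fun P => charge P.1.1
  refine h.congr_fun fun k => ?_
  let e : (charge ⁻¹' {k} : Set (Finset ℕ × Finset ℕ)) ×
      (charge ⁻¹' {d - k} : Set (Finset ℕ × Finset ℕ)) ≃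
      ((fun P : totalCharge d => charge P.1.1) ⁻¹' {k} : Set (totalCharge d)) :=
    { toFun := fun x => ⟨⟨(x.1, x.2), by
        have h1 : charge x.1 = k := x.1.2
        have h2 : charge x.2 = d - k := x.2.2
        change charge x.1 + charge x.2 = d
        omega⟩, x.1.2⟩
      invFun := fun P => (⟨P.1.1.1, P.2⟩, ⟨P.1.1.2, by
        have h1 : charge P.1.1.1 = k := P.2
        have h2 : charge P.1.1.1 + charge P.1.1.2 = d := P.1.2
        change charge P.1.1.2 = d - k
        omega⟩)
      left_inv := fun _ => rfl
      right_inv := fun _ => rfl }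
  rw [← e.tsum_eq]
  have s1 := hs.subtype (charge ⁻¹' {k})
  have s2 := hs.subtype (charge ⁻¹' {d - k})
  rw [chargeSum, chargeSum]
  refine (tsum_mul_tsum_of_summable_norm (f := fun P : charge ⁻¹' {k} => q ^ pairWeight P)
    (g := fun P : charge ⁻¹' {d - k} => q ^ pairWeight P) s1 s2).trans ?_
  exact tsum_congr fun x => (pow_add _ _ _).symm

lemma cpsi_eq_card (β : Fin 2) (n : ℕ) : cpsi β n =
    Nat.card {P : totalCharge ((β : ℕ) - 1) // pairWeight P.1.1 + pairWeight P.1.2 = n} := by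
  rw [cpsi, ← Nat.card_coe_set_eq]
  have hmem : ∀ P, P ∈ frobeniusPartitions 2 ((β : ℕ) : ℚ) n ↔
      arrayEquiv P ∈ totalCharge ((β : ℕ) - 1) ∧
        pairWeight (arrayEquiv P).1 + pairWeight (arrayEquiv P).2 = n := fun P => by
    obtain ⟨Q, rfl⟩ := arrayEquiv.symm.surjective P
    rw [Equiv.apply_symm_apply]
    change (((arrayEquiv.symm Q).1.card : ℚ) - ((arrayEquiv.symm Q).2.card : ℚ) = _ ∧
      weight (arrayEquiv.symm Q) = n) ↔ (charge Q.1 + charge Q.2 = _ ∧ _)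
    rw [weight_arrayEquiv_symm, ← charge_arrayEquiv_symm]
    refine and_congr_left fun _ => ?_
    rw [← Int.cast_inj (α := ℚ)]
    push_cast
    norm_num
  exact Nat.card_congr
    { toFun := fun P => ⟨⟨arrayEquiv P.1, ((hmem _).mp P.2).1⟩, ((hmem _).mp P.2).2⟩
      invFun := fun P => ⟨arrayEquiv.symm P.1.1,
        (hmem _).mpr (by rw [Equiv.apply_symm_apply]; exact ⟨P.1.2, P.2⟩)⟩
      left_inv := fun P => Subtype.ext (arrayEquiv.symm_apply_apply _)
      right_inv := fun P => Subtype.ext (Subtype.ext (arrayEquiv.apply_symm_apply _)) }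

lemma hasSum_cpsi (β : Fin 2) {q : ℂ} (hq : ‖q‖ < 1) :
    HasSum (fun n : ℕ => (cpsi β n : ℂ) * q ^ n)
      (∑' P : totalCharge ((β : ℕ) - 1), q ^ (pairWeight P.1.1 + pairWeight P.1.2)) := by
  have h := (summable_totalCharge hq ((β : ℕ) - 1)).hasSum.tsum_fiberwise
    fun P => pairWeight P.1.1 + pairWeight P.1.2
  refine h.congr_fun fun n => ?_
  have h1 : ∀ P : ((fun P : totalCharge ((β : ℕ) - 1) => pairWeight P.1.1 + pairWeight P.1.2) ⁻¹'
      {n} : Set _), q ^ (pairWeight P.1.1.1 + pairWeight P.1.1.2) = q ^ n := fun P => by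
    rw [show pairWeight P.1.1.1 + pairWeight P.1.1.2 = n from P.2]
  rw [tsum_congr h1, tsum_const, nsmul_eq_mul, cpsi_eq_card]
  rfl

/-- The generating functions as theta functions. -/
lemma CPsi_eq (β : Fin 2) {q : ℂ} (hq : ‖q‖ < 1) (hq0 : q ≠ 0) :
    HasSum (fun k : ℤ => q ^ (k ^ 2 + (1 - (β : ℕ)) * k)) (euler q ^ 2 * CPsi β q) := by
  have h := (hasSum_totalCharge hq ((β : ℕ) - 1)).mul_left (euler q ^ 2)
  rw [CPsi, (hasSum_cpsi β hq).tsum_eq]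
  refine h.congr_fun fun k => ?_
  have he := euler_ne_zero hq
  have hE : ∀ a b : ℂ, euler q ^ 2 * (a * (euler q)⁻¹ * (b * (euler q)⁻¹)) = a * b := fun a b => by
    field_simp
  rw [chargeSum_eq hq0 k, chargeSum_eq hq0 (_ - k), chargeSum_zero hq hq0, hE, ← zpow_add₀ hq0]
  congr 1
  have h1 := Int.ediv_mul_cancel (Int.even_mul_succ_self k).two_dvd
  have h2 := Int.ediv_mul_cancel (Int.even_mul_succ_self (((β : ℕ) : ℤ) - 1 - k)).two_dvd
  refine mul_right_cancel₀ (two_ne_zero : (2 : ℤ) ≠ 0) ?_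
  rw [add_mul, add_mul, h1, h2]
  fin_cases β <;> simp <;> ring

lemma summable_norm_cpsi (β : Fin 2) {q : ℂ} (hq : ‖q‖ < 1) :
    Summable fun n => ‖(cpsi β n : ℂ) * q ^ n‖ := by
  obtain ⟨r, hr, hr1⟩ := exists_between hq
  refine Summable.of_nonneg_of_le (fun _ => norm_nonneg _) (fun n => ?_)
    (summable_cpsi β r ((norm_nonneg _).trans_lt hr) hr1)
  rw [norm_mul, norm_pow, Complex.norm_natCast]
  gcongr

/-- The integer `24 (n - e)`, where `e` is the order of `Θ_β / η²` at infinity. -/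
def level (β : Fin 2) (n : ℕ) : ℤ := 24 * n + (if β = 0 then 4 else -2)

lemma level_eq (β : Fin 2) (n : ℕ) : level β n = 24 * n + level β 0 := by simp [level]

/-- Complete the square in `CPsi_eq`. Together with the `q^(1/12)` of `η²`, the power of `q`
supplies the constant 1/4 for `β = 0` and 0 for `β = 1`. -/
lemma theta_eq_CPsi (β : Fin 2) {z : ℂ} (hz : 0 < z.im) :
    theta z β = ee (level β 0 * z / 24) * eta z ^ 2 * CPsi β (ee z) := by
  have hq : ‖ee z‖ < 1 := norm_ee_lt_one hz
  have h := CPsi_eq β hq (ee_ne_zero z)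
  rw [eta_eq, mul_pow, mul_assoc, mul_assoc, ← mul_assoc, ← ee_nsmul, ← ee_add]
  have h' := h.mul_left (ee (level β 0 * z / 24 + (2 : ℕ) * (z / 24)))
  fin_cases β
  · refine (hasSum_thB hz).unique (h'.congr_fun fun k => ?_)
    rw [← ee_zsmul, ← ee_add]
    congr 1
    simp [level]
    ring
  · refine (hasSum_thA hz).unique (h'.congr_fun fun k => ?_)
    rw [← ee_zsmul, ← ee_add]
    congr 1
    simp [level]
    ring

/-- `level β n` is `3 · 2^(β+1) n - (-1)^(β+1)` times a power of two, which is prime to 5. -/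
lemma inClass_iff (β : Fin 2) (α n : ℕ) : InClass β α n ↔ ((5 ^ α : ℕ) : ℤ) ∣ level β n := by
  have h5 : ∀ k : ℕ, IsCoprime ((5 : ℤ) ^ α) (2 ^ k) := fun k =>
    IsCoprime.pow (by norm_num [Int.isCoprime_iff_gcd_eq_one])
  rw [InClass, Int.modEq_comm, Int.modEq_iff_dvd]
  push_cast
  have h1 : level β n = 2 ^ (2 - (β : ℕ)) * (3 * 2 ^ ((β : ℕ) + 1) * n - (-1) ^ ((β : ℕ) + 1)) := by
    fin_cases β <;> simp [level] <;> ring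
  rw [h1]
  exact ⟨fun h => h.mul_left _, fun h => (h5 _).dvd_of_dvd_mul_left h⟩

lemma five_pow_mod (α : ℕ) : 5 ^ α % 12 = 5 ^ (α % 2) := by
  induction α using Nat.twoStepInduction with
  | zero => rfl
  | one => rfl
  | more n h _ =>
    rw [Nat.add_mod_right, ← h, pow_add]
    omega

/-- The exponent `⌊n/5^α⌋ + β` is exactly what makes the sum over the points, divided by `Θ`, a
power series in `q` without a fractional prefactor. -/
lemma level_of_inClass {β : Fin 2} {α n : ℕ} (hα : 1 ≤ α) (h : InClass β α n) :
    level β n = (5 ^ α : ℕ) * (24 * (n / 5 ^ α + (β : ℕ) : ℕ) + (5 ^ (α % 2) : ℕ) * level β 0) := by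
  rw [inClass_iff, level_eq] at h
  rw [level_eq β n]
  have hN := five_pow_mod α
  have hN5 : 5 ≤ 5 ^ α := Nat.le_self_pow (by omega) 5
  generalize 5 ^ α = N at *
  have hr := Nat.mod_lt n (show 0 < N by omega)
  have hn : (n : ℤ) = N * (n / N : ℕ) + (n % N : ℕ) := by exact_mod_cast (Nat.div_add_mod n N).symm
  set r := n % N
  set m := n / N
  rw [hn] at h ⊢
  have h' : (N : ℤ) ∣ 24 * r + level β 0 := by
    rw [show (24 : ℤ) * r + level β 0 = (24 * (N * m + r) + level β 0) - N * (24 * m) by ring]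
    exact h.sub (dvd_mul_right _ _)
  suffices 24 * (r : ℤ) + level β 0 = N * (24 * (β : ℕ) + (5 ^ (α % 2) : ℕ) * level β 0) by
    push_cast at this ⊢
    linear_combination this
  obtain ⟨k, hk⟩ := h'
  rw [hk]
  congr 1
  have hN0 : (0 : ℤ) < N := by omega
  have hr' : (r : ℤ) < N := by exact_mod_cast hr
  -- Here `N k = 24 r + level β 0` with `0 ≤ r < N`, so `0 ≤ k < 24`. As `N ≡ 5^(α mod 2)` modulo 12
  -- and `level β 0` is even, the residue of `N k` modulo 24 then determines `k`.
  have hk1 : k < 24 := by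
    by_contra! hk1
    have : (N : ℤ) * 24 ≤ N * k := by gcongr
    revert hk
    fin_cases β <;> simp [level] <;> omega
  have hk0 : 0 ≤ k := by
    by_contra! hk1
    have : (N : ℤ) * k ≤ N * (-1) := by gcongr; omega
    revert hk
    fin_cases β <;> simp [level] <;> omega
  rcases Nat.mod_two_eq_zero_or_one α with hα | hα <;> rw [hα] at hN ⊢ <;>
  · revert hk
    fin_cases β <;> simp only [level] <;> simp <;> intro hk <;> interval_cases k <;> omega

/-- The weights in `thetaSum` cancel the `η²` in each theta value and leave `CPsi` at the points.
Orthogonality of characters in `j` then selects the residue class and produces the factor `5^α`. -/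
theorem thetaRatio_eq (β : Fin 2) {α : ℕ} (hα : 1 ≤ α) (τ : ℍ) :
    thetaRatio β α τ = 5 ^ α * classSum β α (ee τ) / CPsi β (ee τ ^ (1 + 4 * (α % 2))) := by
  have hq : ‖ee τ‖ < 1 := norm_ee_lt_one τ.im_pos
  have hN : ((5 ^ α : ℕ) : ℂ) ≠ 0 := NeZero.ne _
  set w : ℍ := scale (5 ^ (α % 2)) τ with hw
  have hwc : (w : ℂ) = (5 ^ (α % 2) : ℕ) * τ := coe_scale _ _
  have hpow : ee (w : ℂ) = ee τ ^ (1 + 4 * (α % 2)) := by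
    rw [hwc, ee_nsmul]
    congr 1
    rcases Nat.mod_two_eq_zero_or_one α with h | h <;> simp [h]
  have hnode : ∀ j : ZMod (5 ^ α), ((eta w / eta (node (5 ^ α) j.val τ)) ^ 2 • theta (node (5 ^ α) j.val τ)) β =
      eta w ^ 2 * (ee (level β 0 * (node (5 ^ α) j.val τ : ℍ) / 24) * CPsi β (ee (node (5 ^ α) j.val τ : ℍ))) :=
    fun j => by
      rw [Pi.smul_apply, smul_eq_mul, theta_eq_CPsi β (node (5 ^ α) j.val τ).im_pos, div_pow]
      have := eta_ne_zero' (node (5 ^ α) j.val τ).im_pos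
      field_simp
  have hterm : ∀ j : ZMod (5 ^ α), HasSum (fun n : ℕ => (cpsi β n : ℂ) * ee (level β n / 24 * τ / ((5 ^ α : ℕ) : ℂ)) *
      ee (level β n * j.val / ((5 ^ α : ℕ) : ℂ)))
      (ee (level β 0 * (node (5 ^ α) j.val τ : ℍ) / 24) * CPsi β (ee (node (5 ^ α) j.val τ : ℍ))) := fun j => by
    have h := (summable_norm_cpsi β (norm_ee_lt_one (node (5 ^ α) j.val τ).im_pos)).of_norm.hasSum.mul_left
      (ee (level β 0 * (node (5 ^ α) j.val τ : ℍ) / 24))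
    refine h.congr_fun fun n => ?_
    rw [mul_left_comm, mul_assoc, ← ee_nsmul, ← ee_add, ← ee_add, coe_node, level_eq β n]
    congr 2
    push_cast
    field_simp
    ring
  have hsum : HasSum (fun n : ℕ => (cpsi β n : ℂ) * ee (level β n / 24 * τ / ((5 ^ α : ℕ) : ℂ)) *
      ∑ j : ZMod (5 ^ α), ee (level β n * j.val / ((5 ^ α : ℕ) : ℂ))) (∑ j : ZMod (5 ^ α),
        ee (level β 0 * (node (5 ^ α) j.val τ : ℍ) / 24) * CPsi β (ee (node (5 ^ α) j.val τ : ℍ))) := by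
    simp_rw [Finset.mul_sum]
    exact hasSum_sum fun j _ => hterm j
  have hclass : ∑ j : ZMod (5 ^ α), ee (level β 0 * (node (5 ^ α) j.val τ : ℍ) / 24) *
      CPsi β (ee (node (5 ^ α) j.val τ : ℍ)) = ((5 ^ α : ℕ) : ℂ) * ee (level β 0 * w / 24) * classSum β α (ee τ) := by
    rw [← hsum.tsum_eq, classSum, ← tsum_mul_left, ← tsum_subtype_eq_of_support_subset
      (s := {n | InClass β α n})]
    · refine tsum_congr fun n => ?_
      have hn : InClass β α n := n.2
      rw [sum_ee_div, if_pos ((inClass_iff β α n).mp hn), level_of_inClass hα hn,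
        mul_left_comm, mul_right_comm, mul_comm _ ((5 ^ α : ℕ) : ℂ), mul_assoc, mul_assoc, ← ee_nsmul,
        mul_left_comm, ← ee_add, hwc]
      generalize (n : ℕ) / 5 ^ α = m
      congr 3
      push_cast
      field_simp
      ring
    · intro n hn
      by_contra hcl
      rw [Function.mem_support, sum_ee_div, if_neg (fun h => hcl ((inClass_iff β α n).mpr h))] at hn
      simp at hn
  rw [thetaRatio, theta_eq_CPsi β w.im_pos, thetaSum, Finset.sum_apply]
  rw [Finset.sum_congr rfl fun j _ => hnode j, ← Finset.mul_sum, hclass, hpow]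
  have h1 := eta_ne_zero' w.im_pos
  have h2 := ee_ne_zero (level β 0 * w / 24)
  rw [show eta w ^ 2 * (((5 ^ α : ℕ) : ℂ) * ee (level β 0 * w / 24) * classSum β α (ee τ)) =
    (ee (level β 0 * w / 24) * eta w ^ 2) * (((5 ^ α : ℕ) : ℂ) * classSum β α (ee τ)) by ring,
    mul_div_mul_left _ _ (mul_ne_zero h2 (pow_ne_zero 2 h1))]
  push_cast
  rfl

end

section

open Polynomial

/-! ### Linear independence of the module generators modulo `5` -/

lemma genPoly_linear {K : Type*} [CommRing K] (β a : Fin 2) (t x y : K) :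
    genPoly β a t x y = genPoly β a t x 0 + (genPoly β a t x 1 - genPoly β a t x 0) * y := by
  fin_cases β <;> fin_cases a <;> simp only [genPoly] <;> ring

lemma map_genPoly {K L : Type*} [CommRing K] [CommRing L] (φ : K →+* L) (β a : Fin 2) (t x y : K) :
    φ (genPoly β a t x y) = genPoly β a (φ t) (φ x) (φ y) := by
  fin_cases β <;> fin_cases a <;> simp [genPoly, map_ofNat]

instance : Fact (Nat.Prime 5) := ⟨by norm_num⟩

lemma five_eq_zero : (5 : (ZMod 5)[X]) = 0 := by
  have : ((5 : ℕ) : (ZMod 5)[X]) = 0 := CharP.cast_eq_zero _ 5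
  exact_mod_cast this

/-- The root 1 has odd multiplicity on the right, because it is a simple root of `(1 - X)(1 + 3X)`
modulo 5. -/
lemma sq_ne_odd_mul_sq (v w : (ZMod 5)[X]) (hv : v ≠ 0) :
    w ^ 2 ≠ v ^ 2 * ((1 - X) * (1 + 3 * X)) := fun h => by
  have h1 : (1 - X : (ZMod 5)[X]) = C (-1) * (X - C 1) := by simp
  have hd : ((1 - X) * (1 + 3 * X) : (ZMod 5)[X]) ≠ 0 := fun h0 => by
    have := congrArg (eval 0) h0
    simp at this
  have hw : w ≠ 0 := by
    rintro rfl
    rw [zero_pow two_ne_zero] at h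
    exact mul_ne_zero (pow_ne_zero 2 hv) hd h.symm
  have hm := congrArg (rootMultiplicity 1) h
  have h3 : rootMultiplicity 1 ((1 - X) * (1 + 3 * X) : (ZMod 5)[X]) = 1 := by
    rw [rootMultiplicity_mul hd, h1, rootMultiplicity_mul (by rw [← h1]; exact left_ne_zero_of_mul hd),
      rootMultiplicity_C, rootMultiplicity_X_sub_C_self, rootMultiplicity_eq_zero]
    rw [IsRoot.def]
    simp
    decide
  rw [rootMultiplicity_mul (mul_ne_zero (pow_ne_zero 2 hv) hd), h3, pow_two, pow_two,
    rootMultiplicity_mul (mul_ne_zero hv hv), rootMultiplicity_mul (mul_ne_zero hw hw)] at hm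
  omega

/-- Modulo 5 the curve equation is quadratic in `y` with discriminant `(1 - x)(1 + 3x)`, which is
not a square. So `y` is not a rational function of `x`. -/
lemma eq_zero_of_linear {S : Type*} [CommRing S] [IsDomain S] [Algebra (ZMod 5) S] {x y : S}
    (hx : ∀ u : (ZMod 5)[X], aeval x u = 0 → u = 0)
    (hy : y ^ 2 - (1 + x) * y + x ^ 2 = 0) {u v : (ZMod 5)[X]}
    (h : aeval x u + aeval x v * y = 0) : u = 0 ∧ v = 0 := by
  have hv : v = 0 := by
    by_contra hv
    have h1 : u ^ 2 + (1 + X) * u * v + X ^ 2 * v ^ 2 = 0 := by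
      apply hx
      simp only [map_add, map_mul, map_pow, aeval_X, map_one]
      have hu : aeval x u = -(aeval x v * y) := eq_neg_of_add_eq_zero_left h
      rw [hu]
      linear_combination (aeval x v) ^ 2 * hy
    refine sq_ne_odd_mul_sq v (2 * u + (1 + X) * v) hv ?_
    linear_combination 4 * h1
  refine ⟨hx u ?_, hv⟩
  simpa [hv] using h

/-- Modulo 5 one has `t = x(1 - x)²`, so polynomials in `t` become polynomials in `x` by an
injective substitution. The relation is then linear in `y`, and the generator has a nonzero
coefficient there. -/
lemma genPoly_independent {S : Type*} [CommRing S] [IsDomain S] [Algebra (ZMod 5) S] {t x y : S}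
    (hx : ∀ u : (ZMod 5)[X], aeval x u = 0 → u = 0)
    (hy : y ^ 2 - (1 + x) * y + x ^ 2 = 0) (ht : t = x * (1 - x) ^ 2) (β a : Fin 2)
    {f g : (ZMod 5)[X]} (h : aeval t f + aeval t g * genPoly β a t x y = 0) : f = 0 ∧ g = 0 := by
  set m : (ZMod 5)[X] := X * (1 - X) ^ 2 with hm
  have hmx : aeval x m = t := by simp [hm, ht]
  have hdeg : 0 < m.natDegree := by
    have : m = X ^ 3 + 3 * X ^ 2 + X := by
      rw [hm]
      linear_combination (-X ^ 2) * five_eq_zero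
    have h3 : m.natDegree = 3 := by
      rw [this]
      compute_degree!
    omega
  have hcomp : ∀ k : (ZMod 5)[X], k.comp m = 0 → k = 0 := fun k hk => by
    rcases comp_eq_zero_iff.mp hk with h0 | h0
    · exact h0
    · rw [h0.2, natDegree_C] at hdeg
      exact absurd hdeg (lt_irrefl 0)
  have hgen : ∀ c : (ZMod 5)[X], aeval x (genPoly β a m X c) = genPoly β a t x (aeval x c) := fun c => by
    have := map_genPoly (aeval x : (ZMod 5)[X] →ₐ[ZMod 5] S).toRingHom β a m X c
    simp only [AlgHom.toRingHom_eq_coe, RingHom.coe_coe, aeval_X, hmx] at this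
    exact this
  have key := eq_zero_of_linear hx hy (u := f.comp m + g.comp m * genPoly β a m X 0)
    (v := g.comp m * (genPoly β a m X 1 - genPoly β a m X 0)) (by
      simp only [map_add, map_mul, map_sub, aeval_comp, hmx, hgen, map_zero, map_one]
      rw [genPoly_linear] at h
      linear_combination h)
  -- At `x = 0` also `t = 0`, and the coefficient of `y` is `4` or `-4`.
  have hB : genPoly β a m X 1 - genPoly β a m X 0 ≠ 0 := fun h0 => by
    have h1 := congrArg (evalRingHom (0 : ZMod 5)) h0
    rw [map_sub, map_genPoly, map_genPoly] at h1
    revert h1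
    fin_cases β <;> fin_cases a <;> simp [genPoly, hm] <;> decide
  have hg : g = 0 := hcomp g ((mul_eq_zero.mp key.2).resolve_right hB)
  refine ⟨hcomp f ?_, hg⟩
  simpa [hg] using key.1

open scoped PowerSeries in
lemma aeval_powerSeries_eq_zero {K : Type*} [Field K] {x : K⟦X⟧} (h0 : PowerSeries.constantCoeff x = 0)
    (hx : x ≠ 0) (u : K[X]) (h : aeval x u = 0) : u = 0 := by
  by_contra hu
  obtain ⟨w, hw, hw0⟩ := exists_eq_pow_rootMultiplicity_mul_and_not_dvd u hu 0
  rw [hw, map_mul, map_pow] at h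
  simp only [map_zero, sub_zero, aeval_X] at h hw0
  rcases mul_eq_zero.mp h with h | h
  · exact hx (eq_zero_of_pow_eq_zero h)
  · rw [Polynomial.X_dvd_iff, coeff_zero_eq_eval_zero] at hw0
    apply hw0
    have h1 := congrArg (PowerSeries.constantCoeff (R := K)) h
    have h2 := Polynomial.hom_eval₂ w (algebraMap K K⟦X⟧) (PowerSeries.constantCoeff (R := K)) x
    rw [aeval_def] at h1
    rw [h2, h0] at h1
    simpa [eval₂_eq_eval_map] using h1

/-! ### Divisibility by powers of 5 in integral power series -/

open scoped PowerSeries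

lemma five_dvd_powerSeries_iff (f : ℤ⟦X⟧) :
    5 ∣ f ↔ PowerSeries.map (Int.castRingHom (ZMod 5)) f = 0 := by
  constructor
  · rintro ⟨g, rfl⟩
    rw [map_mul, map_ofNat, show (5 : (ZMod 5)⟦X⟧) = PowerSeries.C 5 from rfl,
      show (5 : ZMod 5) = 0 from rfl, map_zero, zero_mul]
  · intro h
    have h1 : ∀ n, (5 : ℤ) ∣ PowerSeries.coeff n f := fun n => by
      have := congrArg (PowerSeries.coeff n) h
      rw [PowerSeries.coeff_map, map_zero] at this
      exact (ZMod.intCast_zmod_eq_zero_iff_dvd _ 5).mp this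
    choose g hg using h1
    refine ⟨PowerSeries.mk g, ?_⟩
    ext n
    rw [show (5 : ℤ⟦X⟧) = PowerSeries.C 5 from rfl, PowerSeries.coeff_C_mul, PowerSeries.coeff_mk, hg]

lemma pow_five_dvd_powerSeries_iff (k : ℕ) (f : ℤ⟦X⟧) :
    5 ^ k ∣ f ↔ ∀ n, (5 : ℤ) ^ k ∣ PowerSeries.coeff n f := by
  have h5 : (5 : ℤ⟦X⟧) ^ k = PowerSeries.C (5 ^ k) := by
    rw [map_pow]
    rfl
  rw [h5]
  constructor
  · rintro ⟨g, rfl⟩ n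
    rw [PowerSeries.coeff_C_mul]
    exact dvd_mul_right _ _
  · intro h1
    choose g hg using h1
    refine ⟨PowerSeries.mk g, ?_⟩
    ext n
    rw [PowerSeries.coeff_C_mul, PowerSeries.coeff_mk, hg]

lemma prime_five_powerSeries : Prime (5 : ℤ⟦X⟧) := by
  refine ⟨?_, fun h => ?_, fun f g h => ?_⟩
  · intro h
    have := congrArg (PowerSeries.constantCoeff (R := ℤ)) h
    rw [map_ofNat, map_zero] at this
    omega
  · have := h.map (PowerSeries.constantCoeff (R := ℤ))
    rw [map_ofNat, Int.isUnit_iff] at this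
    omega
  · rw [five_dvd_powerSeries_iff, map_mul] at h
    rw [five_dvd_powerSeries_iff, five_dvd_powerSeries_iff]
    exact mul_eq_zero.mp h

lemma five_dvd_polynomial_iff (f : ℤ[X]) : 5 ∣ f ↔ f.map (Int.castRingHom (ZMod 5)) = 0 := by
  rw [show (5 : ℤ[X]) = C 5 from rfl, C_dvd_iff_dvd_coeff, Polynomial.ext_iff]
  refine forall_congr' fun n => ?_
  rw [coeff_map, coeff_zero]
  exact (ZMod.intCast_zmod_eq_zero_iff_dvd _ 5).symm

/-- A point of the curve over the ring of integral power series. -/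
structure IntegralPoint (t x y : ℤ⟦X⟧) : Prop where
  t_mul : t * (1 + 5 * x) = x * (1 + 4 * x) ^ 2
  y_sq : 4 * y ^ 2 + y + 6 * x * y = x ^ 2 * (1 + 5 * x)
  constantCoeff : PowerSeries.constantCoeff x = 0
  coeff_one : PowerSeries.coeff 1 x = 1

namespace IntegralPoint

variable {t x y : ℤ⟦X⟧}

/-- Reduction modulo 5 lands in a domain of power series. There `x` has no constant term but is
nonzero, hence is transcendental, and the independence of the generator applies. -/
lemma five_dvd (H : IntegralPoint t x y) (β a : Fin 2) {F G : ℤ[X]}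
    (h : 5 ∣ aeval t F + aeval t G * genPoly β a t x y) : 5 ∣ F ∧ 5 ∣ G := by
  set φ := PowerSeries.map (Int.castRingHom (ZMod 5))
  have hae : ∀ P : ℤ[X], φ (aeval t P) = aeval (φ t) (P.map (Int.castRingHom (ZMod 5))) := fun P => by
    rw [aeval_def, hom_eval₂, aeval_def, eval₂_map]
    congr 1
    exact RingHom.ext_int _ _
  have h5 : (5 : (ZMod 5)⟦X⟧) = 0 := by
    rw [show (5 : (ZMod 5)⟦X⟧) = PowerSeries.C 5 from rfl, show (5 : ZMod 5) = 0 from rfl, map_zero]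
  rw [five_dvd_powerSeries_iff, map_add, map_mul, hae, hae, map_genPoly] at h
  rw [five_dvd_polynomial_iff, five_dvd_polynomial_iff]
  refine genPoly_independent (x := φ x) (y := φ y) (aeval_powerSeries_eq_zero ?_ fun h0 => ?_) ?_ ?_
    β a h
  · rw [← PowerSeries.coeff_zero_eq_constantCoeff_apply, PowerSeries.coeff_map,
      PowerSeries.coeff_zero_eq_constantCoeff_apply, H.constantCoeff, map_zero]
  · have := congrArg (PowerSeries.coeff 1) h0
    rw [PowerSeries.coeff_map, H.coeff_one] at this
    simp at this
  · have h1 := congrArg φ H.y_sq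
    simp only [map_add, map_mul, map_pow, map_ofNat, map_one] at h1
    linear_combination -h1 + (φ y ^ 2 + φ x * φ y - φ x ^ 3) * h5
  · have h1 := congrArg φ H.t_mul
    simp only [map_add, map_mul, map_pow, map_ofNat, map_one] at h1
    linear_combination h1 + (-φ t * φ x + φ x * (2 * φ x + 3 * φ x ^ 2)) * h5

lemma pow_five_dvd (H : IntegralPoint t x y) (β a : Fin 2) (k : ℕ) :
    ∀ {F G : ℤ[X]}, 5 ^ k ∣ aeval t F + aeval t G * genPoly β a t x y → 5 ^ k ∣ F ∧ 5 ^ k ∣ G := by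
  induction k with
  | zero => simp
  | succ k ih =>
    intro F G h
    obtain ⟨⟨F, rfl⟩, ⟨G, rfl⟩⟩ := H.five_dvd β a ((dvd_pow_self _ k.succ_ne_zero).trans h)
    have h1 : (5 : ℤ⟦X⟧) * 5 ^ k ∣ 5 * (aeval t F + aeval t G * genPoly β a t x y) := by
      convert h using 1
      · ring
      · simp only [map_mul, map_ofNat]
        ring
    obtain ⟨hF, hG⟩ := ih ((mul_dvd_mul_iff_left prime_five_powerSeries.ne_zero).mp h1)
    rw [pow_succ']
    exact ⟨mul_dvd_mul_left _ hF, mul_dvd_mul_left _ hG⟩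

/-- Write `D = 5^d D'` with `5 ∤ D'`. If `5^k` divides `l β`, then `5^(d+k)` divides `F + G p`,
hence `F` and `G`, and the relation for `β'` leaves `5^k ∣ D'(t) l β'`. Since 5 is prime and does
not divide `D'(t)`, the factor `D'(t)` can be dropped. -/
theorem pow_five_dvd_of_relation (H : IntegralPoint t x y) {a : Fin 2} {l c : Fin 2 → ℤ⟦X⟧}
    (hc : ∀ β, ¬ 5 ∣ c β) {D F G : ℤ[X]} (hD : D ≠ 0) (h : ∀ β, aeval t D * l β =
      (aeval t F + aeval t G * genPoly β a t x y) * c β) (k : ℕ) (β β' : Fin 2)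
    (hl : 5 ^ k ∣ l β) : 5 ^ k ∣ l β' := by
  have hp5 : Prime (5 : ℤ[X]) := prime_C_iff.mpr (by norm_num : Prime (5 : ℤ))
  have hcancel : ∀ (n : ℕ) (β : Fin 2) (u : ℤ⟦X⟧), 5 ^ n ∣ u * c β → 5 ^ n ∣ u := fun n β u =>
    (prime_five_powerSeries).pow_dvd_of_dvd_mul_right n (hc β)
  obtain ⟨D', hD', h5⟩ := (FiniteMultiplicity.of_prime_left hp5 hD).exists_eq_pow_mul_and_not_dvd
  set d := multiplicity 5 D
  have hDt : aeval t D = 5 ^ d * aeval t D' := by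
    rw [hD', map_mul, map_pow, map_ofNat]
  have h1 : 5 ^ (d + k) ∣ (aeval t F + aeval t G * genPoly β a t x y) * c β := by
    rw [← h, hDt, pow_add, mul_assoc]
    exact mul_dvd_mul_left _ (hl.mul_left _)
  obtain ⟨⟨F', hF⟩, ⟨G', hG⟩⟩ := H.pow_five_dvd β a _ (hcancel _ _ _ h1)
  have h2 : (5 : ℤ⟦X⟧) ^ (d + k) ∣ aeval t D * l β' := by
    rw [h, hF, hG, map_mul, map_mul, map_pow, map_ofNat, mul_assoc, ← mul_add]
    exact (dvd_mul_right _ _).mul_right _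
  rw [hDt, pow_add, mul_assoc] at h2
  have h3 := (mul_dvd_mul_iff_left (pow_ne_zero _ prime_five_powerSeries.ne_zero)).mp h2
  refine prime_five_powerSeries.pow_dvd_of_dvd_mul_left k (fun hd => h5 ?_) h3
  refine (H.five_dvd β a (G := 0) ?_).1
  rw [map_zero, zero_mul, add_zero]
  exact hd

end IntegralPoint

end

section

open ModularForm (eta)
open Filter Topology
open scoped PowerSeries

/-! ### Integral `q`-expansions -/

lemma exists_ee_eq {q : ℂ} (hq0 : q ≠ 0) (hq : ‖q‖ < 1) : ∃ τ : ℍ, ee τ = q :=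
  ⟨⟨_, Function.Periodic.im_invQParam_pos_of_norm_lt_one one_pos hq hq0⟩, by
    rw [← qParam_eq_ee]
    exact Function.Periodic.qParam_right_inv one_ne_zero hq0⟩

lemma norm_ee_coe_lt_one (τ : ℍ) : ‖ee τ‖ < 1 := norm_ee_lt_one τ.im_pos

lemma eq_zero_of_hasSum_zero {c : ℕ → ℂ} (h : ∀ τ : ℍ, HasSum (fun n => c n * ee τ ^ n) 0) :
    c = 0 := by
  classical
  let p := FormalMultilinearSeries.ofScalars ℂ c
  -- Points of ℍ only reach `q ≠ 0`, so at 0 the value of the series itself is used. The sum is then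
  -- analytic and vanishes on a punctured neighbourhood.
  let f : ℂ → ℂ := fun q => if q = 0 then c 0 else 0
  have hf0 : ∀ᶠ q in 𝓝[≠] (0 : ℂ), f q = 0 := by
    filter_upwards [self_mem_nhdsWithin] with q hq
    exact if_neg hq
  have hp : HasFPowerSeriesAt f p 0 := by
    rw [hasFPowerSeriesAt_iff]
    filter_upwards [Metric.ball_mem_nhds (0 : ℂ) one_pos] with q hq
    simp only [p, FormalMultilinearSeries.coeff_ofScalars, zero_add, smul_eq_mul]
    by_cases h0 : q = 0
    · simp only [h0, f, if_true]
      have h2 := hasSum_single (f := fun n => (0 : ℂ) ^ n * c n) 0 fun n hn => by simp [hn]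
      simpa using h2
    · obtain ⟨τ, rfl⟩ := exists_ee_eq h0 (by simpa using hq)
      simp only [f, if_neg h0]
      exact (h τ).congr_fun fun n => mul_comm _ _
  have h1 : f =ᶠ[𝓝 0] 0 := hp.analyticAt.frequently_zero_iff_eventually_zero.mp hf0.frequently
  have h2 := (hp.congr h1).eq_zero
  ext n
  have h3 : p.coeff n = c n := FormalMultilinearSeries.coeff_ofScalars
  rw [← h3, h2]
  rfl

/-- The integral power series in `q` converges in the unit disc, to the given function on the upper
half-plane. -/
def Expands (f : ℤ⟦X⟧) (Φ : ℍ → ℂ) : Prop :=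
  ∀ τ : ℍ, HasSum (fun n => ((PowerSeries.coeff n f : ℤ) : ℂ) * ee τ ^ n) (Φ τ)

namespace Expands

variable {f g : ℤ⟦X⟧} {Φ Ψ : ℍ → ℂ}

lemma mul (hf : Expands f Φ) (hg : Expands g Ψ) : Expands (f * g) fun τ => Φ τ * Ψ τ := fun τ => by
  have h1 := (hf τ).summable.norm
  have h2 := (hg τ).summable.norm
  have h3 := tsum_mul_tsum_eq_tsum_sum_antidiagonal_of_summable_norm h1 h2
  rw [(hf τ).tsum_eq, (hg τ).tsum_eq] at h3
  change HasSum _ (Φ τ * Ψ τ)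
  rw [h3]
  refine ((summable_norm_sum_mul_antidiagonal_of_summable_norm h1 h2).of_norm.hasSum).congr_fun
    fun n => ?_
  rw [PowerSeries.coeff_mul, Int.cast_sum, Finset.sum_mul]
  refine Finset.sum_congr rfl fun i hi => ?_
  rw [← Finset.HasAntidiagonal.mem_antidiagonal.mp hi]
  push_cast
  ring

lemma add (hf : Expands f Φ) (hg : Expands g Ψ) : Expands (f + g) fun τ => Φ τ + Ψ τ := fun τ => by
  refine ((hf τ).add (hg τ)).congr_fun fun n => ?_
  rw [map_add]
  push_cast
  ring

lemma sub (hf : Expands f Φ) (hg : Expands g Ψ) : Expands (f - g) fun τ => Φ τ - Ψ τ := fun τ => by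
  refine ((hf τ).sub (hg τ)).congr_fun fun n => ?_
  rw [map_sub]
  push_cast
  ring

lemma congr (hf : Expands f Φ) (h : ∀ τ, Φ τ = Ψ τ) : Expands f Ψ := fun τ => h τ ▸ hf τ

end Expands

lemma expands_intCast (m : ℤ) : Expands (PowerSeries.C m) fun _ => m := fun τ => by
  have h := hasSum_single (f := fun n => ((PowerSeries.coeff n (PowerSeries.C m) : ℤ) : ℂ) * ee τ ^ n) 0
    fun n hn => by rw [PowerSeries.coeff_C, if_neg hn, Int.cast_zero, zero_mul]
  simpa using h

lemma expands_one : Expands 1 fun _ => 1 := by simpa using expands_intCast 1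

lemma expands_ofNat (n : ℕ) [n.AtLeastTwo] : Expands (OfNat.ofNat n) fun _ => OfNat.ofNat n := by
  simpa using expands_intCast (OfNat.ofNat n)

lemma Expands.pow {f : ℤ⟦X⟧} {Φ : ℍ → ℂ} (hf : Expands f Φ) (k : ℕ) :
    Expands (f ^ k) fun τ => Φ τ ^ k := by
  induction k with
  | zero => simpa using expands_one
  | succ k ih =>
    simp only [pow_succ]
    exact ih.mul hf

lemma coeff_relation {ι : Type*} [Fintype ι] (v : ι → ℂ) {f : ι → ℤ⟦X⟧} {Φ : ι → ℍ → ℂ}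
    (h : ∀ i, Expands (f i) (Φ i)) (hv : ∀ τ, ∑ i, v i * Φ i τ = 0) (n : ℕ) :
    ∑ i, v i * ((PowerSeries.coeff n (f i) : ℤ) : ℂ) = 0 := by
  refine congrFun (eq_zero_of_hasSum_zero (c := fun n => ∑ i, v i * ((PowerSeries.coeff n (f i) : ℤ) : ℂ))
    fun τ => ?_) n
  have h1 := hasSum_sum (s := Finset.univ) fun i _ => (h i τ).mul_left (v i)
  rw [hv τ] at h1
  refine h1.congr_fun fun n => ?_
  rw [Finset.sum_mul]
  exact Finset.sum_congr rfl fun i _ => by ring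

lemma Expands.unique {f g : ℤ⟦X⟧} {Φ Ψ : ℍ → ℂ} (hf : Expands f Φ) (hg : Expands g Ψ)
    (h : ∀ τ, Φ τ = Ψ τ) : f = g := by
  ext n
  have h := congrFun (eq_zero_of_hasSum_zero (c := fun n =>
    ((PowerSeries.coeff n f - PowerSeries.coeff n g : ℤ) : ℂ)) fun τ => by
      have := (hf τ).sub (hg τ)
      rw [h τ, sub_self] at this
      refine this.congr_fun fun n => ?_
      push_cast
      ring) n
  exact sub_eq_zero.mp (Int.cast_eq_zero.mp h)

lemma expands_of_injective {ι : Type*} {e : ι → ℕ} (he : Function.Injective e) (c : ι → ℤ)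
    {Φ : ℍ → ℂ} (h : ∀ τ : ℍ, HasSum (fun i => (c i : ℂ) * ee τ ^ e i) (Φ τ)) :
    Expands (PowerSeries.mk (Function.extend e c 0)) Φ := fun τ => by
  refine ((hasSum_extend_zero he).mpr (h τ)).congr_fun fun n => ?_
  rw [PowerSeries.coeff_mk]
  by_cases hn : ∃ i, e i = n
  · obtain ⟨i, rfl⟩ := hn
    rw [he.extend_apply, he.extend_apply]
  · rw [Function.extend_apply' _ _ _ hn, Function.extend_apply' _ _ _ hn]
    simp

lemma expands_card {ι : Type*} (w : ι → ℕ) {Φ : ℍ → ℂ}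
    (h : ∀ τ : ℍ, HasSum (fun i => ee τ ^ w i) (Φ τ)) :
    Expands (PowerSeries.mk fun n => (Nat.card (w ⁻¹' {n}) : ℤ)) Φ := fun τ => by
  refine ((h τ).tsum_fiberwise w).congr_fun fun n => ?_
  have h1 : ∀ i : w ⁻¹' {n}, ee τ ^ w i = ee τ ^ n := fun i => by
    rw [show w i = n from i.2]
  rw [tsum_congr h1, tsum_const, nsmul_eq_mul, PowerSeries.coeff_mk]
  push_cast
  rfl

lemma expands_X : Expands PowerSeries.X fun τ => ee τ := fun τ => by
  have h := hasSum_single (f := fun n =>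
    ((PowerSeries.coeff n (PowerSeries.X : ℤ⟦X⟧) : ℤ) : ℂ) * ee τ ^ n) 1
    fun n hn => by simp [PowerSeries.coeff_X, hn]
  simpa using h

lemma norm_ee_pow_lt_one {d : ℕ} (hd : d ≠ 0) (τ : ℍ) : ‖ee τ ^ d‖ < 1 :=
  norm_pow_lt_one (norm_ee_coe_lt_one τ) hd

/-- The values `∏ (1 - q ^ (d n))` of the Euler product. -/
def eulerFun (d : ℕ) (τ : ℍ) : ℂ := euler (ee τ ^ d)

lemma eulerFun_ne_zero {d : ℕ} (hd : d ≠ 0) (τ : ℍ) : eulerFun d τ ≠ 0 :=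
  euler_ne_zero (norm_ee_pow_lt_one hd τ)

lemma exists_expansion_euler {d : ℕ} (hd : d ≠ 0) :
    ∃ f : ℤ⟦X⟧, PowerSeries.constantCoeff f = 1 ∧ Expands f (eulerFun d) := by
  have he : Function.Injective fun k : ℤ => d * pentagonal k := fun k l h =>
    pentagonal_injective (Nat.eq_of_mul_eq_mul_left (Nat.pos_of_ne_zero hd) h)
  refine ⟨_, ?_, expands_of_injective he (fun k => (-1) ^ k.natAbs) fun τ => ?_⟩
  · rw [← PowerSeries.coeff_zero_eq_constantCoeff_apply, PowerSeries.coeff_mk,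
      show (0 : ℕ) = (fun k : ℤ => d * pentagonal k) 0 by simp [pentagonal], he.extend_apply]
    rfl
  · refine (hasSum_pentagonal (norm_ee_pow_lt_one hd τ)).congr_fun fun k => ?_
    rw [← pow_mul]
    push_cast
    congr 1
    rcases k.natAbs_eq with h | h <;> generalize k.natAbs = m at h <;> subst h <;>
      simp [← inv_pow]

/-- Integrality holds because `1 / euler` is the generating function of the pairs of charge zero:
the coefficients are cardinalities. -/
lemma exists_expansion_euler_inv {d : ℕ} (hd : d ≠ 0) :
    ∃ f : ℤ⟦X⟧, PowerSeries.constantCoeff f = 1 ∧ Expands f ((eulerFun d)⁻¹) := by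
  have hmem := expands_card (fun P : charge ⁻¹' {0} => d * pairWeight P)
    (Φ := (eulerFun d)⁻¹) fun τ => by
      have hq := norm_ee_pow_lt_one hd τ
      rw [Pi.inv_apply, eulerFun, ← chargeSum_zero hq (pow_ne_zero _ (ee_ne_zero _)), chargeSum]
      simp_rw [pow_mul]
      have hs := summable_norm_charge hq one_ne_zero
      simp only [one_zpow, one_mul] at hs
      exact (hs.of_norm.subtype (charge ⁻¹' {0})).hasSum
  refine ⟨_, ?_, hmem⟩
  obtain ⟨g, hg, hg'⟩ := exists_expansion_euler hd
  have h3 := congrArg PowerSeries.constantCoeff ((hmem.mul hg').unique expands_one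
    fun τ => inv_mul_cancel₀ (eulerFun_ne_zero hd τ))
  rwa [map_mul, hg, mul_one, map_one] at h3

lemma eta_eq_eulerFun (d : ℕ) (τ : ℍ) : eta (d * τ) = ee (τ / 24) ^ d * eulerFun d τ :=
  eta_nat_mul d τ

lemma ee_eq_pow (z : ℂ) : ee z = ee (z / 24) ^ 24 := by
  rw [← ee_nsmul]
  congr 1
  push_cast
  ring

/-- A point of the curve over the ring of integral power series, that represents `t`, `x`, `y`. -/
theorem exists_integralPoint : ∃ t x y : ℤ⟦X⟧, IntegralPoint t x y ∧
    Expands t (fun τ : ℍ => tFun τ) ∧ Expands x (fun τ : ℍ => xFun τ) ∧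
    Expands y (fun τ : ℍ => yFun τ) := by
  obtain ⟨f1, c1, h1⟩ := exists_expansion_euler_inv one_ne_zero
  obtain ⟨g1, -, k1⟩ := exists_expansion_euler one_ne_zero
  obtain ⟨g2, d2, k2⟩ := exists_expansion_euler two_ne_zero
  obtain ⟨g4, -, k4⟩ := exists_expansion_euler four_ne_zero
  obtain ⟨g5, -, k5⟩ := exists_expansion_euler (d := 5) (by norm_num)
  obtain ⟨f5, c5, h5⟩ := exists_expansion_euler_inv (d := 5) (by norm_num)
  obtain ⟨g10, d10, k10⟩ := exists_expansion_euler (d := 10) (by norm_num)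
  obtain ⟨f10, -, h10⟩ := exists_expansion_euler_inv (d := 10) (by norm_num)
  obtain ⟨g20, -, k20⟩ := exists_expansion_euler (d := 20) (by norm_num)
  have hη : ∀ τ : ℍ, eta τ = ee (τ / 24) * eulerFun 1 τ := fun τ => by
    simpa using eta_eq_eulerFun 1 τ
  have h2 : ∀ τ : ℍ, eta (2 * τ) = ee (τ / 24) ^ 2 * eulerFun 2 τ := fun τ => by
    simpa using eta_eq_eulerFun 2 τ
  have h4 : ∀ τ : ℍ, eta (4 * τ) = ee (τ / 24) ^ 4 * eulerFun 4 τ := fun τ => by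
    simpa using eta_eq_eulerFun 4 τ
  have hh5 : ∀ τ : ℍ, eta (5 * τ) = ee (τ / 24) ^ 5 * eulerFun 5 τ := fun τ => by
    simpa using eta_eq_eulerFun 5 τ
  have hh10 : ∀ τ : ℍ, eta (10 * τ) = ee (τ / 24) ^ 10 * eulerFun 10 τ := fun τ => by
    simpa using eta_eq_eulerFun 10 τ
  have h20 : ∀ τ : ℍ, eta (20 * τ) = ee (τ / 24) ^ 20 * eulerFun 20 τ := fun τ => by
    simpa using eta_eq_eulerFun 20 τ
  have ht : Expands (PowerSeries.X * g5 ^ 6 * f1 ^ 6) (fun τ : ℍ => tFun τ) := by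
    refine ((expands_X.mul (k5.pow 6)).mul (h1.pow 6)).congr fun τ => ?_
    simp only [Pi.inv_apply]
    rw [tFun, hh5, hη, ee_eq_pow τ]
    have := ee_ne_zero (τ / 24)
    have := eulerFun_ne_zero one_ne_zero τ
    field_simp
  have hx : Expands (PowerSeries.X * g2 * g10 ^ 3 * f1 ^ 3 * f5) (fun τ : ℍ => xFun τ) := by
    refine ((((expands_X.mul k2).mul (k10.pow 3)).mul (h1.pow 3)).mul h5).congr fun τ => ?_
    simp only [Pi.inv_apply]
    rw [xFun, hh5, hη, h2, hh10, ee_eq_pow τ]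
    have := ee_ne_zero (τ / 24)
    have := eulerFun_ne_zero one_ne_zero τ
    have := eulerFun_ne_zero (d := 5) (by norm_num) τ
    field_simp
  have hy : Expands (PowerSeries.X ^ 2 * g2 ^ 2 * g4 * g5 * g20 ^ 3 * f1 ^ 5 * f10 ^ 2)
      (fun τ : ℍ => yFun τ) := by
    refine (((((((expands_X.pow 2).mul (k2.pow 2)).mul k4).mul k5).mul (k20.pow 3)).mul
      (h1.pow 5)).mul (h10.pow 2)).congr fun τ => ?_
    simp only [Pi.inv_apply]
    rw [yFun, hh5, hη, h2, h4, hh10, h20, ee_eq_pow τ]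
    have := ee_ne_zero (τ / 24)
    have := eulerFun_ne_zero one_ne_zero τ
    have := eulerFun_ne_zero (d := 10) (by norm_num) τ
    field_simp
  refine ⟨_, _, _, ⟨?_, ?_, ?_, ?_⟩, ht, hx, hy⟩
  · exact (ht.mul (expands_one.add ((expands_ofNat 5).mul hx))).unique
      (hx.mul ((expands_one.add ((expands_ofNat 4).mul hx)).pow 2)) fun τ => tFun_mul τ.im_pos
  · exact ((((expands_ofNat 4).mul (hy.pow 2)).add hy).add (((expands_ofNat 6).mul hx).mul hy)).unique
      ((hx.pow 2).mul (expands_one.add ((expands_ofNat 5).mul hx))) fun τ => yFun_sq τ.im_pos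
  · simp
  · rw [mul_assoc, mul_assoc, mul_assoc, show (1 : ℕ) = 0 + 1 from rfl, PowerSeries.coeff_succ_X_mul,
      PowerSeries.coeff_zero_eq_constantCoeff_apply]
    simp [c1, c5, d2, d10]

/-! ### Integral expansions of the generating functions and transfer of congruences -/

lemma CPsi_expansion (β : Fin 2) {m : ℕ} (hm : m ≠ 0) : ∃ f : ℤ⟦X⟧,
    PowerSeries.constantCoeff f = cpsi β 0 ∧ Expands f (fun τ : ℍ => CPsi β (ee τ ^ m)) := by
  have he : Function.Injective fun n : ℕ => m * n := fun k l h =>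
    Nat.eq_of_mul_eq_mul_left (Nat.pos_of_ne_zero hm) h
  refine ⟨_, ?_, expands_of_injective he (fun n => cpsi β n) fun τ => ?_⟩
  · rw [← PowerSeries.coeff_zero_eq_constantCoeff_apply, PowerSeries.coeff_mk]
    exact he.extend_apply _ _ 0
  · refine ((summable_norm_cpsi β (norm_ee_pow_lt_one hm τ)).of_norm.hasSum).congr_fun fun n => ?_
    rw [← pow_mul]
    push_cast
    rfl

/-- Needed so that 5 does not divide the series of `CPsi` and this factor can be cancelled. The
values are read off from the eta quotients for the theta functions. -/
lemma cpsi_zero (β : Fin 2) : cpsi β 0 = if β = 0 then 2 else 1 := by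
  obtain ⟨f, hf, hf'⟩ := CPsi_expansion β one_ne_zero
  obtain ⟨g1, d1, k1⟩ := exists_expansion_euler one_ne_zero
  obtain ⟨g2, d2, k2⟩ := exists_expansion_euler two_ne_zero
  obtain ⟨g4, d4, k4⟩ := exists_expansion_euler four_ne_zero
  have hη : ∀ τ : ℍ, eta τ = ee (τ / 24) * eulerFun 1 τ := fun τ => by
    simpa using eta_eq_eulerFun 1 τ
  have h2 : ∀ τ : ℍ, eta (2 * τ) = ee (τ / 24) ^ 2 * eulerFun 2 τ := fun τ => by
    simpa using eta_eq_eulerFun 2 τ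
  have h4 : ∀ τ : ℍ, eta (4 * τ) = ee (τ / 24) ^ 4 * eulerFun 4 τ := fun τ => by
    simpa using eta_eq_eulerFun 4 τ
  have key : ∀ τ : ℍ, _ := fun τ => theta_eq_CPsi β τ.im_pos
  obtain rfl | rfl : β = 0 ∨ β = 1 := by omega
  · have h : g1 ^ 2 * g2 * f = 2 * g4 ^ 2 := by
      refine (((k1.pow 2).mul k2).mul hf').unique ((expands_ofNat 2).mul (k4.pow 2)) fun τ => ?_
      have h1 : thB τ = _ := key τ
      have e4 : ee (level 0 0 * τ / 24) = ee (τ / 24) ^ 4 := by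
        rw [← ee_nsmul]
        congr 1
        simp [level]
        ring
      rw [thB_eq τ.im_pos, h2, h4, hη, e4] at h1
      have := ee_ne_zero (τ / 24)
      have := eulerFun_ne_zero two_ne_zero τ
      field_simp at h1
      rw [pow_one]
      linear_combination -h1
    have h3 := congrArg PowerSeries.constantCoeff h
    simp only [map_mul, map_pow, map_ofNat, d1, d2, d4, hf] at h3
    norm_num at h3
    exact_mod_cast h3
  · have h : g1 ^ 4 * g4 ^ 2 * f = g2 ^ 5 := by
      refine (((k1.pow 4).mul (k4.pow 2)).mul hf').unique (k2.pow 5) fun τ => ?_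
      have h1 : thA τ = _ := key τ
      have e4 : ee (level 1 0 * τ / 24) = (ee (τ / 24) ^ 2)⁻¹ := by
        rw [← mul_eq_one_iff_eq_inv₀ (pow_ne_zero _ (ee_ne_zero _)), ← ee_nsmul, ← ee_add, ← ee_int 0]
        congr 1
        simp [level]
        ring
      rw [thA_eq τ.im_pos, h2, h4, hη, e4] at h1
      have := ee_ne_zero (τ / 24)
      have := eulerFun_ne_zero four_ne_zero τ
      have := eulerFun_ne_zero one_ne_zero τ
      field_simp at h1
      rw [pow_one]
      linear_combination -h1
    have h3 := congrArg PowerSeries.constantCoeff h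
    simp only [map_mul, map_pow, d1, d2, d4, hf] at h3
    norm_num at h3
    exact_mod_cast h3

lemma classSum_expansion (β : Fin 2) {α : ℕ} (hα : 1 ≤ α) : ∃ f : ℤ⟦X⟧,
    (CongruenceAt β α ↔ 5 ^ α ∣ f) ∧ Expands f (fun τ : ℍ => classSum β α (ee τ)) := by
  -- Within the residue class `level β n`, and with it `n`, is recovered from the exponent. So each
  -- coefficient of the series is a single value of `cpsi`, or zero.
  have he : Function.Injective fun n : {n : ℕ // InClass β α n} => (n : ℕ) / 5 ^ α + (β : ℕ) :=
    fun m n h => by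
      have h1 := level_of_inClass hα m.2
      have h2 := level_of_inClass hα n.2
      simp only [add_left_inj] at h
      rw [h, ← h2] at h1
      rw [level_eq β m, level_eq β n] at h1
      exact Subtype.ext (by omega)
  refine ⟨_, ?_, expands_of_injective he (fun n => cpsi β n) fun τ => ?_⟩
  · rw [pow_five_dvd_powerSeries_iff]
    constructor
    · intro h n
      rw [PowerSeries.coeff_mk]
      by_cases hn : ∃ i : {n : ℕ // InClass β α n}, (i : ℕ) / 5 ^ α + (β : ℕ) = n
      · obtain ⟨i, rfl⟩ := hn
        have h1 := he.extend_apply (fun n => (cpsi β n : ℤ)) 0 i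
        rw [h1]
        exact_mod_cast h i i.2
      · rw [Function.extend_apply' _ _ _ hn]
        exact dvd_zero _
    · intro h n hn
      have h1 := h (n / 5 ^ α + (β : ℕ))
      rw [PowerSeries.coeff_mk] at h1
      have h2 := he.extend_apply (fun n => (cpsi β n : ℤ)) 0 ⟨n, hn⟩
      simp only at h2
      rw [h2] at h1
      exact_mod_cast h1
  · have hs : Summable fun n : {n : ℕ // InClass β α n} =>
        (cpsi β n : ℂ) * ee τ ^ ((n : ℕ) / 5 ^ α + (β : ℕ)) := by
      refine Summable.of_norm ((summable_class β α ‖ee τ‖ (norm_pos_iff.mpr (ee_ne_zero _))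
        (norm_ee_coe_lt_one τ)).congr fun n => ?_)
      rw [norm_mul, norm_pow, Complex.norm_natCast]
    refine hs.hasSum.congr_fun fun n => ?_
    push_cast
    rfl

/-- A ℚ-linear functional on ℂ that does not vanish at `v i₀` maps the complex solution to a
rational one, and clearing denominators makes it integral. The set of equations may be infinite. -/
lemma exists_int_solution {ι κ : Type*} [Fintype ι] (A : κ → ι → ℤ) {v : ι → ℂ}
    (h : ∀ k, ∑ i, v i * (A k i : ℂ) = 0) {i₀ : ι} (h0 : v i₀ ≠ 0) :
    ∃ w : ι → ℤ, w i₀ ≠ 0 ∧ ∀ k, ∑ i, w i * A k i = 0 := by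
  obtain ⟨φ, hφ⟩ : ∃ φ : Module.Dual ℚ ℂ, φ (v i₀) ≠ 0 := by
    by_contra! hall
    exact h0 ((Module.forall_dual_apply_eq_zero_iff ℚ (v i₀)).mp hall)
  obtain ⟨b, hb⟩ := IsLocalization.exist_integer_multiples_of_finite (nonZeroDivisors ℤ)
    fun i => φ (v i)
  choose w hw using hb
  have hw' : ∀ i, (w i : ℚ) = (b : ℤ) * φ (v i) := fun i => by simpa using hw i
  have hb0 : ((b : ℤ) : ℚ) ≠ 0 := by
    exact_mod_cast nonZeroDivisors.coe_ne_zero b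
  refine ⟨w, fun h1 => ?_, fun k => ?_⟩
  · have := hw' i₀
    rw [h1, Int.cast_zero] at this
    exact mul_ne_zero hb0 hφ this.symm
  · have h1 := congrArg φ (h k)
    rw [map_sum, map_zero] at h1
    have h2 : ∀ i, φ (v i * (A k i : ℂ)) = φ (v i) * A k i := fun i => by
      rw [mul_comm, ← zsmul_eq_mul, map_zsmul, zsmul_eq_mul, mul_comm]
    have h3 : ((∑ i, w i * A k i : ℤ) : ℚ) = 0 := by
      push_cast
      simp_rw [hw', mul_assoc, ← Finset.mul_sum, ← h2, h1, mul_zero]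
    exact_mod_cast h3

lemma expands_genPoly {t x y : ℤ⟦X⟧} {Φ Ψ Ω : ℍ → ℂ} (ht : Expands t Φ) (hx : Expands x Ψ)
    (hy : Expands y Ω) (β a : Fin 2) :
    Expands (genPoly β a t x y) fun τ => genPoly β a (Φ τ) (Ψ τ) (Ω τ) := by
  have m := fun (n : ℕ) [n.AtLeastTwo] => expands_ofNat n
  have t2 := ht.pow 2
  have x2 := hx.pow 2
  match β, a with
  | 0, 0 =>
    exact ((((((((((((expands_one.add ((m 5).mul ht)).add ((m 64).mul hx)).add
      (((m 600).mul ht).mul hx)).add ((m 208).mul x2)).add (((m 2000).mul ht).mul x2)).add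
      ((m 4).mul hy)).add (((m 1000).mul ht).mul hy)).add (((m 12500).mul t2).mul hy)).sub
      (((m 992).mul hx).mul hy)).sub ((((m 12000).mul ht).mul hx).mul hy)).sub
      (((m 3520).mul x2).mul hy)).sub ((((m 40000).mul ht).mul x2).mul hy))
  | 0, 1 =>
    exact ((((((((((((expands_one.add ((m 9).mul ht)).add ((m 8).mul hx)).add
      (((m 64).mul ht).mul hx)).add ((m 16).mul x2)).add (((m 80).mul ht).mul x2)).add
      ((m 4).mul hy)).add (((m 8).mul ht).mul hy)).add (((m 500).mul t2).mul hy)).add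
      (((m 32).mul hx).mul hy)).sub ((((m 480).mul ht).mul hx).mul hy)).add
      (((m 64).mul x2).mul hy)).sub ((((m 1600).mul ht).mul x2).mul hy))
  | 1, 0 =>
    exact (((((((((((m 85).mul ht).add ((m 625).mul t2)).sub ((m 24).mul hx)).sub
      ((m 64).mul x2)).sub ((m 4).mul hy)).sub (((m 1000).mul ht).mul hy)).sub
      (((m 12500).mul t2).mul hy)).add (((m 992).mul hx).mul hy)).add
      ((((m 12000).mul ht).mul hx).mul hy)).add (((m 3520).mul x2).mul hy)).add
      ((((m 40000).mul ht).mul x2).mul hy)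
  | 1, 1 =>
    exact (((((((((ht.add ((m 25).mul t2)).sub (((m 8).mul ht).mul hx)).sub ((m 4).mul hy)).sub
      (((m 8).mul ht).mul hy)).sub (((m 500).mul t2).mul hy)).sub (((m 32).mul hx).mul hy)).add
      ((((m 480).mul ht).mul hx).mul hy)).sub (((m 64).mul x2).mul hy)).add
      ((((m 1600).mul ht).mul x2).mul hy))

lemma CPsi_ne_zero (β : Fin 2) (τ : ℍ) : CPsi β (ee τ) ≠ 0 := fun h => by
  have h1 := theta_eq_CPsi β τ.im_pos
  rw [h, mul_zero] at h1
  have h2 := eta_ne_zero' τ.im_pos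
  have h3 := eta_ne_zero' (im_ofNat_mul τ.im_pos 2 two_pos)
  have h4 := eta_ne_zero' (im_ofNat_mul τ.im_pos 4 four_pos)
  revert h1
  obtain rfl | rfl : β = 0 ∨ β = 1 := by omega
  · change thB τ ≠ 0
    rw [thB_eq τ.im_pos]
    exact div_ne_zero (mul_ne_zero two_ne_zero (pow_ne_zero _ h4)) h3
  · change thA τ ≠ 0
    rw [thA_eq τ.im_pos]
    exact div_ne_zero (pow_ne_zero _ h3) (mul_ne_zero (pow_ne_zero _ h2) (pow_ne_zero _ h4))

lemma CPsi_pow_ne_zero (β : Fin 2) (τ : ℍ) {m : ℕ} (hm : m ≠ 0) : CPsi β (ee τ ^ m) ≠ 0 := by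
  obtain ⟨w, hw⟩ := exists_ee_eq (pow_ne_zero m (ee_ne_zero τ)) (norm_ee_pow_lt_one hm τ)
  rw [← hw]
  exact CPsi_ne_zero β w

open Polynomial in
/-- The two congruence families are equivalent. -/
theorem congruenceAt_iff {α : ℕ} (hα : 1 ≤ α) (β β' : Fin 2) (hβ : CongruenceAt β α) :
    CongruenceAt β' α := by
  obtain ⟨D, F, G, hD, hrel⟩ := exists_polynomials α (a := ⟨α % 2, Nat.mod_lt _ two_pos⟩) rfl
  set a : Fin 2 := ⟨α % 2, Nat.mod_lt _ two_pos⟩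
  obtain ⟨t, x, y, H, ht, hx, hy⟩ := exists_integralPoint
  have hm : 1 + 4 * (α % 2) ≠ 0 := by omega
  choose l hl hl' using fun β => classSum_expansion β hα
  choose c hc hc' using fun β => CPsi_expansion β hm
  obtain ⟨N, hND, hNF, hNG⟩ : ∃ N, D.natDegree < N ∧ F.natDegree < N ∧ G.natDegree < N :=
    ⟨D.natDegree + F.natDegree + G.natDegree + 1, by omega, by omega, by omega⟩
  -- After multiplication by `CPsi`, the relation `D L = F + G p` is a finite linear relation
  -- between integral series, with the coefficients of `D`, `F`, `G` as unknowns.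
  let f : Fin 2 → Fin 3 × Fin N → ℤ⟦X⟧ := fun β s =>
    ![t ^ (s.2 : ℕ) * l β, t ^ (s.2 : ℕ) * c β, t ^ (s.2 : ℕ) * genPoly β a t x y * c β] s.1
  let Φ : Fin 2 → Fin 3 × Fin N → ℍ → ℂ := fun β s =>
    ![fun τ : ℍ => tFun τ ^ (s.2 : ℕ) * classSum β α (ee τ),
      fun τ : ℍ => tFun τ ^ (s.2 : ℕ) * CPsi β (ee τ ^ (1 + 4 * (α % 2))),
      fun τ : ℍ => tFun τ ^ (s.2 : ℕ) * pFun β a τ * CPsi β (ee τ ^ (1 + 4 * (α % 2)))] s.1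
  let v : Fin 3 × Fin N → ℂ := fun s =>
    ![5 ^ α * D.coeff s.2, -F.coeff s.2, -G.coeff s.2] s.1
  have hf : ∀ β s, Expands (f β s) (Φ β s) := fun β s => by
    obtain ⟨i, j⟩ := s
    fin_cases i
    · exact (ht.pow _).mul (hl' β)
    · exact (ht.pow _).mul (hc' β)
    · exact ((ht.pow _).mul (expands_genPoly ht hx hy β a)).mul (hc' β)
  have hv : ∀ β τ, ∑ s, v s * Φ β s τ = 0 := fun β τ => by
    have h1 := hrel β τ
    have hC := CPsi_pow_ne_zero β τ hm
    rw [thetaRatio_eq β hα, eval_eq_sum_range' hND, eval_eq_sum_range' hNF,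
      eval_eq_sum_range' hNG, ← mul_div_assoc, div_eq_iff hC] at h1
    simp only [Fintype.sum_prod_type, Fin.sum_univ_three, v, Φ, Matrix.cons_val]
    simp only [Finset.sum_range, Finset.sum_mul, add_mul] at h1
    rw [← sub_eq_zero] at h1
    rw [← h1, sub_add_eq_sub_sub, sub_eq_add_neg, sub_eq_add_neg, ← Finset.sum_neg_distrib,
      ← Finset.sum_neg_distrib]
    refine congrArg₂ _ (congrArg₂ _ ?_ ?_) ?_ <;> refine Finset.sum_congr rfl fun i _ => by ring
  obtain ⟨i₀, hi₀⟩ : ∃ i : Fin N, D.coeff i ≠ 0 :=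
    ⟨⟨D.natDegree, hND⟩, leadingCoeff_ne_zero.mpr hD⟩
  -- The equations are indexed by pairs `(β, n)`, so one integral solution serves both values of
  -- `β`. A nonzero coefficient of `D` stays nonzero.
  obtain ⟨w, hw0, hw⟩ := exists_int_solution
    (fun (k : Fin 2 × ℕ) s => PowerSeries.coeff k.2 (f k.1 s)) (v := v)
    (fun k => coeff_relation v (hf k.1) (hv k.1) k.2) (i₀ := (0, i₀))
    (mul_ne_zero (by norm_num) hi₀)
  let P : Fin 3 → ℤ[X] := fun i => ∑ j : Fin N, C (w (i, j)) * X ^ (j : ℕ)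
  have hP : ∀ i, aeval t (P i) = ∑ j : Fin N, (w (i, j) : ℤ⟦X⟧) * t ^ (j : ℕ) := fun i => by
    simp only [P, map_sum, map_mul, map_pow, aeval_X, aeval_C]
    simp
  have hP0 : P 0 ≠ 0 := fun h0 => hw0 (by
    have := congrArg (fun p => p.coeff i₀) h0
    simpa [P, finsetSum_coeff, coeff_X_pow, Fin.val_inj] using this)
  have hser : ∀ β, ∑ s, (w s : ℤ⟦X⟧) * f β s = 0 := fun β => by
    ext n
    have := hw (β, n)
    rw [map_sum, map_zero, ← this]
    refine Finset.sum_congr rfl fun s _ => ?_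
    rw [← zsmul_eq_mul, map_zsmul, smul_eq_mul]
  rw [hl] at hβ ⊢
  refine H.pow_five_dvd_of_relation (D := P 0) (F := -P 1) (G := -P 2) (a := a) (c := c)
    (fun β h5 => ?_) hP0 (fun β => ?_) α β β' hβ
  · have h1 := map_dvd PowerSeries.constantCoeff h5
    rw [map_ofNat, hc, cpsi_zero] at h1
    split_ifs at h1 <;> norm_num at h1
  · have h1 := hser β
    simp only [Fintype.sum_prod_type, Fin.sum_univ_three, f, Matrix.cons_val] at h1
    rw [map_neg, map_neg, hP, hP, hP, ← sub_eq_zero, ← h1]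
    simp only [neg_mul, add_mul, Finset.sum_mul, sub_eq_add_neg, neg_add, neg_neg]
    rw [add_assoc]
    refine congrArg₂ _ ?_ (congrArg₂ _ ?_ ?_) <;> refine Finset.sum_congr rfl fun i _ => by ring

end

section

open ModularForm (eta)
open Filter Topology

/-! ### Passage to meromorphic functions -/

/-- Evaluation at a point. -/
def evalAt (τ : ℍ) : Hol →+* ℂ := (Pi.evalRingHom (fun _ : ℍ => ℂ) τ).comp Hol.val.toRingHom

lemma evalAt_apply (τ : ℍ) (f : Hol) : evalAt τ f = (f : ℍ → ℂ) τ := rfl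

lemma hol_ext {f g : Hol} (h : ∀ τ, evalAt τ f = evalAt τ g) : f = g :=
  Subtype.ext (funext h)

/-- `η(d τ)` -/
def etaHol (d : ℕ) (hd : 0 < d := by norm_num) : Hol := ⟨_, eta_mem d hd⟩

/-- The inverse of a function without zeros. -/
lemma exists_inv (f : Hol) (h : ∀ τ, evalAt τ f ≠ 0) : ∃ g : Hol, ∀ τ, evalAt τ g = (evalAt τ f)⁻¹ :=
  ⟨⟨_, inv_mem_Hol f.2 h⟩, fun _ => rfl⟩

lemma exists_div (f g : Hol) (h : ∀ τ, evalAt τ g ≠ 0) : ∃ k : Hol,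
    (∀ τ, evalAt τ k = evalAt τ f / evalAt τ g) ∧
      algebraMap Hol Mer k = algebraMap Hol Mer f / algebraMap Hol Mer g := by
  obtain ⟨i, hi⟩ := exists_inv g h
  have h1 : f * i * g = f := hol_ext fun τ => by
    rw [map_mul, map_mul, hi, inv_mul_cancel_right₀ (h τ)]
  have hg : algebraMap Hol Mer g ≠ 0 := fun h0 => by
    have := (IsFractionRing.injective Hol Mer) (h0.trans (map_zero _).symm)
    apply h UpperHalfPlane.I
    rw [this, map_zero]
  refine ⟨f * i, fun τ => ?_, ?_⟩
  · rw [map_mul, hi, div_eq_mul_inv]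
  · rw [eq_div_iff hg, ← map_mul, h1]

lemma evalAt_etaHol (d : ℕ) (hd : 0 < d) (τ : ℍ) : evalAt τ (etaHol d hd) = eta (d * τ) := rfl

lemma evalAt_etaHol_ne_zero (d : ℕ) (hd : 0 < d) (τ : ℍ) : evalAt τ (etaHol d hd) ≠ 0 := by
  rw [evalAt_etaHol]
  exact eta_ne_zero' (by simpa using mul_pos (Nat.cast_pos.mpr hd) τ.im_pos)

lemma exists_tHol : ∃ f : Hol, (∀ τ : ℍ, evalAt τ f = tFun τ) ∧ algebraMap Hol Mer f = t := by
  obtain ⟨k, hk, hk'⟩ := exists_div (etaHol 5 ^ 6) (etaHol 1 ^ 6) fun τ => by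
    rw [map_pow]
    exact pow_ne_zero _ (evalAt_etaHol_ne_zero _ _ τ)
  refine ⟨k, fun τ => ?_, ?_⟩
  · rw [hk]
    simp only [map_pow, evalAt_etaHol]
    simp [tFun]
  · rw [hk', map_pow, map_pow]
    rfl

lemma exists_xHol : ∃ f : Hol, (∀ τ : ℍ, evalAt τ f = xFun τ) ∧ algebraMap Hol Mer f = x := by
  obtain ⟨k, hk, hk'⟩ := exists_div (etaHol 2 * etaHol 10 ^ 3) (etaHol 1 ^ 3 * etaHol 5)
    fun τ => by
      rw [map_mul, map_pow]
      exact mul_ne_zero (pow_ne_zero _ (evalAt_etaHol_ne_zero _ _ τ)) (evalAt_etaHol_ne_zero _ _ τ)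
  refine ⟨k, fun τ => ?_, ?_⟩
  · rw [hk]
    simp only [map_mul, map_pow, evalAt_etaHol]
    simp [xFun]
  · rw [hk', map_mul, map_mul, map_pow, map_pow]
    rfl

lemma exists_yHol : ∃ f : Hol, (∀ τ : ℍ, evalAt τ f = yFun τ) ∧ algebraMap Hol Mer f = y := by
  obtain ⟨k, hk, hk'⟩ := exists_div (etaHol 2 ^ 2 * etaHol 4 * etaHol 5 * etaHol 20 ^ 3)
    (etaHol 1 ^ 5 * etaHol 10 ^ 2) fun τ => by
      rw [map_mul, map_pow, map_pow]
      exact mul_ne_zero (pow_ne_zero _ (evalAt_etaHol_ne_zero _ _ τ))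
        (pow_ne_zero _ (evalAt_etaHol_ne_zero _ _ τ))
  refine ⟨k, fun τ => ?_, ?_⟩
  · rw [hk]
    simp only [map_mul, map_pow, evalAt_etaHol]
    simp [yFun]
  · rw [hk', map_mul, map_mul, map_mul, map_mul, map_pow, map_pow, map_pow, map_pow]
    rfl

lemma exists_pHol (β a : Fin 2) : ∃ f : Hol, (∀ τ : ℍ, evalAt τ f = pFun β a τ) ∧
    algebraMap Hol Mer f = p β a := by
  obtain ⟨ft, ht, ht'⟩ := exists_tHol
  obtain ⟨fx, hx, hx'⟩ := exists_xHol
  obtain ⟨fy, hy, hy'⟩ := exists_yHol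
  refine ⟨genPoly β a ft fx fy, fun τ => ?_, ?_⟩
  · rw [map_genPoly, ht, hx, hy, pFun]
  · rw [map_genPoly, ht', hx', hy', p_eq_genPoly]

lemma exists_LHol (β : Fin 2) {α : ℕ} (hα : 1 ≤ α) : ∃ f : Hol,
    (∀ τ : ℍ, evalAt τ f = thetaRatio β α τ / 5 ^ α) ∧ algebraMap Hol Mer f = L β α := by
  have hm : 1 + 4 * (α % 2) ≠ 0 := by omega
  obtain ⟨k, hk, hk'⟩ := exists_div ⟨_, classSum_mem β α⟩ ⟨_, CPsi_mem β (1 + 4 * (α % 2)) (by omega)⟩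
    fun τ => by
      rw [evalAt_apply]
      simp only [qParam_eq_ee]
      exact CPsi_pow_ne_zero β τ hm
  refine ⟨k, fun τ => ?_, ?_⟩
  · rw [hk, evalAt_apply, evalAt_apply, thetaRatio_eq β hα]
    simp only [qParam_eq_ee]
    field_simp
  · rw [hk']
    rfl

lemma merComp_algebraMap (g : SL(2, ℤ)) {f k : Hol} (h : ∀ τ, evalAt (g • τ) f = evalAt τ k) :
    merComp g (algebraMap Hol Mer f) = algebraMap Hol Mer k := by
  rw [merComp, IsFractionRing.ringEquivOfRingEquiv_algebraMap]
  congr 1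
  exact hol_ext h

/-! ### The isomorphisms induced by `gam` and its inverse -/

lemma one_sub_one_sub (β : Fin 2) : 1 - (1 - β) = β := by
  revert β
  decide

/-- The matrix by which `σ^{(β)}` is induced. -/
def twist (β : Fin 2) : SL(2, ℤ) := if β = 1 then gam else gam⁻¹

/-- `β ↦ 1 - β` is an involution, so `gam⁻¹` exchanges the indices just as `gam` does. -/
lemma comp_twist {X : Type*} (f : Fin 2 → ℍ → X) (h : ∀ β τ, f β (gam • τ) = f (1 - β) τ)
    (β γ : Fin 2) (τ : ℍ) : f β (twist γ • τ) = f (1 - β) τ := by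
  rw [twist]
  split_ifs
  · exact h β τ
  · have h1 := h (1 - β) (gam⁻¹ • τ)
    rw [smul_inv_smul, one_sub_one_sub] at h1
    exact h1.symm

lemma merComp_p (γ β a : Fin 2) : merComp (twist γ) (p β a) = p (1 - β) a := by
  obtain ⟨f, hf, hf'⟩ := exists_pHol β a
  obtain ⟨k, hk, hk'⟩ := exists_pHol (1 - β) a
  rw [← hf', ← hk']
  refine merComp_algebraMap _ fun τ => ?_
  rw [hf, hk]
  exact comp_twist (fun β (τ : ℍ) => pFun β a τ) (fun β τ => pFun_gam β a τ) β γ τ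

lemma merComp_L (γ β : Fin 2) {α : ℕ} (hα : 1 ≤ α) : merComp (twist γ) (L β α) = L (1 - β) α := by
  obtain ⟨f, hf, hf'⟩ := exists_LHol β hα
  obtain ⟨k, hk, hk'⟩ := exists_LHol (1 - β) hα
  rw [← hf', ← hk']
  refine merComp_algebraMap _ fun τ => ?_
  rw [hf, hk, comp_twist (fun β (τ : ℍ) => thetaRatio β α τ) (fun β τ => thetaRatio_gam β α τ) β γ τ]

lemma merComp_t (γ : Fin 2) : merComp (twist γ) t = t := by
  obtain ⟨f, hf, hf'⟩ := exists_tHol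
  rw [← hf']
  refine merComp_algebraMap _ fun τ => ?_
  rw [hf, hf]
  exact comp_twist (fun _ (τ : ℍ) => tFun τ) (fun _ τ => t_invariant gam five_dvd_gam τ) 0 γ τ

lemma merComp_algebraMap_complex (g : SL(2, ℤ)) (c : ℂ) :
    merComp g (algebraMap ℂ Mer c) = algebraMap ℂ Mer c := by
  rw [IsScalarTower.algebraMap_apply ℂ Hol Mer]
  exact merComp_algebraMap g fun τ => rfl

lemma merComp_of_mem_Ct (γ : Fin 2) {f : Mer} (hf : f ∈ Ct) : merComp (twist γ) f = f := by
  induction hf using IntermediateField.adjoin_induction with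
  | mem f hf =>
    rw [Set.mem_singleton_iff.mp hf, merComp_t]
  | algebraMap c => exact merComp_algebraMap_complex _ c
  | add f g _ _ h1 h2 => rw [RingEquiv.map_add, h1, h2]
  | mul f g _ _ h1 h2 => rw [RingEquiv.map_mul, h1, h2]
  | inv f _ h1 => rw [map_inv₀, h1]

/-- The automorphism of the field of meromorphic functions over `ℂ(t)` that is given by `twist`. -/
def twistEquiv (γ : Fin 2) : Mer ≃ₐ[Ct] Mer :=
  AlgEquiv.ofRingEquiv (f := merComp (twist γ)) fun c => merComp_of_mem_Ct γ c.2

lemma twistEquiv_apply (γ : Fin 2) (f : Mer) : twistEquiv γ f = merComp (twist γ) f := rfl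

lemma map_twistEquiv_A (γ β : Fin 2) :
    (A β).map (twistEquiv γ).toAlgHom = A (1 - β) := by
  rw [A, A, AlgHom.map_adjoin, Set.image_pair]
  simp only [AlgEquiv.toAlgHom_apply, twistEquiv_apply, merComp_p]

lemma map_twistEquiv_R (γ β : Fin 2) :
    (R β).map (twistEquiv γ).toLinearMap = R (1 - β) := by
  rw [R, R, Submodule.map_span, Set.image_insert_eq, Set.image_pair]
  simp only [AlgEquiv.toLinearMap_apply, twistEquiv_apply, merComp_p, map_one]

lemma mem_A_iff (β : Fin 2) (f : Mer) : f ∈ A β ↔ merComp (twist β) f ∈ A (1 - β) := by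
  rw [← map_twistEquiv_A β β]
  exact (Function.Injective.mem_set_image (f := twistEquiv β) (twistEquiv β).injective).symm

/-- The isomorphism `σ^{(β)}`. -/
def sigma (β : Fin 2) : A β ≃+* A (1 - β) where
  toFun f := ⟨merComp (twist β) f, (mem_A_iff β f).mp f.2⟩
  invFun f := ⟨(merComp (twist β)).symm f,
    (mem_A_iff β _).mpr (by rw [RingEquiv.apply_symm_apply]; exact f.2)⟩
  left_inv f := Subtype.ext (RingEquiv.symm_apply_apply _ _)
  right_inv f := Subtype.ext (RingEquiv.apply_symm_apply _ _)
  map_mul' f g := Subtype.ext (RingEquiv.map_mul _ _ _)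
  map_add' f g := Subtype.ext (RingEquiv.map_add _ _ _)

lemma mem_R_iff (β : Fin 2) (f : Mer) : f ∈ R β ↔ merComp (twist β) f ∈ R (1 - β) := by
  rw [← map_twistEquiv_R β β]
  exact (Function.Injective.mem_set_image (f := twistEquiv β) (twistEquiv β).injective).symm

open Polynomial in
-- Near infinity `t` takes nonzero values tending to zero. Some of them avoid the finitely many
-- roots of `D`.
lemma aeval_t_ne_zero {D : ℂ[X]} (hD : D ≠ 0) : aeval t D ≠ 0 := fun h => by
  obtain ⟨f, hf, hf'⟩ := exists_tHol
  rw [← hf', aeval_algebraMap_apply, map_eq_zero_iff _ (IsFractionRing.injective Hol Mer)] at h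
  have h1 : ∀ τ : ℍ, D.eval (tFun τ) = 0 := fun τ => by
    have h2 := congrArg (evalAt τ) h
    rw [aeval_def, hom_eval₂, map_zero, hf] at h2
    exact h2
  have h2 : ((D.roots.toFinset.erase 0 : Finset ℂ) : Set ℂ)ᶜ ∈ 𝓝 (0 : ℂ) :=
    (Finset.finite_toSet _).isClosed.isOpen_compl.mem_nhds (by simp)
  obtain ⟨z, hz, hz'⟩ := ((tendsto_tFun.eventually h2).and eventually_im_pos).exists
  apply hz
  simp only [Finset.coe_erase, Set.mem_sdiff, Finset.mem_coe, Multiset.mem_toFinset,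
    Set.mem_singleton_iff]
  exact ⟨(mem_roots hD).mpr (h1 ⟨z, hz'⟩), tFun_ne_zero hz'⟩

open Polynomial in
lemma aeval_t_mem_Ct (D : ℂ[X]) : aeval t D ∈ Ct :=
  IntermediateField.algebra_adjoin_le_adjoin _ _ (aeval_mem_adjoin_singleton ℂ t)

open Polynomial in
lemma L_mem_R (β : Fin 2) {α : ℕ} (hα : 1 ≤ α) : L β α ∈ R β := by
  obtain ⟨D, F, G, hD, hrel⟩ := exists_polynomials α (a := ⟨α % 2, Nat.mod_lt _ two_pos⟩) rfl
  set a : Fin 2 := ⟨α % 2, Nat.mod_lt _ two_pos⟩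
  obtain ⟨ft, ht, ht'⟩ := exists_tHol
  obtain ⟨fp, hp, hp'⟩ := exists_pHol β a
  obtain ⟨fL, hL, hL'⟩ := exists_LHol β hα
  have heval : ∀ (P : ℂ[X]) τ, evalAt τ (aeval ft P) = P.eval (tFun τ) := fun P τ => by
    rw [aeval_def, hom_eval₂, ht]
    rfl
  have h1 : aeval ft (C (5 ^ α) * D) * fL = aeval ft F + aeval ft G * fp := hol_ext fun τ => by
    rw [RingHom.map_mul, RingHom.map_add, RingHom.map_mul, heval, heval, heval, hL, hp, ← hrel,
      eval_mul, eval_C]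
    field_simp
  have h2 := congrArg (algebraMap Hol Mer) h1
  rw [RingHom.map_mul, RingHom.map_add, RingHom.map_mul, ← aeval_algebraMap_apply, ← aeval_algebraMap_apply,
    ← aeval_algebraMap_apply, ht', hp', hL'] at h2
  have h3 : aeval t (C (5 ^ α) * D) ≠ 0 :=
    aeval_t_ne_zero (mul_ne_zero (C_ne_zero.mpr (pow_ne_zero _ (by norm_num))) hD)
  have h4 : L β α = (⟨_, div_mem (aeval_t_mem_Ct F) (aeval_t_mem_Ct (C (5 ^ α) * D))⟩ : Ct) • 1 +
      (⟨_, div_mem (aeval_t_mem_Ct G) (aeval_t_mem_Ct (C (5 ^ α) * D))⟩ : Ct) • p β a := by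
    change L β α = _ / _ * 1 + _ / _ * p β a
    field_simp
    rw [mul_comm, h2]
  rw [h4]
  exact add_mem (Submodule.smul_mem _ _ (Submodule.subset_span (by simp)))
    (Submodule.smul_mem _ _ (p_mem_R β a))

/-- `A β` is generated over ℂ(t) by the two `p_a^{(β)}`, on which the values are prescribed. -/
lemma sigma_unique (β : Fin 2) (σ' : A β →+* A (1 - β))
    (hC : ∀ f : A β, (f : Mer) ∈ Ct → (σ' f : Mer) = f)
    (hp : ∀ a, (σ' ⟨p β a, R_le_A β (p_mem_R β a)⟩ : Mer) = p (1 - β) a) (f : A β) :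
    σ' f = sigma β f := by
  obtain ⟨f, hf⟩ := f
  induction hf using Algebra.adjoin_induction with
  | mem f hf =>
    obtain ⟨a, rfl⟩ : ∃ a, f = p β a := by
      rcases hf with rfl | rfl
      exacts [⟨0, rfl⟩, ⟨1, rfl⟩]
    exact Subtype.ext ((hp a).trans (merComp_p β β a).symm)
  | algebraMap c => exact Subtype.ext ((hC ⟨_, _⟩ c.2).trans (merComp_of_mem_Ct β c.2).symm)
  | add f g hf hg h1 h2 =>
    have h := congrArg₂ (· + ·) h1 h2
    rw [← RingHom.map_add, ← RingEquiv.map_add] at h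
    exact h
  | mul f g hf hg h1 h2 =>
    have h := congrArg₂ (· * ·) h1 h2
    rw [← RingHom.map_mul, ← RingEquiv.map_mul] at h
    exact h

lemma gam_mem : gam ∈ CongruenceSubgroup.Gamma0 10 := by
  rw [CongruenceSubgroup.Gamma0_mem]
  decide

end

end FrobeniusPairs

end

open FrobeniusPairs in
theorem theorem4 :
    gam ∈ CongruenceSubgroup.Gamma0 10 ∧
    ∃ σ : ∀ β : Fin 2, A β ≃+* A (1 - β),
      -- `σ β` fixes `ℂ(t)` elementwise and sends `p_a^{(β)}` to `p_a^{(1-β)}`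
      (∀ β, ∀ f : A β, (f : Mer) ∈ Ct → (σ β f : Mer) = f) ∧
      (∀ β a, (σ β ⟨p β a, R_le_A β (p_mem_R β a)⟩ : Mer) = p (1 - β) a) ∧
      -- it is the only ring homomorphism with these properties
      (∀ β, ∀ σ' : A β →+* A (1 - β),
        (∀ f : A β, (f : Mer) ∈ Ct → (σ' f : Mer) = f) →
        (∀ a, (σ' ⟨p β a, R_le_A β (p_mem_R β a)⟩ : Mer) = p (1 - β) a) →
        ∀ f, σ' f = σ β f) ∧
      -- it carries `R^{(β)}` onto `R^{(1-β)}`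
      (∀ β, ∀ f : A β, (f : Mer) ∈ R β ↔ (σ β f : Mer) ∈ R (1 - β)) ∧
      -- `L_α^{(β)}` lies in `R^{(β)}` and is carried to `L_α^{(1-β)}`
      (∀ β, ∀ α : ℕ, 1 ≤ α → ∃ h : L β α ∈ R β,
        (σ β ⟨L β α, R_le_A β h⟩ : Mer) = L (1 - β) α) ∧
      -- `σ 1` is `f(τ) ↦ f(γτ)` and `σ 0` is `f(τ) ↦ f(γ⁻¹τ)`
      (∀ f : A 1, (σ 1 f : Mer) = merComp gam f) ∧
      (∀ f : A 0, (σ 0 f : Mer) = merComp gam⁻¹ f) ∧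
      -- the two congruence families are equivalent
      (∀ α : ℕ, 1 ≤ α → (CongruenceAt 1 α ↔ CongruenceAt 0 α)) := by
  refine ⟨gam_mem, sigma, fun β f hf => merComp_of_mem_Ct β hf, fun β a => merComp_p β β a,
    sigma_unique, fun β f => mem_R_iff β f, fun β α hα => ⟨L_mem_R β hα, merComp_L β β hα⟩,
    fun f => rfl, fun f => rfl, fun α hα => ⟨congruenceAt_iff hα 1 0, congruenceAt_iff hα 0 1⟩⟩
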